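/- Let $(M,g)$ be a hyperkähler manifold: a smooth Riemannian manifold whose metric is Kählerian with respect to three complex structures $I,J,K$ satisfying $IJ=K=-JI$, $JK=I=-KJ$, $KI=J=-IK$. For $\eta\in\mathbb{CP}^1=\mathbb{C}\cup\{\infty\}$ put $$I_\eta=\frac{1-|\eta|^2}{1+|\eta|^2}\,I+\frac{2\,\mathrm{Re}\,\eta}{1+|\eta|^2}\,J+\frac{2\,\mathrm{Im}\,\eta}{1+|\eta|^2}\,K,\qquad I_\infty=-I,\qquad \omega_\eta(X,Y)=g(I_\eta X,Y),$$ and for $\alpha,\beta\in\mathbb{CP}^1$ let $\mathcal{J}_{\alpha,\beta}$ be the endomorphism of $TM\oplus T^*M$ $$\mathcal{J}_{\alpha,\beta}=\frac12\begin{pmatrix} -(I_\alpha+I_\beta) & -(\omega_\alpha^{-1}-\omega_\beta^{-1})\\ \omega_\alpha-\omega_\beta & I_\alpha^*+I_\beta^*\end{pmatrix},$$ where a two-form $\omega$ is regarded as the map $X\mapsto\omega(X,\cdot)$ from $TM$ to $T^*M$. On the smooth manifold $\mathcal{X}=M\times\mathbb{CP}^1\times\mathbb{CP}^1$ let $\mathcal{J}$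 be the endomorphism of $T\mathcal{X}\oplus T^*\mathcal{X}$ given at the point $(m,\alpha,\beta)$ by $$\mathcal{J}=\mathcal{J}_{\alpha,\beta}\times\mathcal{J}_{I_{\mathbb{CP}^1}}\times\mathcal{J}_{I_{\mathbb{CP}^1}},\qquad \mathcal{J}_{I_{\mathbb{CP}^1}}=\begin{pmatrix}-I_{\mathbb{CP}^1}&0\\0&I_{\mathbb{CP}^1}^*\end{pmatrix},$$ where $I_{\mathbb{CP}^1}$ is the standard complex structure of $\mathbb{CP}^1$. Then $\mathcal{J}$ is a generalized complex structure on $\mathcal{X}$. That is, $\mathcal{J}$ is smooth, it is orthogonal for the pairing $\langle X+\xi,Y+\eta\rangle=\frac12(\xi(Y)+\eta(X))$, it satisfies $\mathcal{J}^2=-1$, and its $+i$-eigenbundle $L\subset(T\mathcal{X}\oplus T^*\mathcal{X})\otimes\mathbb{C}$ is involutive for the (complex bilinear extension of the) Courant bracket $$[X+\xi,Y+\eta]=[X,Y]+\mathcal{L}_X\eta-i_Yd\xi .$$ The same holds with $\mathcal{J}_{\beta,\alpha}$ in place of $\mathcal{J}_{\alpha,\beta}$, i.e. for the structure $\mathcal{J}_{\beta,\alpha}\times\mathcal{J}_{I_{\mathbb{CP}^1}}\times\mathcal{J}_{I_{\mathbb{CP}^1}}$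 at $(m,\alpha,\beta)$. -/

import Mathlib

open scoped Manifold ContDiff Topology Bundle

noncomputable section

namespace GenTwistor

/-! ## Generalized geometry on a smooth manifold -/

section GeneralizedGeometry

variable {E : Type*} [NormedAddCommGroup E] [NormedSpace ℝ E]
  {H : Type*} [TopologicalSpace H] (I : ModelWithCorners ℝ E H)
  {M : Type*} [TopologicalSpace M] [ChartedSpace H M]

/-- The fibre `T_x M ⊕ T_x^* M` of the generalized tangent bundle. -/
abbrev GenTangentSpace (x : M) : Type _ :=
  TangentSpace I x × (TangentSpace I x →L[ℝ] ℝ)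

/-- The natural pairing `⟨X + ξ, Y + η⟩ = (ξ(Y) + η(X)) / 2`. -/
def pairing {x : M} (u v : GenTangentSpace I x) : ℝ :=
  (1 / 2) * (u.2 v.1 + v.2 u.1)

/-- A one-form read in the preferred chart at `x₀`, i.e. pulled back to the model vector space
by the inverse chart. -/
def oneFormInChart (ξ : Π x : M, TangentSpace I x →L[ℝ] ℝ) (x₀ : M) (y : E) : E →L[ℝ] ℝ :=
  (ξ ((extChartAt I x₀).symm y)).comp
    (mfderivWithin 𝓘(ℝ, E) I (extChartAt I x₀).symm (Set.range I) y)

/-- A field of bilinear forms read in the preferred chart at `x₀`, evaluated on two vectors of the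
model vector space. -/
def twoFormInChart (Ω : Π x : M, TangentSpace I x →L[ℝ] TangentSpace I x →L[ℝ] ℝ) (x₀ : M)
    (y v w : E) : ℝ :=
  let D : E →L[ℝ] TangentSpace I ((extChartAt I x₀).symm y) :=
    mfderivWithin 𝓘(ℝ, E) I (extChartAt I x₀).symm (Set.range I) y
  Ω ((extChartAt I x₀).symm y) (D v) (D w)

/-- The differential at `x` of the preferred chart at `x`. -/
def chartDeriv (x : M) : TangentSpace I x →L[ℝ] E :=
  mfderiv I 𝓘(ℝ, E) (extChartAt I x) x

/-- The exterior derivative of a one-form: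
in a chart, `dξ(v, w) = (D_v ξ)(w) - (D_w ξ)(v)`. The value at `v` is the covector `i_v dξ`. -/
def extDerivOneForm (ξ : Π x : M, TangentSpace I x →L[ℝ] ℝ) (x : M) (v : TangentSpace I x) :
    TangentSpace I x →L[ℝ] ℝ :=
  let A : E →L[ℝ] E →L[ℝ] ℝ :=
    fderivWithin ℝ (oneFormInChart I ξ x) (Set.range I) (extChartAt I x x)
  let D := chartDeriv I x
  (A (D v) - A.flip (D v)).comp D

/-- The exterior derivative of a two-form: in a chart,
`dΩ(u, v, w) = (D_u Ω)(v, w) - (D_v Ω)(u, w) + (D_w Ω)(u, v)`. -/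
def extDerivTwoForm (Ω : Π x : M, TangentSpace I x →L[ℝ] TangentSpace I x →L[ℝ] ℝ) (x : M)
    (u v w : TangentSpace I x) : ℝ :=
  let A : E → E → E → ℝ := fun a b c =>
    fderivWithin ℝ (fun y => twoFormInChart I Ω x y b c) (Set.range I) (extChartAt I x x) a
  let D := chartDeriv I x
  A (D u) (D v) (D w) - A (D v) (D u) (D w) + A (D w) (D u) (D v)

/-- The differential of a real function, as a one-form. -/
def differential (f : M → ℝ) (x : M) : TangentSpace I x →L[ℝ] ℝ :=
  mfderiv I 𝓘(ℝ, ℝ) f x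

/-- The Lie derivative of a one-form, `L_X η = i_X dη + d(η(X))`. -/
def lieDerivOneForm (X : Π x : M, TangentSpace I x) (η : Π x : M, TangentSpace I x →L[ℝ] ℝ)
    (x : M) : TangentSpace I x →L[ℝ] ℝ :=
  extDerivOneForm I η x (X x) + differential I (fun y => η y (X y)) x

/-- The (Dorfman form of the) Courant bracket
`[X + ξ, Y + η] = [X, Y] + L_X η - i_Y dξ`. -/
def courantBracket (e f : Π x : M, GenTangentSpace I x) (x : M) : GenTangentSpace I x :=
  (VectorField.mlieBracket I (fun y => (e y).1) (fun y => (f y).1) x,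
    lieDerivOneForm I (fun y => (e y).1) (fun y => (f y).2) x
      - extDerivOneForm I (fun y => (e y).2) x (f x).1)

/-- A section `re + i im` of the complexified generalized tangent bundle `(T ⊕ T^*) ⊗ ℂ`. -/
structure ComplexSection (I : ModelWithCorners ℝ E H) (M : Type*) [TopologicalSpace M]
    [ChartedSpace H M] where
  re : Π x : M, GenTangentSpace I x
  im : Π x : M, GenTangentSpace I x

/-- The complex bilinear extension of the Courant bracket. -/
def ComplexSection.bracket (e f : ComplexSection I M) : ComplexSection I M where
  re x := courantBracket I e.re f.re x - courantBracket I e.im f.im x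
  im x := courantBracket I e.re f.im x + courantBracket I e.im f.re x

/-- The value of `e` at `x` lies in the `+i`-eigenspace `L_x` of the complex linear extension of
`𝒥`: writing `e = a + i b`, the equation `𝒥 e = i e` says `𝒥 a = -b` and `𝒥 b = a`. -/
def ComplexSection.MemEigenbundle (J : Π x : M, GenTangentSpace I x →ₗ[ℝ] GenTangentSpace I x)
    (e : ComplexSection I M) (x : M) : Prop :=
  J x (e.re x) = -e.im x ∧ J x (e.im x) = e.re x

variable [IsManifold I ∞ M]

/-- Smoothness on the set `U` of a vector field. -/
def SmoothVectorFieldOn (X : Π x : M, TangentSpace I x) (U : Set M) : Prop :=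
  ContMDiffOn I I.tangent ∞ (fun x => (⟨x, X x⟩ : TangentBundle I M)) U

/-- Smoothness on the set `U` of a one-form. -/
def SmoothOneFormOn (ξ : Π x : M, TangentSpace I x →L[ℝ] ℝ) (U : Set M) : Prop :=
  ContMDiffOn I (I.prod 𝓘(ℝ, E →L[ℝ] ℝ)) ∞
    (fun x => Bundle.TotalSpace.mk' (E →L[ℝ] ℝ)
      (E := fun x : M => TangentSpace I x →L[ℝ] ℝ) x (ξ x)) U

/-- Smoothness of a section of `T ⊕ T^*` on the set `U`. -/
def SmoothGenSectionOn (e : Π x : M, GenTangentSpace I x) (U : Set M) : Prop :=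
  SmoothVectorFieldOn I (fun x => (e x).1) U ∧ SmoothOneFormOn I (fun x => (e x).2) U

/-- Smoothness of a section of `(T ⊕ T^*) ⊗ ℂ` on the set `U`. -/
def ComplexSection.SmoothOn (e : ComplexSection I M) (U : Set M) : Prop :=
  SmoothGenSectionOn I e.re U ∧ SmoothGenSectionOn I e.im U

/-- A generalized almost complex structure: a smooth orthogonal endomorphism `𝒥` of `T ⊕ T^*`
with `𝒥² = -1`. Smoothness is expressed by saying that `𝒥` maps smooth local sections to smooth
local sections. -/
structure IsGenAlmostComplex (J : Π x : M, GenTangentSpace I x →ₗ[ℝ] GenTangentSpace I x) :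
    Prop where
  smooth : ∀ (U : Set M), IsOpen U → ∀ e : Π x : M, GenTangentSpace I x,
    SmoothGenSectionOn I e U → SmoothGenSectionOn I (fun x => J x (e x)) U
  orthogonal : ∀ (x : M) (u v : GenTangentSpace I x),
    pairing I (J x u) (J x v) = pairing I u v
  sq : ∀ (x : M) (u : GenTangentSpace I x), J x (J x u) = -u

/-- The `+i`-eigenbundle `L ⊂ (T ⊕ T^*) ⊗ ℂ` is involutive: the Courant bracket of two smooth
local sections of `L` is again a section of `L`. -/
def IsInvolutive (J : Π x : M, GenTangentSpace I x →ₗ[ℝ] GenTangentSpace I x) : Prop :=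
  ∀ (U : Set M), IsOpen U → ∀ e f : ComplexSection I M,
    e.SmoothOn I U → f.SmoothOn I U →
    (∀ x ∈ U, e.MemEigenbundle I J x) → (∀ x ∈ U, f.MemEigenbundle I J x) →
    ∀ x ∈ U, (e.bracket I f).MemEigenbundle I J x

/-- A generalized complex structure: an integrable generalized almost complex structure. -/
structure IsGenComplex (J : Π x : M, GenTangentSpace I x →ₗ[ℝ] GenTangentSpace I x) :
    Prop extends IsGenAlmostComplex I J where
  involutive : IsInvolutive I J

end GeneralizedGeometry

/-! ## Linear algebra: generalized complex structures on one vector space -/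

section LinearAlgebra

variable {V W : Type*}
  [AddCommGroup V] [Module ℝ V] [TopologicalSpace V] [IsTopologicalAddGroup V]
  [ContinuousSMul ℝ V]
  [AddCommGroup W] [Module ℝ W] [TopologicalSpace W] [IsTopologicalAddGroup W]
  [ContinuousSMul ℝ W]

/-- `𝒥_I = (-I, 0; 0, I^*)` for an endomorphism `I`. -/
def genOfComplex (I : V →L[ℝ] V) : (V × (V →L[ℝ] ℝ)) →ₗ[ℝ] (V × (V →L[ℝ] ℝ)) where
  toFun u := (-I u.1, u.2.comp I)
  map_add' u v := by ext <;> simp [add_comm]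
  map_smul' c u := by ext <;> simp

/-- The block matrix
`½ (-(I₊ + I₋), -(ω₊⁻¹ - ω₋⁻¹); ω₊ - ω₋, I₊^* + I₋^*)`, where a two-form `ω` is regarded as the
map `X ↦ i_X ω = ω(X, ·)` from `V` to `V^*`. -/
def genOfBiHermitian (Ip Im : V →L[ℝ] V) (ωp ωm : V →L[ℝ] V →L[ℝ] ℝ) :
    (V × (V →L[ℝ] ℝ)) →ₗ[ℝ] (V × (V →L[ℝ] ℝ)) where
  toFun u :=
    ((1 / 2 : ℝ) • (-(Ip u.1 + Im u.1) - (ωp.inverse u.2 - ωm.inverse u.2)),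
      (1 / 2 : ℝ) • ((ωp u.1 - ωm u.1) + (u.2.comp Ip + u.2.comp Im)))
  map_add' u v := by
    ext
    · simp only [Prod.fst_add, Prod.snd_add, map_add, ← smul_add]
      congr 1; abel
    · simp; ring
  map_smul' c u := by
    ext
    · simp only [Prod.smul_fst, Prod.smul_snd, map_smul, RingHom.id_apply]
      rw [smul_comm]; congr 1; module
    · simp; ring

/-- The product `𝒥₁ × 𝒥₂` on `(V ⊕ W) ⊕ (V ⊕ W)^* = (V ⊕ V^*) ⊕ (W ⊕ W^*)`. -/
def genProd (J₁ : (V × (V →L[ℝ] ℝ)) →ₗ[ℝ] (V × (V →L[ℝ] ℝ)))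
    (J₂ : (W × (W →L[ℝ] ℝ)) →ₗ[ℝ] (W × (W →L[ℝ] ℝ))) :
    ((V × W) × (V × W →L[ℝ] ℝ)) →ₗ[ℝ] ((V × W) × (V × W →L[ℝ] ℝ)) where
  toFun u :=
    let p := J₁ (u.1.1, u.2.comp (ContinuousLinearMap.inl ℝ V W))
    let q := J₂ (u.1.2, u.2.comp (ContinuousLinearMap.inr ℝ V W))
    ((p.1, q.1), p.2.coprod q.2)
  map_add' u v := by
    have h₁ : (((u + v).1.1, (u + v).2.comp (ContinuousLinearMap.inl ℝ V W)) : V × (V →L[ℝ] ℝ))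
      = (u.1.1, u.2.comp (ContinuousLinearMap.inl ℝ V W))
        + (v.1.1, v.2.comp (ContinuousLinearMap.inl ℝ V W)) := rfl
    have h₂ : (((u + v).1.2, (u + v).2.comp (ContinuousLinearMap.inr ℝ V W)) : W × (W →L[ℝ] ℝ))
      = (u.1.2, u.2.comp (ContinuousLinearMap.inr ℝ V W))
        + (v.1.2, v.2.comp (ContinuousLinearMap.inr ℝ V W)) := rfl
    simp only [h₁, h₂, map_add]
    ext <;> simp
  map_smul' c u := by
    have h₁ : (((c • u).1.1, (c • u).2.comp (ContinuousLinearMap.inl ℝ V W)) : V × (V →L[ℝ] ℝ))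
      = c • (u.1.1, u.2.comp (ContinuousLinearMap.inl ℝ V W)) := rfl
    have h₂ : (((c • u).1.2, (c • u).2.comp (ContinuousLinearMap.inr ℝ V W)) : W × (W →L[ℝ] ℝ))
      = c • (u.1.2, u.2.comp (ContinuousLinearMap.inr ℝ V W)) := rfl
    simp only [h₁, h₂, map_smul]
    ext <;> simp

end LinearAlgebra

/-! ## The complex projective line -/

/-- The complex projective line `ℂℙ¹ = ℂ ∪ {∞}`; the point `z` stands for the line `[z : 1]` and
`∞` for `[1 : 0]`, as in `OnePoint.equivProjectivization`. -/
abbrev CP1 : Type := OnePoint ℂ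

namespace CP1

/-- The inversion `z ↦ z⁻¹` of `ℂℙ¹`, exchanging `0` and `∞`. -/
def inv (p : CP1) : CP1 :=
  p.elim ((0 : ℂ) : OnePoint ℂ) (fun z => if z = 0 then OnePoint.infty else ((z⁻¹ : ℂ) : OnePoint ℂ))

lemma inv_infty : inv OnePoint.infty = ((0 : ℂ) : OnePoint ℂ) := rfl

lemma inv_coe_zero : inv ((0 : ℂ) : OnePoint ℂ) = OnePoint.infty := by
  simp [inv]

lemma inv_coe {z : ℂ} (hz : z ≠ 0) : inv (z : OnePoint ℂ) = ((z⁻¹ : ℂ) : OnePoint ℂ) := by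
  simp [inv, hz]

lemma inv_inv (p : CP1) : inv (inv p) = p := by
  induction p using OnePoint.rec with
  | infty => rw [inv_infty, inv_coe_zero]
  | coe z =>
    by_cases hz : z = 0
    · subst hz; rw [inv_coe_zero, inv_infty]
    · rw [inv_coe hz, inv_coe (inv_ne_zero hz), _root_.inv_inv]

lemma continuous_inv : Continuous inv := by
  rw [OnePoint.continuous_iff]
  constructor
  · rw [inv_infty, Filter.coclosedCompact_eq_cocompact, ← Metric.cobounded_eq_cocompact]
    have h : Filter.Tendsto (fun z : ℂ => ((z⁻¹ : ℂ) : OnePoint ℂ)) (Bornology.cobounded ℂ)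
        (𝓝 ((0 : ℂ) : OnePoint ℂ)) :=
      (OnePoint.continuous_coe.tendsto 0).comp Filter.tendsto_inv₀_cobounded
    refine h.congr' ?_
    filter_upwards [Bornology.eventually_ne_cobounded (0 : ℂ)] with z hz
    exact (inv_coe hz).symm
  · rw [continuous_iff_continuousAt]
    intro z
    by_cases hz : z = 0
    · subst hz
      rw [continuousAt_iff_punctured_nhds, inv_coe_zero]
      have h : Filter.Tendsto (fun z : ℂ => ((z⁻¹ : ℂ) : OnePoint ℂ)) (𝓝[≠] (0 : ℂ))
          (𝓝 (OnePoint.infty : OnePoint ℂ)) := by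
        refine OnePoint.tendsto_coe_infty.comp ?_
        rw [Filter.coclosedCompact_eq_cocompact, ← Metric.cobounded_eq_cocompact]
        exact Filter.tendsto_inv₀_nhdsNE_zero
      refine h.congr' ?_
      filter_upwards [self_mem_nhdsWithin] with w hw
      exact (inv_coe hw).symm
    · have h : ContinuousAt (fun z : ℂ => ((z⁻¹ : ℂ) : OnePoint ℂ)) z :=
        OnePoint.continuous_coe.continuousAt.comp (continuousAt_inv₀ hz)
      refine h.congr ?_
      filter_upwards [isOpen_ne.mem_nhds hz] with w hw
      exact (inv_coe hw).symm

/-- The inversion as a homeomorphism. -/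
def invHomeo : CP1 ≃ₜ CP1 where
  toFun := inv
  invFun := inv
  left_inv := inv_inv
  right_inv := inv_inv
  continuous_toFun := continuous_inv
  continuous_invFun := continuous_inv

/-- The affine coordinate `z` on `ℂℙ¹ \ {∞}`. -/
def affineChart : OpenPartialHomeomorph CP1 ℂ :=
  (OnePoint.isOpenEmbedding_coe.toOpenPartialHomeomorph ((↑) : ℂ → OnePoint ℂ)).symm

/-- The coordinate `z⁻¹` on `ℂℙ¹ \ {0}`. -/
def inftyChart : OpenPartialHomeomorph CP1 ℂ :=
  invHomeo.transOpenPartialHomeomorph affineChart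

lemma affineChart_coe (z : ℂ) : affineChart (z : OnePoint ℂ) = z :=
  (OnePoint.isOpenEmbedding_coe.toOpenPartialHomeomorph ((↑) : ℂ → OnePoint ℂ)).left_inv
    (by simp)

lemma affineChart_symm (z : ℂ) : affineChart.symm z = (z : OnePoint ℂ) := rfl

lemma affineChart_source : affineChart.source = Set.range ((↑) : ℂ → OnePoint ℂ) := by
  simp [affineChart]

lemma affineChart_target : affineChart.target = Set.univ := by
  simp [affineChart]

lemma inftyChart_symm (z : ℂ) : inftyChart.symm z = inv (z : OnePoint ℂ) := rfl

lemma inftyChart_apply (p : CP1) : inftyChart p = affineChart (inv p) := rfl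

lemma inftyChart_source : inftyChart.source = inv ⁻¹' Set.range ((↑) : ℂ → OnePoint ℂ) := by
  have : inftyChart.source = inv ⁻¹' affineChart.source := rfl
  rw [this, affineChart_source]

instance : ChartedSpace ℂ CP1 where
  atlas := {affineChart, inftyChart}
  chartAt p := p.elim inftyChart (fun _ => affineChart)
  mem_chart_source p := by
    induction p using OnePoint.rec with
    | infty =>
      change _ ∈ inftyChart.source
      rw [inftyChart_source]
      exact ⟨0, rfl⟩
    | coe z =>
      change _ ∈ affineChart.source
      rw [affineChart_source]
      exact ⟨z, rfl⟩
  chart_mem_atlas p := by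
    induction p using OnePoint.rec with
    | infty => exact Or.inr rfl
    | coe z => exact Or.inl rfl

lemma isManifold_aux (𝕜 : Type*) [NontriviallyNormedField 𝕜] [NormedAlgebra 𝕜 ℂ] :
    IsManifold 𝓘(𝕜, ℂ) ω CP1 := by
  refine isManifold_of_contDiffOn _ _ _ fun e e' he he' => ?_
  have key : ∀ z : ℂ, inv (z : OnePoint ℂ) ∈ Set.range ((↑) : ℂ → OnePoint ℂ) → z ≠ 0 := by
    rintro z ⟨w, hw⟩ rfl
    rw [inv_coe_zero] at hw
    exact OnePoint.coe_ne_infty w hw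
  rcases he with rfl | rfl <;> rcases he' with rfl | rfl
  · refine contDiffOn_id.congr fun z _ => ?_
    simp [affineChart_symm, affineChart_coe]
  · have hs : ∀ z ∈ (𝓘(𝕜, ℂ).symm ⁻¹' (affineChart.symm ≫ₕ inftyChart).source ∩
        Set.range 𝓘(𝕜, ℂ)), z ≠ 0 := by
      rintro z ⟨hz, -⟩
      refine key z ?_
      have h2 : affineChart.symm z ∈ inftyChart.source := hz.2
      rwa [inftyChart_source] at h2
    refine ((contDiffOn_inv 𝕜 (𝕜' := ℂ)).mono hs).congr fun z hz => ?_
    simp [affineChart_symm, inftyChart_apply, inv_coe (hs z hz), affineChart_coe]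
  · have hs : ∀ z ∈ (𝓘(𝕜, ℂ).symm ⁻¹' (inftyChart.symm ≫ₕ affineChart).source ∩
        Set.range 𝓘(𝕜, ℂ)), z ≠ 0 := by
      rintro z ⟨hz, -⟩
      refine key z ?_
      have h2 : inftyChart.symm z ∈ affineChart.source := hz.2
      rwa [affineChart_source] at h2
    refine ((contDiffOn_inv 𝕜 (𝕜' := ℂ)).mono hs).congr fun z hz => ?_
    simp [inftyChart_symm, inv_coe (hs z hz), affineChart_coe]
  · refine contDiffOn_id.congr fun z _ => ?_
    simp [inftyChart_symm, inftyChart_apply, inv_inv, affineChart_coe]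

/-- `ℂℙ¹` is a complex manifold. -/
instance : IsManifold 𝓘(ℂ, ℂ) ω CP1 := isManifold_aux ℂ

/-- `ℂℙ¹` as a real manifold. -/
instance : IsManifold 𝓘(ℝ, ℂ) ω CP1 := isManifold_aux ℝ

end CP1

/-! ## Hyperkähler manifolds -/

section Hyperkahler

variable {E : Type*} [NormedAddCommGroup E] [NormedSpace ℝ E]
  {M : Type*} [TopologicalSpace M] [ChartedSpace E M] [IsManifold 𝓘(ℝ, E) ∞ M]

/-- A smooth Riemannian metric on `M`. -/
abbrev RiemannianMetric (E : Type*) [NormedAddCommGroup E] [NormedSpace ℝ E]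
    (M : Type*) [TopologicalSpace M] [ChartedSpace E M] [IsManifold 𝓘(ℝ, E) ∞ M] : Type _ :=
  Bundle.ContMDiffRiemannianMetric 𝓘(ℝ, E) ∞ E (fun x : M => TangentSpace 𝓘(ℝ, E) x)

/-- The field of bilinear forms `ω_A(X, Y) = g(A X, Y)` of a metric and a field of
endomorphisms. -/
def kahlerForm (g : RiemannianMetric E M)
    (A : Π x : M, TangentSpace 𝓘(ℝ, E) x →L[ℝ] TangentSpace 𝓘(ℝ, E) x) (x : M) :
    TangentSpace 𝓘(ℝ, E) x →L[ℝ] TangentSpace 𝓘(ℝ, E) x →L[ℝ] ℝ :=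
  (g.inner x).comp (A x)

/-- The metric `g` is Kählerian with respect to the complex structure `A`: `A` is a smooth
endomorphism of the tangent bundle with `A² = -1`, integrable in the sense that its Nijenhuis
tensor vanishes, orthogonal for `g`, and the form `ω_A` is closed. -/
structure IsKahler (g : RiemannianMetric E M)
    (A : Π x : M, TangentSpace 𝓘(ℝ, E) x →L[ℝ] TangentSpace 𝓘(ℝ, E) x) : Prop where
  smooth : ContMDiff 𝓘(ℝ, E) (𝓘(ℝ, E).prod 𝓘(ℝ, E →L[ℝ] E)) ∞
    (fun x => Bundle.TotalSpace.mk' (E →L[ℝ] E)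
      (E := fun x : M => TangentSpace 𝓘(ℝ, E) x →L[ℝ] TangentSpace 𝓘(ℝ, E) x) x (A x))
  sq : ∀ (x : M) (v : TangentSpace 𝓘(ℝ, E) x), A x (A x v) = -v
  integrable : ∀ (U : Set M), IsOpen U → ∀ X Y : Π x : M, TangentSpace 𝓘(ℝ, E) x,
    SmoothVectorFieldOn 𝓘(ℝ, E) X U → SmoothVectorFieldOn 𝓘(ℝ, E) Y U → ∀ x ∈ U,
      VectorField.mlieBracket 𝓘(ℝ, E) (fun y => A y (X y)) (fun y => A y (Y y)) x
        - A x (VectorField.mlieBracket 𝓘(ℝ, E) (fun y => A y (X y)) Y x)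
        - A x (VectorField.mlieBracket 𝓘(ℝ, E) X (fun y => A y (Y y)) x)
        - VectorField.mlieBracket 𝓘(ℝ, E) X Y x = 0
  orthogonal : ∀ (x : M) (v w : TangentSpace 𝓘(ℝ, E) x),
    g.inner x (A x v) (A x w) = g.inner x v w
  closed : ∀ (x : M) (u v w : TangentSpace 𝓘(ℝ, E) x),
    extDerivTwoForm 𝓘(ℝ, E) (kahlerForm g A) x u v w = 0

/-- `(M, g)` is hyperkähler with complex structures `I`, `J`, `K`: the metric is Kählerian with
respect to each of them and they satisfy the quaternion relations. -/
structure IsHyperkahler (g : RiemannianMetric E M)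
    (I J K : Π x : M, TangentSpace 𝓘(ℝ, E) x →L[ℝ] TangentSpace 𝓘(ℝ, E) x) : Prop where
  kahler_I : IsKahler g I
  kahler_J : IsKahler g J
  kahler_K : IsKahler g K
  IJ : ∀ x, (I x).comp (J x) = K x
  JI : ∀ x, (J x).comp (I x) = -K x
  JK : ∀ x, (J x).comp (K x) = I x
  KJ : ∀ x, (K x).comp (J x) = -I x
  KI : ∀ x, (K x).comp (I x) = J x
  IK : ∀ x, (I x).comp (K x) = -J x

/-! ## The generalized twistor space -/

/-- The point `((1 - |η|²), 2 Re η, 2 Im η) / (1 + |η|²)` of the unit sphere of `ℝ³`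
corresponding to `η ∈ ℂℙ¹`; the point `∞` corresponds to `(-1, 0, 0)`. -/
def spherePoint (η : CP1) : ℝ × ℝ × ℝ :=
  η.elim (-1, 0, 0) (fun z =>
    ((1 - ‖z‖ ^ 2) / (1 + ‖z‖ ^ 2), 2 * z.re / (1 + ‖z‖ ^ 2), 2 * z.im / (1 + ‖z‖ ^ 2)))

/-- The twistor family `I_η = a I + b J + c K`, where `(a, b, c) ∈ S²` corresponds to
`η ∈ ℂℙ¹`. -/
def twistorFamily (I J K : Π x : M, TangentSpace 𝓘(ℝ, E) x →L[ℝ] TangentSpace 𝓘(ℝ, E) x)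
    (η : CP1) (x : M) : TangentSpace 𝓘(ℝ, E) x →L[ℝ] TangentSpace 𝓘(ℝ, E) x :=
  (spherePoint η).1 • I x + (spherePoint η).2.1 • J x + (spherePoint η).2.2 • K x

/-- The generalized almost complex structure `𝒥_{α,β}` on `M` at the point `x`, attached to the
almost bi-Hermitian structure `(g, I₊, I₋) = (g, I_α, I_β)`. -/
def genFamily (g : RiemannianMetric E M)
    (I J K : Π x : M, TangentSpace 𝓘(ℝ, E) x →L[ℝ] TangentSpace 𝓘(ℝ, E) x)
    (α β : CP1) (x : M) :
    GenTangentSpace 𝓘(ℝ, E) x →ₗ[ℝ] GenTangentSpace 𝓘(ℝ, E) x :=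
  genOfBiHermitian (twistorFamily I J K α x) (twistorFamily I J K β x)
    (kahlerForm g (twistorFamily I J K α) x) (kahlerForm g (twistorFamily I J K β) x)

/-- The standard complex structure of `ℂℙ¹`: multiplication by `i` on the tangent space, which is
identified with `ℂ` by a holomorphic coordinate. -/
def cp1ComplexStructure (p : CP1) : TangentSpace 𝓘(ℝ, ℂ) p →L[ℝ] TangentSpace 𝓘(ℝ, ℂ) p :=
  (Complex.I • ContinuousLinearMap.id ℝ ℂ : ℂ →L[ℝ] ℂ)

/-- The model with corners of the smooth manifold `M × ℂℙ¹ × ℂℙ¹`. -/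
abbrev twistorModel (E : Type*) [NormedAddCommGroup E] [NormedSpace ℝ E] :
    ModelWithCorners ℝ (E × ℂ × ℂ) (ModelProd E (ModelProd ℂ ℂ)) :=
  𝓘(ℝ, E).prod (𝓘(ℝ, ℂ).prod 𝓘(ℝ, ℂ))

/-- The endomorphism field `𝒥 = F_{α,β} × 𝒥_{I_{ℂℙ¹}} × 𝒥_{I_{ℂℙ¹}}` of `T ⊕ T^*` on
`M × ℂℙ¹ × ℂℙ¹`, at the point `(m, α, β)`, whose tangent space is
`T_m M × T_α ℂℙ¹ × T_β ℂℙ¹`, for a family `F_{α,β}` of endomorphism fields on `M`. -/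
def twistorStructure
    (F : CP1 → CP1 → Π x : M, GenTangentSpace 𝓘(ℝ, E) x →ₗ[ℝ] GenTangentSpace 𝓘(ℝ, E) x)
    (p : M × CP1 × CP1) :
    GenTangentSpace (twistorModel E) p →ₗ[ℝ] GenTangentSpace (twistorModel E) p :=
  genProd (V := TangentSpace 𝓘(ℝ, E) p.1)
    (W := TangentSpace 𝓘(ℝ, ℂ) p.2.1 × TangentSpace 𝓘(ℝ, ℂ) p.2.2)
    (F p.2.1 p.2.2 p.1)
    (genProd (genOfComplex (cp1ComplexStructure p.2.1))
      (genOfComplex (cp1ComplexStructure p.2.2)))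

end Hyperkahler

end GenTwistor

end

/-! The Courant bracket at a point depends only on the values and first derivatives of the two
sections there. A section of `L` has the form `a - i𝒥a` with `a` real, and `[a - i𝒥a, c - i𝒥c]` lies
in `L` exactly when `[𝒥a, c] + [a, 𝒥c] = 𝒥([a, c] - [𝒥a, 𝒥c])`. Involutivity therefore reduces to a
pointwise identity in the 1-jet of `𝒥` in a chart (`JetIntegrable`,
`isInvolutive_of_jetIntegrable`).

The partial derivatives in the bracket may be replaced by covariant derivatives of any torsion-free
connection (`jetBracket_add_connAct`). On `M × ℂℙ¹ × ℂℙ¹` the connection is Levi-Civita on `M` and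
flat in a holomorphic chart of `ℂℙ¹ × ℂℙ¹`. Closedness of the Kähler forms and integrability make
`I`, `J`, `K` parallel (`kahler_parallel`). Hence `∇𝒥` vanishes along `M`, and along a vector `ν`
tangent to `ℂℙ¹ × ℂℙ¹` it comes only from the variation of `I_α` and `I_β` with the parameters
(`fderiv_biHermitian`).

That variation is holomorphic. For unit `s` in `S²`, the stereographic parametrization satisfies
`ds(iν) = s × ds(ν)`, and imaginary quaternions multiply by the cross product. So `dI(ν) = -I
dI(iν)` (`IsHolomorphicJet.quatL_eq`). On the graphs of `g` and `-g`, which span `T ⊕ T^*`, the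
structure `𝒥_{α,β}` acts as `-I_β` and `-I_α` (`biHermitian_split`), so `∇_ν 𝒥 = 𝒥 ∇_{iν} 𝒥`.
Together with the fact that `𝒥` acts on the `ℂℙ¹` directions as the structure of a complex manifold,
this makes every term of the Nijenhuis identity cancel (`jetIntegrable_of_connection`).

Orthogonality and `𝒥² = -1` are read off from the same splitting. Smoothness follows because `𝒥` is
given in charts by a smooth matrix function (`representedBy_twistorInChart`). -/

noncomputable section

namespace GenTwistor

/-! ### Fields, smoothness and the Courant bracket in a chart -/

section ChartRepresentation

variable {E : Type*} [NormedAddCommGroup E] [NormedSpace ℝ E]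
  {H : Type*} [TopologicalSpace H] (I : ModelWithCorners ℝ E H)
  {M : Type*} [TopologicalSpace M] [ChartedSpace H M] [IsManifold I ∞ M]

/-- A vector field read in the preferred chart at `x₀`. -/
def vecInChart (X : Π x : M, TangentSpace I x) (x₀ : M) (y : E) : E :=
  tangentCoordChange I ((extChartAt I x₀).symm y) x₀ ((extChartAt I x₀).symm y)
    (X ((extChartAt I x₀).symm y))

/-- A one-form read in the preferred chart at `x₀`. -/
def covInChart (ξ : Π x : M, TangentSpace I x →L[ℝ] ℝ) (x₀ : M) (y : E) : E →L[ℝ] ℝ :=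
  ContinuousLinearMap.comp (ξ ((extChartAt I x₀).symm y) : E →L[ℝ] ℝ)
    (tangentCoordChange I x₀ ((extChartAt I x₀).symm y) ((extChartAt I x₀).symm y))

variable {I}

lemma contDiffAt_congr {V F : Type*} [NormedAddCommGroup V] [NormedSpace ℝ V]
    [NormedAddCommGroup F] [NormedSpace ℝ F] {f g : V → F} {x : V} {n : WithTop ℕ∞}
    (h : f =ᶠ[𝓝 x] g) : ContDiffAt ℝ n f x ↔ ContDiffAt ℝ n g x :=
  ⟨fun hf => hf.congr_of_eventuallyEq h.symm, fun hg => hg.congr_of_eventuallyEq h⟩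

/-- `TangentSpace I x` is the model space, read through the preferred chart at `x` itself. So at the
centre of a chart the value of a field agrees with its chart expression. -/
lemma tangentCoordChange_same (x : M) :
    tangentCoordChange I x x x = ContinuousLinearMap.id ℝ E := by
  ext v
  exact tangentCoordChange_self (mem_extChartAt_source x)

lemma tangentCoordChange_left_inv {x₀ p : M} (hp : p ∈ (extChartAt I x₀).source) :
    (tangentCoordChange I p x₀ p).comp (tangentCoordChange I x₀ p p) =
      ContinuousLinearMap.id ℝ E := by
  ext v
  have := tangentCoordChange_comp (I := I) (w := x₀) (x := p) (y := x₀) (z := p) (v := v)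
    ⟨⟨hp, mem_extChartAt_source p⟩, hp⟩
  exact this.trans (tangentCoordChange_self hp)

lemma tangentCoordChange_right_inv {x₀ p : M} (hp : p ∈ (extChartAt I x₀).source) :
    (tangentCoordChange I x₀ p p).comp (tangentCoordChange I p x₀ p) =
      ContinuousLinearMap.id ℝ E := by
  ext v
  have := tangentCoordChange_comp (I := I) (w := p) (x := x₀) (y := p) (z := p) (v := v)
    ⟨⟨mem_extChartAt_source p, hp⟩, mem_extChartAt_source p⟩
  exact this.trans (tangentCoordChange_self (mem_extChartAt_source (I := I) p))

lemma inverse_tangentCoordChange {x₀ p : M} (hp : p ∈ (extChartAt I x₀).source) :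
    (tangentCoordChange I x₀ p p).inverse = tangentCoordChange I p x₀ p :=
  ContinuousLinearMap.inverse_eq (tangentCoordChange_right_inv hp) (tangentCoordChange_left_inv hp)

lemma mfderivWithin_extChartAt_symm_eq {x₀ : M} {y : E} (hy : y ∈ (extChartAt I x₀).target) :
    (mfderivWithin 𝓘(ℝ, E) I (extChartAt I x₀).symm (Set.range I) y : E →L[ℝ] E) =
      tangentCoordChange I x₀ ((extChartAt I x₀).symm y) ((extChartAt I x₀).symm y) := by
  have hp : (extChartAt I x₀).symm y ∈ (chartAt H x₀).source := by
    rw [← extChartAt_source I]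
    exact (extChartAt I x₀).map_target hy
  have h1 := TangentBundle.symmL_trivializationAt (I := I) hp
  rw [(extChartAt I x₀).right_inv hy] at h1
  rw [TangentBundle.symmL_trivializationAt_eq_core hp] at h1
  exact h1.symm

lemma mfderiv_extChartAt_eq {x₀ p : M} (hp : p ∈ (extChartAt I x₀).source) :
    (mfderiv I 𝓘(ℝ, E) (extChartAt I x₀) p : E →L[ℝ] E) = tangentCoordChange I p x₀ p := by
  have hp' : p ∈ (chartAt H x₀).source := by rwa [← extChartAt_source I]
  have h1 := TangentBundle.continuousLinearMapAt_trivializationAt (I := I) hp'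
  rw [TangentBundle.continuousLinearMapAt_trivializationAt_eq_core hp'] at h1
  exact h1.symm

lemma chartDeriv_eq (x : M) : (chartDeriv I x : E →L[ℝ] E) = ContinuousLinearMap.id ℝ E :=
  (mfderiv_extChartAt_eq (mem_extChartAt_source x)).trans (tangentCoordChange_same x)

lemma oneFormInChart_eq (ξ : Π x : M, TangentSpace I x →L[ℝ] ℝ) {x₀ : M} {y : E}
    (hy : y ∈ (extChartAt I x₀).target) : oneFormInChart I ξ x₀ y = covInChart I ξ x₀ y := by
  unfold oneFormInChart covInChart
  exact congrArg (ContinuousLinearMap.comp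
    (ξ ((extChartAt I x₀).symm y) : E →L[ℝ] ℝ)) (mfderivWithin_extChartAt_symm_eq hy)

lemma mpullbackWithin_extChartAt_symm_eq (X : Π x : M, TangentSpace I x) {x₀ : M} {y : E}
    (hy : y ∈ (extChartAt I x₀).target) :
    (VectorField.mpullbackWithin 𝓘(ℝ, E) I (extChartAt I x₀).symm X (Set.range I) y : E) =
      vecInChart I X x₀ y := by
  have hp := (extChartAt I x₀).map_target hy
  let v : E := X ((extChartAt I x₀).symm y)
  exact (congrArg (fun L : E →L[ℝ] E => L.inverse v) (mfderivWithin_extChartAt_symm_eq hy)).trans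
    (congrArg (fun L : E →L[ℝ] E => L v) (inverse_tangentCoordChange hp))

lemma vecInChart_self (X : Π x : M, TangentSpace I x) (x : M) :
    vecInChart I X x (extChartAt I x x) = X x := by
  unfold vecInChart
  rw [extChartAt_to_inv, tangentCoordChange_same]
  rfl

lemma covInChart_self (ξ : Π x : M, TangentSpace I x →L[ℝ] ℝ) (x : M) :
    covInChart I ξ x (extChartAt I x x) = ξ x := by
  unfold covInChart
  rw [extChartAt_to_inv, tangentCoordChange_same]
  rfl

lemma covInChart_apply_vecInChart (ξ : Π x : M, TangentSpace I x →L[ℝ] ℝ)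
    (X : Π x : M, TangentSpace I x) {x₀ : M} {y : E} (hy : y ∈ (extChartAt I x₀).target) :
    covInChart I ξ x₀ y (vecInChart I X x₀ y) =
      ξ ((extChartAt I x₀).symm y) (X ((extChartAt I x₀).symm y)) := by
  have h := congrArg (fun L : E →L[ℝ] E => L (X ((extChartAt I x₀).symm y)))
    (tangentCoordChange_right_inv (I := I) ((extChartAt I x₀).map_target hy))
  exact congrArg (ξ ((extChartAt I x₀).symm y) : E →L[ℝ] ℝ) h

variable [I.Boundaryless]

omit [IsManifold I ∞ M] in
lemma contMDiffAt_iff_contDiffAt_chart {F : Type*} [NormedAddCommGroup F] [NormedSpace ℝ F]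
    {f : M → F} {x : M} {n : WithTop ℕ∞} :
    ContMDiffAt I 𝓘(ℝ, F) n f x ↔
      ContDiffAt ℝ n (f ∘ (extChartAt I x).symm) (extChartAt I x x) := by
  rw [contMDiffAt_iff_source, I.range_eq_univ, contMDiffWithinAt_univ, contMDiffAt_iff_contDiffAt]

lemma contMDiffAt_vectorField_iff {X : Π x : M, TangentSpace I x} {x : M} :
    ContMDiffAt I I.tangent ∞ (fun x => (⟨x, X x⟩ : TangentBundle I M)) x ↔
      ContDiffAt ℝ ∞ (vecInChart I X x) (extChartAt I x x) := by
  rw [Bundle.contMDiffAt_section, contMDiffAt_iff_contDiffAt_chart]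
  refine contDiffAt_congr ?_
  exact Filter.Eventually.of_forall fun _ => rfl

lemma contMDiffAt_oneForm_iff {ξ : Π x : M, TangentSpace I x →L[ℝ] ℝ} {x : M} :
    ContMDiffAt I (I.prod 𝓘(ℝ, E →L[ℝ] ℝ)) ∞
    (fun x => Bundle.TotalSpace.mk' (E →L[ℝ] ℝ)
      (E := fun x : M => TangentSpace I x →L[ℝ] ℝ) x (ξ x)) x ↔
      ContDiffAt ℝ ∞ (covInChart I ξ x) (extChartAt I x x) := by
  rw [contMDiffAt_hom_bundle]
  refine (and_iff_right contMDiffAt_id).trans ?_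
  rw [contMDiffAt_iff_contDiffAt_chart]
  refine contDiffAt_congr ?_
  filter_upwards [extChartAt_target_mem_nhds (I := I) x] with y hy
  have hp : (extChartAt I x).symm y ∈ (chartAt H x).source := by
    rw [← extChartAt_source I]
    exact (extChartAt I x).map_target hy
  ext v
  simp only [Function.comp_apply, ContinuousLinearMap.inCoordinates,
    TangentBundle.symmL_trivializationAt_eq_core hp, covInChart]
  simp

theorem smoothVectorFieldOn_iff {X : Π x : M, TangentSpace I x} {U : Set M} (hU : IsOpen U) :
    SmoothVectorFieldOn I X U ↔
      ∀ x ∈ U, ContDiffAt ℝ ∞ (vecInChart I X x) (extChartAt I x x) :=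
  forall₂_congr fun _ hx =>
    ⟨fun h => contMDiffAt_vectorField_iff.1 (h.contMDiffAt (hU.mem_nhds hx)),
      fun h => (contMDiffAt_vectorField_iff.2 h).contMDiffWithinAt⟩

theorem smoothOneFormOn_iff {ξ : Π x : M, TangentSpace I x →L[ℝ] ℝ} {U : Set M} (hU : IsOpen U) :
    SmoothOneFormOn I ξ U ↔
      ∀ x ∈ U, ContDiffAt ℝ ∞ (covInChart I ξ x) (extChartAt I x x) :=
  forall₂_congr fun _ hx =>
    ⟨fun h => contMDiffAt_oneForm_iff.1 (h.contMDiffAt (hU.mem_nhds hx)),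
      fun h => (contMDiffAt_oneForm_iff.2 h).contMDiffWithinAt⟩

variable (I) in
/-- A section of `T ⊕ T^*` read in the preferred chart at `x₀`. -/
def genInChart (e : Π x : M, GenTangentSpace I x) (x₀ : M) (y : E) : E × (E →L[ℝ] ℝ) :=
  (vecInChart I (fun x => (e x).1) x₀ y, covInChart I (fun x => (e x).2) x₀ y)

theorem smoothGenSectionOn_iff {e : Π x : M, GenTangentSpace I x} {U : Set M} (hU : IsOpen U) :
    SmoothGenSectionOn I e U ↔
      ∀ x ∈ U, ContDiffAt ℝ ∞ (genInChart I e x) (extChartAt I x x) := by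
  unfold SmoothGenSectionOn
  rw [smoothVectorFieldOn_iff hU, smoothOneFormOn_iff hU]
  refine ⟨fun h x hx => (h.1 x hx).prodMk (h.2 x hx), fun h => ⟨fun x hx => ?_, fun x hx => ?_⟩⟩
  · exact (h x hx).fst
  · exact (h x hx).snd

/-- The Courant bracket of two sections of `V ⊕ V^*` at a point of a vector space `V`,
in terms of their values `a`, `c` and derivatives `a'`, `c'`. -/
def jetBracket {V : Type*} [NormedAddCommGroup V] [NormedSpace ℝ V]
    (a : V × (V →L[ℝ] ℝ)) (a' : V →L[ℝ] V × (V →L[ℝ] ℝ))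
    (c : V × (V →L[ℝ] ℝ)) (c' : V →L[ℝ] V × (V →L[ℝ] ℝ)) : V × (V →L[ℝ] ℝ) :=
  ((c' a.1).1 - (a' c.1).1,
    (c' a.1).2 + c.2.comp ((ContinuousLinearMap.fst ℝ V (V →L[ℝ] ℝ)).comp a')
      - (a' c.1).2 + ((ContinuousLinearMap.snd ℝ V (V →L[ℝ] ℝ)).comp a').flip c.1)

/-- The bracket on the manifold is the flat bracket of the pulled-back fields, pushed forward by the
inverse of the derivative of the chart; that derivative is the identity at the centre. -/
lemma mlieBracket_eq_lieBracket (X Y : Π x : M, TangentSpace I x) (x : M) :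
    VectorField.mlieBracket I X Y x =
      VectorField.lieBracket ℝ (vecInChart I X x) (vecInChart I Y x) (extChartAt I x x) := by
  have hev : ∀ Z : Π x : M, TangentSpace I x,
      (VectorField.mpullbackWithin 𝓘(ℝ, E) I (extChartAt I x).symm Z (Set.range I) : E → E)
        =ᶠ[𝓝 (extChartAt I x x)] vecInChart I Z x := fun Z => by
    filter_upwards [extChartAt_target_mem_nhds (I := I) x] with y hy
    exact mpullbackWithin_extChartAt_symm_eq Z hy
  have h1 : (VectorField.lieBracketWithin ℝ
      (VectorField.mpullbackWithin 𝓘(ℝ, E) I (extChartAt I x).symm X (Set.range I) : E → E)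
      (VectorField.mpullbackWithin 𝓘(ℝ, E) I (extChartAt I x).symm Y (Set.range I) : E → E)
      ((extChartAt I x).symm ⁻¹' Set.univ ∩ Set.range I)) (extChartAt I x x) =
      VectorField.lieBracket ℝ (vecInChart I X x) (vecInChart I Y x) (extChartAt I x x) := by
    have key : ∀ (A B : E → E) (S : Set E), S = Set.univ →
        A =ᶠ[𝓝 (extChartAt I x x)] vecInChart I X x → B =ᶠ[𝓝 (extChartAt I x x)] vecInChart I Y x →
        VectorField.lieBracketWithin ℝ A B S (extChartAt I x x) =
          VectorField.lieBracket ℝ (vecInChart I X x) (vecInChart I Y x) (extChartAt I x x) := by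
      rintro A B S rfl hA hB
      rw [VectorField.lieBracketWithin_univ]
      exact hA.lieBracket_vectorField_eq hB
    exact key _ _ _ (by rw [I.range_eq_univ, Set.preimage_univ, Set.inter_univ]) (hev X) (hev Y)
  have h2 : ((mfderiv I 𝓘(ℝ, E) (extChartAt I x) x : E →L[ℝ] E)).inverse =
      ContinuousLinearMap.id ℝ E := by
    rw [show (mfderiv I 𝓘(ℝ, E) (extChartAt I x) x : E →L[ℝ] E) = ContinuousLinearMap.id ℝ E from
      chartDeriv_eq x]
    exact ContinuousLinearMap.inverse_id
  exact (congrArg (fun L : E →L[ℝ] E => L _) h2).trans h1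

lemma extDerivOneForm_eq (ξ : Π x : M, TangentSpace I x →L[ℝ] ℝ) (x : M)
    (v : TangentSpace I x) :
    (extDerivOneForm I ξ x v : E →L[ℝ] ℝ) =
      (fderiv ℝ (covInChart I ξ x) (extChartAt I x x) : E →L[ℝ] E →L[ℝ] ℝ) v -
        (fderiv ℝ (covInChart I ξ x) (extChartAt I x x)).flip v := by
  have h1 : fderivWithin ℝ (oneFormInChart I ξ x) (Set.range I) (extChartAt I x x) =
      fderiv ℝ (covInChart I ξ x) (extChartAt I x x) := by
    rw [I.range_eq_univ, fderivWithin_univ]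
    refine Filter.EventuallyEq.fderiv_eq ?_
    filter_upwards [extChartAt_target_mem_nhds (I := I) x] with y hy
    exact oneFormInChart_eq ξ hy
  have key : ∀ (A : E →L[ℝ] E →L[ℝ] ℝ) (D : E →L[ℝ] E) (v : E),
      D = ContinuousLinearMap.id ℝ E → (A (D v) - A.flip (D v)).comp D = A v - A.flip v := by
    rintro A D v rfl
    rfl
  rw [← h1]
  exact key _ (chartDeriv I x) v (chartDeriv_eq x)

omit [IsManifold I ∞ M] in
omit [I.Boundaryless] in
lemma differential_eq {f : M → ℝ} {x : M}
    (hf : DifferentiableAt ℝ (f ∘ (extChartAt I x).symm) (extChartAt I x x)) :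
    (differential I f x : E →L[ℝ] ℝ) =
      fderiv ℝ (f ∘ (extChartAt I x).symm) (extChartAt I x x) := by
  have h : HasMFDerivAt I 𝓘(ℝ, ℝ) f x
      (fderiv ℝ (f ∘ (extChartAt I x).symm) (extChartAt I x x)) := by
    refine ⟨?_, ?_⟩
    · have h1 : ContinuousAt ((f ∘ (extChartAt I x).symm) ∘ extChartAt I x) x :=
        ContinuousAt.comp hf.continuousAt (continuousAt_extChartAt x)
      refine h1.congr ?_
      filter_upwards [extChartAt_source_mem_nhds (I := I) x] with p hp
      exact congrArg f ((extChartAt I x).left_inv hp)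
    · exact hf.hasFDerivAt.hasFDerivWithinAt
  exact h.mfderiv

/-- Reduces the bracket to linear algebra on 1-jets. In `i_X dη + d(η(X))` the two terms `(D_Z
η)(X)` cancel, which leaves `D_X η + η ∘ DX`. Differentiability is needed for the product rule on
`η(X)`. -/
theorem courantBracket_eq_jetBracket {e f : Π x : M, GenTangentSpace I x} {x : M}
    (he : DifferentiableAt ℝ (genInChart I e x) (extChartAt I x x))
    (hf : DifferentiableAt ℝ (genInChart I f x) (extChartAt I x x)) :
    courantBracket I e f x =
      jetBracket (genInChart I e x (extChartAt I x x))
        (fderiv ℝ (genInChart I e x) (extChartAt I x x))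
        (genInChart I f x (extChartAt I x x))
        (fderiv ℝ (genInChart I f x) (extChartAt I x x)) := by
  set X := vecInChart I (fun x => (e x).1) x with hX
  set ξ := covInChart I (fun x => (e x).2) x with hξ
  set Y := vecInChart I (fun x => (f x).1) x with hY
  set η := covInChart I (fun x => (f x).2) x with hη
  set y₀ := extChartAt I x x with hy₀
  have dX : DifferentiableAt ℝ X y₀ := he.fst
  have dξ : DifferentiableAt ℝ ξ y₀ := he.snd
  have dY : DifferentiableAt ℝ Y y₀ := hf.fst
  have dη : DifferentiableAt ℝ η y₀ := hf.snd
  have he' : fderiv ℝ (genInChart I e x) y₀ = (fderiv ℝ X y₀).prod (fderiv ℝ ξ y₀) :=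
    dX.fderiv_prodMk dξ
  have hf' : fderiv ℝ (genInChart I f x) y₀ = (fderiv ℝ Y y₀).prod (fderiv ℝ η y₀) :=
    dY.fderiv_prodMk dη
  have heq : (fun y : M => (f y).2 (e y).1) ∘ (extChartAt I x).symm =ᶠ[𝓝 y₀]
      fun y => η y (X y) := by
    filter_upwards [extChartAt_target_mem_nhds (I := I) x] with y hy
    exact (covInChart_apply_vecInChart (fun x => (f x).2) (fun x => (e x).1) hy).symm
  have hd : (differential I (fun y : M => (f y).2 (e y).1) x : E →L[ℝ] ℝ) =
      (fderiv ℝ η y₀).flip (X y₀) + (η y₀).comp (fderiv ℝ X y₀) := by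
    rw [differential_eq ((dη.clm_apply dX).congr_of_eventuallyEq heq), heq.fderiv_eq,
      fderiv_clm_apply dη dX]
    exact add_comm _ _
  have hx1 : (e x).1 = X y₀ := (vecInChart_self (fun x => (e x).1) x).symm
  have hx2 : (f x).1 = Y y₀ := (vecInChart_self (fun x => (f x).1) x).symm
  have d1 := extDerivOneForm_eq (fun x => (f x).2) x (e x).1
  have d2 := extDerivOneForm_eq (fun x => (e x).2) x (f x).1
  have hb := mlieBracket_eq_lieBracket (fun x => (e x).1) (fun x => (f x).1) x
  rw [he', hf']
  refine Prod.ext ?_ ?_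
  · exact hb
  · have := congrArg₂ (fun a b : E →L[ℝ] ℝ => a - b)
      (congrArg₂ (fun a b : E →L[ℝ] ℝ => a + b) d1 hd) d2
    refine this.trans ?_
    rw [hx1, hx2]
    ext Z
    change (fderiv ℝ η y₀ (X y₀) Z - fderiv ℝ η y₀ Z (X y₀) + (fderiv ℝ η y₀ Z (X y₀) +
      η y₀ (fderiv ℝ X y₀ Z)) - (fderiv ℝ ξ y₀ (Y y₀) Z - fderiv ℝ ξ y₀ Z (Y y₀))) =
      fderiv ℝ η y₀ (X y₀) Z + η y₀ (fderiv ℝ X y₀ Z) - fderiv ℝ ξ y₀ (Y y₀) Z +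
        fderiv ℝ ξ y₀ Z (Y y₀)
    ring

end ChartRepresentation

/-! ### The Nijenhuis identity on 1-jets -/

section JetAlgebra

set_option maxSynthPendingDepth 3

variable {V : Type*} [NormedAddCommGroup V] [NormedSpace ℝ V]

/-- Twice the natural pairing with `c`, as a linear form on `V ⊕ V^*`. -/
def pairL (c : V × (V →L[ℝ] ℝ)) : V × (V →L[ℝ] ℝ) →L[ℝ] ℝ :=
  (ContinuousLinearMap.apply ℝ ℝ c.1).comp (ContinuousLinearMap.snd ℝ V (V →L[ℝ] ℝ)) +
    c.2.comp (ContinuousLinearMap.fst ℝ V (V →L[ℝ] ℝ))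

lemma pairL_apply (c u : V × (V →L[ℝ] ℝ)) : pairL c u = u.2 c.1 + c.2 u.1 := rfl

/-- Separates the antisymmetrized derivative from the covector `T ↦ 2⟨D_T a, c⟩`. In this form an
endomorphism that is skew for the pairing can be moved across. -/
lemma jetBracket_eq (a c : V × (V →L[ℝ] ℝ)) (a' c' : V →L[ℝ] V × (V →L[ℝ] ℝ)) :
    jetBracket a a' c c' = c' a.1 - a' c.1 + (0, (pairL c).comp a') := by
  refine Prod.ext ?_ ?_
  · simp [jetBracket]
  · ext Z
    simp [jetBracket, pairL_apply]
    ring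

/-- The derivative of the action on `V ⊕ V^*` of the connection form `Γ`. -/
def connAct (Γ : V →L[ℝ] V →L[ℝ] V) (a : V × (V →L[ℝ] ℝ)) : V →L[ℝ] V × (V →L[ℝ] ℝ) :=
  (Γ.flip a.1).prod (-((ContinuousLinearMap.compL ℝ V V ℝ a.2).comp Γ))

lemma connAct_apply (Γ : V →L[ℝ] V →L[ℝ] V) (a : V × (V →L[ℝ] ℝ)) (T : V) :
    connAct Γ a T = (Γ T a.1, -(a.2.comp (Γ T))) := rfl

/-- The Courant bracket may be computed with any torsion-free connection. -/
lemma jetBracket_add_connAct {Γ : V →L[ℝ] V →L[ℝ] V} (hΓ : ∀ v w, Γ v w = Γ w v)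
    (a c : V × (V →L[ℝ] ℝ)) (a' c' : V →L[ℝ] V × (V →L[ℝ] ℝ)) :
    jetBracket a (a' + connAct Γ a) c (c' + connAct Γ c) = jetBracket a a' c c' := by
  simp only [jetBracket_eq]
  refine Prod.ext ?_ ?_
  · simp [connAct_apply, hΓ c.1 a.1]
  · ext Z
    simp [connAct_apply, pairL_apply, hΓ Z]
    ring

/-- The vanishing of the Nijenhuis tensor of a field of endomorphisms of `V ⊕ V^*` with value
`J` and derivative `J'` at a point. -/
def JetIntegrable (J : V × (V →L[ℝ] ℝ) →L[ℝ] V × (V →L[ℝ] ℝ))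
    (J' : V →L[ℝ] V × (V →L[ℝ] ℝ) →L[ℝ] V × (V →L[ℝ] ℝ)) : Prop :=
  ∀ (a c : V × (V →L[ℝ] ℝ)) (a' c' : V →L[ℝ] V × (V →L[ℝ] ℝ)),
    jetBracket (J a) (J'.flip a + J.comp a') c c' + jetBracket a a' (J c) (J'.flip c + J.comp c') =
      J (jetBracket a a' c c' -
        jetBracket (J a) (J'.flip a + J.comp a') (J c) (J'.flip c + J.comp c'))

/-- The algebraic core. Here `P` projects to the parameter directions `N` with complex structure
`i`, and `hQ` says that the covariant derivative `∇_T J` is `R (P T)`. The condition `hR` is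
holomorphic dependence on the parameter; `hP` and `hcov` say that `J` induces `-i` on `N` and `i^*`
on covectors pulled back from `N`. Terms with `∇a` and `∇c` cancel because `J` is skew with square
`-1`; terms with `R` cancel by holomorphy. -/
theorem jetIntegrable_of_connection {N : Type*} [NormedAddCommGroup N] [NormedSpace ℝ N]
    {J : V × (V →L[ℝ] ℝ) →L[ℝ] V × (V →L[ℝ] ℝ)}
    {J' : V →L[ℝ] V × (V →L[ℝ] ℝ) →L[ℝ] V × (V →L[ℝ] ℝ)}
    (hsq : ∀ u, J (J u) = -u) (hskew : ∀ u v, pairL v (J u) = -pairL (J v) u)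
    {Γ : V →L[ℝ] V →L[ℝ] V} (hΓ : ∀ v w, Γ v w = Γ w v)
    (P : V →L[ℝ] N) (i : N →L[ℝ] N)
    (R : N →L[ℝ] V × (V →L[ℝ] ℝ) →L[ℝ] V × (V →L[ℝ] ℝ))
    (hQ : ∀ T u, J' T u + connAct Γ (J u) T - J (connAct Γ u T) = R (P T) u)
    (hR : ∀ S u, R S u = J (R (i S) u))
    (hP : ∀ u, P (J u).1 = -i (P u.1))
    (hcov : ∀ σ : N →L[ℝ] ℝ, J (0, σ.comp P) = (0, (σ.comp i).comp P)) :
    JetIntegrable J J' := by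
  intro a c a' c'
  set b' := a' + connAct Γ a with hb'
  set d' := c' + connAct Γ c with hd'
  have hQ' : ∀ (u : V × (V →L[ℝ] ℝ)) (u' : V →L[ℝ] V × (V →L[ℝ] ℝ)),
      J'.flip u + J.comp u' + connAct Γ (J u) =
        (R.flip u).comp P + J.comp (u' + connAct Γ u) := by
    intro u u'
    refine ContinuousLinearMap.ext fun T => ?_
    have := hQ T u
    simp only [add_apply, ContinuousLinearMap.comp_apply,
      ContinuousLinearMap.flip_apply, map_add, ← this]
    abel
  -- All four brackets are now computed with `∇`, where `∇(J u) = R u + J ∇u`.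
  rw [← jetBracket_add_connAct hΓ (J a), ← jetBracket_add_connAct hΓ a c,
    ← jetBracket_add_connAct hΓ a (J c), ← jetBracket_add_connAct hΓ (J a) (J c),
    hQ', hQ', ← hb', ← hd']
  have hRi : ∀ S u, J (R S u) = -R (i S) u := fun S u => by rw [hR S, hsq]
  have hRii : ∀ S u, R (i (i S)) u = -R S u := fun S u => by rw [hR S, hRi, neg_neg]
  have e1 : (pairL c).comp ((R.flip a).comp P + J.comp b') + (pairL (J c)).comp b' =
      ((pairL c).comp (R.flip a)).comp P := by
    ext T
    simp [hskew]
  have e2 : (pairL (J c)).comp ((R.flip a).comp P + J.comp b') - (pairL c).comp b' =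
      ((pairL (J c)).comp (R.flip a)).comp P := by
    ext T
    have : pairL (J c) (J (b' T)) = pairL c (b' T) := by
      have h := hskew (J (b' T)) c
      rw [hsq, map_neg] at h
      linarith
    simp [this]
  -- This covector is pulled back from `N`, so `J` replaces `P T` by `i (P T)`; skewness then moves
  -- `J` onto `R (i (P T)) a`, and `hR` turns the result into `R (P T) a`.
  have e3 : J (0, ((pairL (J c)).comp (R.flip a)).comp P) =
      -(0, ((pairL c).comp (R.flip a)).comp P) := by
    rw [hcov]
    refine Prod.ext (by simp) ?_
    ext T
    have h := hskew (R (i (P T)) a) c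
    rw [← hR] at h
    simp [h]
  have e4 : ∀ σ τ : V →L[ℝ] ℝ, ((0, σ) : V × (V →L[ℝ] ℝ)) + (0, τ) = (0, σ + τ) := by simp
  have e5 : ∀ σ τ : V →L[ℝ] ℝ, ((0, σ) : V × (V →L[ℝ] ℝ)) - (0, τ) = (0, σ - τ) := by simp
  simp only [jetBracket_eq]
  have e6 := congrArg (fun σ : V →L[ℝ] ℝ => ((0, σ) : V × (V →L[ℝ] ℝ))) e1
  have e7 := congrArg (fun σ : V →L[ℝ] ℝ => J ((0, σ) : V × (V →L[ℝ] ℝ))) e2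
  simp only [← e4, ← e5, map_sub] at e6 e7
  rw [e3] at e7
  simp only [map_sub, map_add, add_apply, ContinuousLinearMap.comp_apply,
    ContinuousLinearMap.flip_apply, hRi, hRii, hP, hsq, map_neg, neg_neg] at e6 e7 ⊢
  -- The difference of the two sides is the sum of the differences in `e6` and `e7`.
  rw [← sub_eq_zero] at e6 e7 ⊢
  rw [← add_zero (0 : V × (V →L[ℝ] ℝ)), ← congrArg₂ (· + ·) e6 e7]
  abel

end JetAlgebra

/-! ### From the pointwise identity to smoothness and involutivity -/

section Integrability

set_option maxSynthPendingDepth 3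

variable {E : Type*} [NormedAddCommGroup E] [NormedSpace ℝ E]
  {H : Type*} [TopologicalSpace H] (I : ModelWithCorners ℝ E H)
  {M : Type*} [TopologicalSpace M] [ChartedSpace H M] [IsManifold I ∞ M] [I.Boundaryless]

/-- An element of `T_pM ⊕ T_p^*M` read in the preferred chart at `x₀`. -/
def genToChart (x₀ p : M) (u : GenTangentSpace I p) : E × (E →L[ℝ] ℝ) :=
  (tangentCoordChange I p x₀ p u.1,
    ContinuousLinearMap.comp (u.2 : E →L[ℝ] ℝ) (tangentCoordChange I x₀ p p))

/-- The field of endomorphisms `𝒥` is represented by `Φ` in the preferred chart at `x₀`. -/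
def RepresentedBy (J : Π x : M, GenTangentSpace I x →ₗ[ℝ] GenTangentSpace I x) (x₀ : M)
    (Φ : E → E × (E →L[ℝ] ℝ) →L[ℝ] E × (E →L[ℝ] ℝ)) : Prop :=
  ∀ᶠ y in 𝓝 (extChartAt I x₀ x₀), ∀ u : GenTangentSpace I ((extChartAt I x₀).symm y),
    genToChart I x₀ ((extChartAt I x₀).symm y) (J ((extChartAt I x₀).symm y) u) =
      Φ y (genToChart I x₀ ((extChartAt I x₀).symm y) u)

variable {I}

omit [I.Boundaryless] in
lemma RepresentedBy.genInChart_eventuallyEq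
    {J : Π x : M, GenTangentSpace I x →ₗ[ℝ] GenTangentSpace I x} {x₀ : M}
    {Φ : E → E × (E →L[ℝ] ℝ) →L[ℝ] E × (E →L[ℝ] ℝ)} (h : RepresentedBy I J x₀ Φ)
    (e : Π x : M, GenTangentSpace I x) :
    genInChart I (fun x => J x (e x)) x₀ =ᶠ[𝓝 (extChartAt I x₀ x₀)]
      fun y => Φ y (genInChart I e x₀ y) := by
  filter_upwards [h] with y hy
  exact hy (e ((extChartAt I x₀).symm y))

theorem smooth_of_representedBy {J : Π x : M, GenTangentSpace I x →ₗ[ℝ] GenTangentSpace I x}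
    (hJ : ∀ x, ∃ Φ, RepresentedBy I J x Φ ∧ ContDiffAt ℝ ∞ Φ (extChartAt I x x))
    (U : Set M) (hU : IsOpen U) (e : Π x : M, GenTangentSpace I x)
    (he : SmoothGenSectionOn I e U) : SmoothGenSectionOn I (fun x => J x (e x)) U := by
  rw [smoothGenSectionOn_iff hU] at he ⊢
  intro x hx
  obtain ⟨Φ, hΦ, hs⟩ := hJ x
  exact (hs.clm_apply (he x hx)).congr_of_eventuallyEq (hΦ.genInChart_eventuallyEq e)

omit [I.Boundaryless] in
lemma genInChart_self (e : Π x : M, GenTangentSpace I x) (x : M) :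
    genInChart I e x (extChartAt I x x) = e x :=
  Prod.ext (vecInChart_self (fun x => (e x).1) x) (covInChart_self (fun x => (e x).2) x)

omit [I.Boundaryless] in
lemma genInChart_congr {e f : Π x : M, GenTangentSpace I x} {U : Set M} (hU : IsOpen U)
    (h : ∀ x ∈ U, e x = f x) {x : M} (hx : x ∈ U) :
    genInChart I e x =ᶠ[𝓝 (extChartAt I x x)] genInChart I f x := by
  have hU' : (extChartAt I x).symm ⁻¹' U ∈ 𝓝 (extChartAt I x x) := by
    refine (continuousAt_extChartAt_symm x).preimage_mem_nhds ?_
    rw [extChartAt_to_inv]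
    exact hU.mem_nhds hx
  filter_upwards [hU'] with y hy
  unfold genInChart vecInChart covInChart
  simp only [h _ hy]

omit [I.Boundaryless] in
lemma genToChart_neg (x₀ p : M) (u : GenTangentSpace I p) :
    genToChart I x₀ p (-u) = -genToChart I x₀ p u :=
  Prod.ext (map_neg (tangentCoordChange I p x₀ p) u.1)
    (ContinuousLinearMap.ext fun _ => rfl)

lemma jetBracket_neg_neg {V : Type*} [NormedAddCommGroup V] [NormedSpace ℝ V]
    (a c : V × (V →L[ℝ] ℝ)) (a' c' : V →L[ℝ] V × (V →L[ℝ] ℝ)) :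
    jetBracket (-a) (-a') (-c) (-c') = jetBracket a a' c c' := by
  simp only [jetBracket_eq]
  refine Prod.ext ?_ ?_
  · simp
  · ext Z
    simp [pairL_apply, add_comm]

lemma jetBracket_neg_left {V : Type*} [NormedAddCommGroup V] [NormedSpace ℝ V]
    (a c : V × (V →L[ℝ] ℝ)) (a' c' : V →L[ℝ] V × (V →L[ℝ] ℝ)) :
    jetBracket (-a) (-a') c c' = -jetBracket a a' c c' := by
  simp only [jetBracket_eq]
  refine Prod.ext ?_ ?_
  · simp; abel
  · ext Z
    simp [pairL_apply]; ring

lemma jetBracket_neg_right {V : Type*} [NormedAddCommGroup V] [NormedSpace ℝ V]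
    (a c : V × (V →L[ℝ] ℝ)) (a' c' : V →L[ℝ] V × (V →L[ℝ] ℝ)) :
    jetBracket a a' (-c) (-c') = -jetBracket a a' c c' := by
  simp only [jetBracket_eq]
  refine Prod.ext ?_ ?_
  · simp; abel
  · ext Z
    simp [pairL_apply]; ring

/-- The bracket read in the chart. -/
lemma courantBracket_eq_of_hasFDerivAt {e f : Π x : M, GenTangentSpace I x} {x : M}
    {e' f' : E →L[ℝ] E × (E →L[ℝ] ℝ)} {a c : E × (E →L[ℝ] ℝ)}
    (ha : genInChart I e x (extChartAt I x x) = a) (hc : genInChart I f x (extChartAt I x x) = c)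
    (he : HasFDerivAt (genInChart I e x) e' (extChartAt I x x))
    (hf : HasFDerivAt (genInChart I f x) f' (extChartAt I x x)) :
    courantBracket I e f x = jetBracket a e' c f' := by
  rw [courantBracket_eq_jetBracket he.differentiableAt hf.differentiableAt, he.fderiv, hf.fderiv,
    ha, hc]

/-- A section of `L` is `a - iJa`, so its 1-jet is determined by that of its real part. The bracket
of two such sections has real part `[a, c] - [Ja, Jc]` and imaginary part `-([Ja, c] + [a, Jc])`,
and the Nijenhuis identity is the eigenvector equation for this pair. -/
theorem isInvolutive_of_jetIntegrable
    {J : Π x : M, GenTangentSpace I x →ₗ[ℝ] GenTangentSpace I x}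
    (hsq : ∀ x u, J x (J x u) = -u)
    (hJ : ∀ x, ∃ (Φ : E → E × (E →L[ℝ] ℝ) →L[ℝ] E × (E →L[ℝ] ℝ))
      (Φ' : E →L[ℝ] E × (E →L[ℝ] ℝ) →L[ℝ] E × (E →L[ℝ] ℝ)), RepresentedBy I J x Φ ∧
      HasFDerivAt Φ Φ' (extChartAt I x x) ∧ JetIntegrable (Φ (extChartAt I x x)) Φ') :
    IsInvolutive I J := by
  intro U hU e f he hf hLe hLf x hx
  obtain ⟨Φ, Φ', hΦ, hd, hint⟩ := hJ x
  set y₀ := extChartAt I x x with hy₀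
  have hval : ∀ s : Π x : M, GenTangentSpace I x,
      genInChart I (fun x => J x (s x)) x y₀ = Φ y₀ (genInChart I s x y₀) := fun s =>
    (hΦ.genInChart_eventuallyEq s).self_of_nhds
  have main : ∀ s : ComplexSection I M, s.SmoothOn I U →
      (∀ x ∈ U, s.MemEigenbundle I J x) → ∃ (a : E × (E →L[ℝ] ℝ)) (s' : E →L[ℝ] E × (E →L[ℝ] ℝ)),
        genInChart I s.re x y₀ = a ∧ HasFDerivAt (genInChart I s.re x) s' y₀ ∧
        genInChart I s.im x y₀ = -Φ y₀ a ∧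
        HasFDerivAt (genInChart I s.im x) (-(Φ'.flip a + (Φ y₀).comp s')) y₀ := by
    intro s hs hL
    have h1 : DifferentiableAt ℝ (genInChart I s.re x) y₀ :=
      ((smoothGenSectionOn_iff hU).1 hs.1 x hx).differentiableAt (by simp)
    -- The eigenvector equation is needed on a neighbourhood, since it gets differentiated; this is
    -- where openness of `U` enters.
    have h2 : genInChart I s.im x =ᶠ[𝓝 y₀] fun y => -Φ y (genInChart I s.re x y) := by
      have h3 : genInChart I s.im x =ᶠ[𝓝 y₀] genInChart I (fun x => -J x (s.re x)) x :=
        genInChart_congr hU (fun z hz => by rw [(hL z hz).1, neg_neg]) hx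
      filter_upwards [h3, hΦ.genInChart_eventuallyEq s.re] with y hy1 hy2
      rw [hy1, ← hy2]
      exact genToChart_neg x _ _
    refine ⟨_, fderiv ℝ (genInChart I s.re x) y₀, rfl, h1.hasFDerivAt, h2.self_of_nhds, ?_⟩
    refine HasFDerivAt.congr_of_eventuallyEq ?_ h2
    have := (hd.clm_apply h1.hasFDerivAt).neg
    rwa [add_comm] at this
  obtain ⟨a, a', he1, he2, he3, he4⟩ := main e he hLe
  obtain ⟨c, c', hf1, hf2, hf3, hf4⟩ := main f hf hLf
  have hN := hint a c a' c'
  have hre : (e.bracket I f).re x = jetBracket a a' c c' -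
      jetBracket (Φ y₀ a) (Φ'.flip a + (Φ y₀).comp a') (Φ y₀ c) (Φ'.flip c + (Φ y₀).comp c') := by
    rw [← jetBracket_neg_neg (Φ y₀ a)]
    exact congrArg₂ (fun u v : E × (E →L[ℝ] ℝ) => u - v)
      (courantBracket_eq_of_hasFDerivAt he1 hf1 he2 hf2)
      (courantBracket_eq_of_hasFDerivAt he3 hf3 he4 hf4)
  have him : (e.bracket I f).im x = -(jetBracket (Φ y₀ a) (Φ'.flip a + (Φ y₀).comp a') c c' +
      jetBracket a a' (Φ y₀ c) (Φ'.flip c + (Φ y₀).comp c')) := by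
    rw [add_comm, neg_add, ← jetBracket_neg_right a, ← jetBracket_neg_left _ c]
    exact congrArg₂ (fun u v : E × (E →L[ℝ] ℝ) => u + v)
      (courantBracket_eq_of_hasFDerivAt he1 hf3 he2 hf4)
      (courantBracket_eq_of_hasFDerivAt he3 hf1 he4 hf2)
  have hre' : genInChart I (e.bracket I f).re x y₀ = _ := (genInChart_self _ x).trans hre
  have key : J x ((e.bracket I f).re x) = -(e.bracket I f).im x := by
    have h1 := hval (e.bracket I f).re
    rw [hre', ← hN] at h1
    refine ((genInChart_self (fun x => J x ((e.bracket I f).re x)) x).symm.trans h1).trans ?_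
    rw [him]
    exact (neg_neg _).symm
  -- The second eigenvector equation follows from the first by `J² = -1`.
  exact ⟨key, by rw [← neg_neg ((e.bracket I f).im x), ← key, map_neg, hsq, neg_neg]⟩

end Integrability

/-! ### Levi-Civita connection and parallel complex structures at a point -/

section KahlerAlgebra

set_option maxSynthPendingDepth 3

variable {E : Type*} [NormedAddCommGroup E] [NormedSpace ℝ E]

omit [NormedSpace ℝ E] in
/-- A trilinear form with the symmetries of `g((∇_u A)v, w)` for a Kähler structure vanishes. -/
lemma trilinear_eq_zero {q : E → E → E → ℝ} {A : E → E}
    (hneg : ∀ u v w, q (-u) v w = -q u v w) (hneg' : ∀ u v w, q u (-v) w = -q u v w)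
    (hA : ∀ v, A (A v) = -v)
    (hcomm : ∀ u v w, q u v (A w) = q u (A v) w) (hskew : ∀ u v w, q u v w = -q u w v)
    (hcyc : ∀ u v w, q u v w - q v u w + q w u v = 0)
    (hnij : ∀ v w z, q (A v) w z - q (A w) v z - q w v (A z) + q v w (A z) = 0)
    (u v w : E) : q u v w = 0 := by
  -- The classical identity `2q(u, v, w) = dω(u, v, w) - dω(u, Av, Aw) + N(v, Aw, u)`, with `dω` and
  -- `N` the left-hand sides of `hcyc` and `hnij`: the result is `h1 - h2 + h3`.
  have h1 := hcyc u v w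
  have h2 := hcyc u (A v) (A w)
  have h3 := hnij v (A w) u
  rw [hcomm u, hA, hneg'] at h2
  rw [hA, hneg, hcomm v, hA, hneg', hcomm (A w)] at h3
  have h4 := hskew (A w) u (A v)
  have h5 := hskew v u w
  have h6 := hskew (A v) u (A w)
  have h7 := hskew w u v
  linarith

/-- Positivity makes `g` injective, and `E` and its dual have the same finite dimension. This is
what gives `g.inverse` its meaning as a true inverse. -/
lemma exists_metricEquiv [FiniteDimensional ℝ E] {g : E →L[ℝ] E →L[ℝ] ℝ}
    (hpos : ∀ v, v ≠ 0 → 0 < g v v) : ∃ e : E ≃L[ℝ] (E →L[ℝ] ℝ), (e : E →L[ℝ] E →L[ℝ] ℝ) = g := by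
  have hinj : Function.Injective g.toLinearMap := by
    rw [← LinearMap.ker_eq_bot, LinearMap.ker_eq_bot']
    intro v hv
    by_contra hne
    have h0 : g v = 0 := hv
    have := hpos v hne
    rw [h0] at this
    simp at this
  have hdim : Module.finrank ℝ E = Module.finrank ℝ (E →L[ℝ] ℝ) := by
    rw [← (LinearMap.toContinuousLinearMap (𝕜 := ℝ) (E := E) (F' := ℝ)).finrank_eq]
    exact (Subspace.dual_finrank_eq (K := ℝ) (V := E)).symm
  refine ⟨(LinearEquiv.ofInjectiveOfFinrankEq g.toLinearMap hinj hdim).toContinuousLinearEquiv, ?_⟩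
  ext v w
  rfl

lemma eq_of_metric {g : E →L[ℝ] E →L[ℝ] ℝ} (hpos : ∀ v, v ≠ 0 → 0 < g v v) {v : E}
    (h : ∀ w, g v w = 0) : v = 0 := by
  by_contra hne
  exact (hpos v hne).ne' (h v)

/-- The Christoffel symbols of the Levi-Civita connection at a point. -/
theorem exists_leviCivita [FiniteDimensional ℝ E] {g : E →L[ℝ] E →L[ℝ] ℝ}
    (hsymm : ∀ v w, g v w = g w v) (hpos : ∀ v, v ≠ 0 → 0 < g v v)
    {g' : E →L[ℝ] E →L[ℝ] E →L[ℝ] ℝ} (hsymm' : ∀ u v w, g' u v w = g' u w v) :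
    ∃ Γ : E →L[ℝ] E →L[ℝ] E, (∀ v w, Γ v w = Γ w v) ∧
      ∀ u v w, g' u v w = g (Γ u v) w + g v (Γ u w) := by
  obtain ⟨e, he⟩ := exists_metricEquiv hpos
  -- The Koszul formula on constant fields; raising the last index with `g⁻¹` gives `Γ`.
  let κ : E →L[ℝ] E →L[ℝ] E →L[ℝ] ℝ := (1 / 2 : ℝ) • (g' + g'.flip -
    (ContinuousLinearMap.flipₗᵢ ℝ E E ℝ).toContinuousLinearEquiv.toContinuousLinearMap.comp g'.flip)
  have hκ : ∀ u v w, κ u v w = (1 / 2) * (g' u v w + g' v u w - g' w u v) := fun u v w => rfl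
  let Γ : E →L[ℝ] E →L[ℝ] E :=
    (ContinuousLinearMap.compL ℝ E (E →L[ℝ] ℝ) E (e.symm : (E →L[ℝ] ℝ) →L[ℝ] E)).comp κ
  have hΓ : ∀ u v w, g (Γ u v) w = κ u v w := by
    intro u v w
    have : e (e.symm (κ u v)) = κ u v := e.apply_symm_apply _
    rw [← he]
    exact congrArg (fun L : E →L[ℝ] ℝ => L w) this
  refine ⟨Γ, fun v w => ?_, fun u v w => ?_⟩
  · rw [← sub_eq_zero]
    refine eq_of_metric hpos fun z => ?_
    rw [map_sub, sub_apply, hΓ, hΓ, hκ, hκ, hsymm' z v w]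
    ring
  · rw [hsymm v, hΓ, hΓ, hκ, hκ, hsymm' w u v, hsymm' u v w, hsymm' v u w]
    ring

/-- On a Kähler manifold the complex structure is parallel. -/
theorem kahler_parallel {g : E →L[ℝ] E →L[ℝ] ℝ}
    (hsymm : ∀ v w, g v w = g w v) (hpos : ∀ v, v ≠ 0 → 0 < g v v)
    {g' : E →L[ℝ] E →L[ℝ] E →L[ℝ] ℝ}
    {Γ : E →L[ℝ] E →L[ℝ] E} (hΓ : ∀ v w, Γ v w = Γ w v)
    (hg' : ∀ u v w, g' u v w = g (Γ u v) w + g v (Γ u w))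
    {A : E →L[ℝ] E} {A' : E →L[ℝ] E →L[ℝ] E}
    (hA : ∀ v, A (A v) = -v) (hA' : ∀ u v, A' u (A v) + A (A' u v) = 0)
    (horth : ∀ v w, g (A v) (A w) = g v w)
    (horth' : ∀ u v w, g' u (A v) (A w) + g (A' u v) (A w) + g (A v) (A' u w) = g' u v w)
    (hclosed : ∀ u v w, (g' u (A v) w + g (A' u v) w) - (g' v (A u) w + g (A' v u) w) +
      (g' w (A u) v + g (A' w u) v) = 0)
    (hnij : ∀ v w, A' (A v) w - A' (A w) v + A (A' w v) - A (A' v w) = 0)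
    (u v : E) : A' u v + Γ u (A v) - A (Γ u v) = 0 := by
  have hAg : ∀ v w, g (A v) w = -g v (A w) := fun v w => by
    have := horth v (A w)
    rw [hA, map_neg] at this
    linarith
  set B : E → E → E := fun u v => A' u v + Γ u (A v) - A (Γ u v) with hB
  have hBA : ∀ u v, B u (A v) = -A (B u v) := fun u v => by
    have := hA' u v
    simp only [hB, map_add, map_sub, hA, map_neg]
    rw [eq_neg_of_add_eq_zero_left this]
    abel
  have hcomm : ∀ u v w, g (B u v) (A w) = g (B u (A v)) w := fun u v w => by
    rw [hBA, map_neg, neg_apply, hAg, neg_neg]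
  -- The covariant derivative of the orthogonality of `A`, with `g` parallel.
  have hsk : ∀ u v w, g (B u v) (A w) = -g (B u w) (A v) := fun u v w => by
    have h := horth' u v w
    rw [hg', hg'] at h
    have e1 : g (A (Γ u v)) (A w) = g (Γ u v) w := horth _ _
    have e2 : g (A (Γ u w)) (A v) = g v (Γ u w) := by rw [horth, hsymm]
    have e3 := hsymm (A v) (Γ u (A w))
    have e4 := hsymm (A v) (A' u w)
    simp only [hB, map_add, map_sub, add_apply, sub_apply]
    linarith
  refine eq_of_metric hpos fun w => ?_
  refine trilinear_eq_zero (q := fun u v w => g (B u v) w) (A := A) ?_ ?_ hA hcomm ?_ ?_ ?_ u v w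
  · intro u v w
    simp only [hB, map_neg, map_add, map_sub, neg_apply, add_apply, sub_apply]
    ring
  · intro u v w
    simp only [hB, map_neg, map_add, map_sub, neg_apply, add_apply, sub_apply]
    ring
  · intro u v w
    have h1 := hsk u v (A w)
    have h2 := hcomm u (A w) v
    have h3 : B u (-w) = -B u w := by simp only [hB, map_neg]; abel
    rw [hA, map_neg, h2, hA, h3, map_neg, neg_apply] at h1
    linarith
  · intro u v w
    have h := hclosed u v w
    simp only [hg'] at h
    have e1 := hAg (Γ u v) w
    have e2 := hAg (Γ v u) w
    have e3 := hAg (Γ w u) v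
    have e4 := hΓ u v
    have e5 := hΓ u w
    have e6 := hΓ v w
    have e7 := hsymm (A v) (Γ u w)
    simp only [hB, map_add, map_sub, add_apply, sub_apply]
    rw [e1, e2, e3]
    have e8 := hsymm (A u) (Γ v w)
    have e9 := hsymm (A v) (Γ w u)
    have e10 := hsymm (A u) (Γ w v)
    rw [e5] at e7 h
    rw [e6] at e8 h
    rw [e4]
    linarith
  · intro v w z
    -- Since `Γ` is symmetric, its terms drop out of the Nijenhuis tensor, and `A'` may be replaced
    -- by `B`.
    have key : B (A v) w - B (A w) v + A (B w v) - A (B v w) = 0 := by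
      have h := hnij v w
      simp only [hB, map_add, map_sub, hA]
      rw [hΓ (A w) (A v), hΓ (A v) w, hΓ (A w) v, hΓ v w]
      rw [← h]
      abel
    have h2 := congrArg (fun x => g x z) key
    simp only [map_add, map_sub, add_apply, sub_apply, hAg, map_zero, zero_apply] at h2
    linarith

end KahlerAlgebra

/-! ### The bi-Hermitian endomorphism of `E ⊕ E^*` -/

section BiHermitian

set_option maxSynthPendingDepth 3

variable {E : Type*} [NormedAddCommGroup E] [NormedSpace ℝ E]

/-- The block matrix of a bi-Hermitian structure, with `ω⁻¹` expressed through the inverse of the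
metric. -/
def biHermitian (g : E →L[ℝ] E →L[ℝ] ℝ) (S T : E →L[ℝ] E) :
    E × (E →L[ℝ] ℝ) →L[ℝ] E × (E →L[ℝ] ℝ) :=
  (1 / 2 : ℝ) • ((ContinuousLinearMap.inl ℝ E (E →L[ℝ] ℝ)).comp
      ((-(S + T)).comp (ContinuousLinearMap.fst ℝ E (E →L[ℝ] ℝ)) +
        ((S - T).comp g.inverse).comp (ContinuousLinearMap.snd ℝ E (E →L[ℝ] ℝ))) +
    (ContinuousLinearMap.inr ℝ E (E →L[ℝ] ℝ)).comp
      ((g.comp (S - T)).comp (ContinuousLinearMap.fst ℝ E (E →L[ℝ] ℝ)) +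
        ((ContinuousLinearMap.compL ℝ E E ℝ).flip (S + T)).comp
          (ContinuousLinearMap.snd ℝ E (E →L[ℝ] ℝ))))

lemma biHermitian_apply (g : E →L[ℝ] E →L[ℝ] ℝ) (S T : E →L[ℝ] E) (u : E × (E →L[ℝ] ℝ)) :
    biHermitian g S T u =
      ((1 / 2 : ℝ) • (-(S u.1 + T u.1) + (S (g.inverse u.2) - T (g.inverse u.2))),
        (1 / 2 : ℝ) • (g (S u.1 - T u.1) + u.2.comp (S + T))) := by
  refine Prod.ext ?_ ?_ <;> simp [biHermitian]

lemma inverse_metric_apply {g : E →L[ℝ] E →L[ℝ] ℝ} {e : E ≃L[ℝ] (E →L[ℝ] ℝ)}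
    (he : (e : E →L[ℝ] E →L[ℝ] ℝ) = g) (v : E) : g.inverse (g v) = v := by
  rw [← he, ContinuousLinearMap.inverse_equiv]
  exact e.symm_apply_apply v

lemma metric_inverse_apply {g : E →L[ℝ] E →L[ℝ] ℝ} {e : E ≃L[ℝ] (E →L[ℝ] ℝ)}
    (he : (e : E →L[ℝ] E →L[ℝ] ℝ) = g) (ξ : E →L[ℝ] ℝ) : g (g.inverse ξ) = ξ := by
  rw [← he, ContinuousLinearMap.inverse_equiv]
  exact e.apply_symm_apply ξ

/-- Every generalized vector splits into its components in the graphs of `g` and `-g`. -/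
lemma exists_split {g : E →L[ℝ] E →L[ℝ] ℝ} {e : E ≃L[ℝ] (E →L[ℝ] ℝ)}
    (he : (e : E →L[ℝ] E →L[ℝ] ℝ) = g) (u : E × (E →L[ℝ] ℝ)) :
    ∃ a b : E, u = (a + b, g a - g b) := by
  refine ⟨(1 / 2 : ℝ) • (u.1 + g.inverse u.2), (1 / 2 : ℝ) • (u.1 - g.inverse u.2),
    Prod.ext ?_ ?_⟩
  · simp only; module
  · simp only [map_smul, map_add, map_sub, metric_inverse_apply he]; module

/-- The block matrix becomes diagonal on the graphs of `g` and `-g`: it acts as `-T` on the first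
and `-S` on the second. Square, skewness and composition become statements about `S` and `T`
separately. -/
lemma biHermitian_split {g : E →L[ℝ] E →L[ℝ] ℝ} {e : E ≃L[ℝ] (E →L[ℝ] ℝ)}
    (he : (e : E →L[ℝ] E →L[ℝ] ℝ) = g) {S T : E →L[ℝ] E}
    (hS : ∀ v w, g (S v) w = -g v (S w)) (hT : ∀ v w, g (T v) w = -g v (T w)) (a b : E) :
    biHermitian g S T (a + b, g a - g b) = (-T a + -S b, g (-T a) - g (-S b)) := by
  rw [biHermitian_apply, map_sub, inverse_metric_apply he, inverse_metric_apply he]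
  refine Prod.ext ?_ ?_
  · simp only [map_add, map_sub]; module
  · ext w
    simp [hS, hT]
    ring

lemma pairL_split {g : E →L[ℝ] E →L[ℝ] ℝ} (hsymm : ∀ v w, g v w = g w v) (a b c d : E) :
    pairL (c + d, g c - g d) (a + b, g a - g b) = 2 * g a c - 2 * g b d := by
  simp [pairL_apply, hsymm c, hsymm d]
  ring

lemma biHermitian_sq {g : E →L[ℝ] E →L[ℝ] ℝ} {e : E ≃L[ℝ] (E →L[ℝ] ℝ)}
    (he : (e : E →L[ℝ] E →L[ℝ] ℝ) = g) {S T : E →L[ℝ] E}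
    (hS : ∀ v w, g (S v) w = -g v (S w)) (hT : ∀ v w, g (T v) w = -g v (T w))
    (hS2 : ∀ v, S (S v) = -v) (hT2 : ∀ v, T (T v) = -v) (u : E × (E →L[ℝ] ℝ)) :
    biHermitian g S T (biHermitian g S T u) = -u := by
  obtain ⟨a, b, rfl⟩ := exists_split he u
  rw [biHermitian_split he hS hT, biHermitian_split he hS hT]
  refine Prod.ext ?_ ?_
  · simp [hS2, hT2]; abel
  · simp [hS2, hT2]; abel

lemma biHermitian_skew {g : E →L[ℝ] E →L[ℝ] ℝ} {e : E ≃L[ℝ] (E →L[ℝ] ℝ)}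
    (he : (e : E →L[ℝ] E →L[ℝ] ℝ) = g) (hsymm : ∀ v w, g v w = g w v) {S T : E →L[ℝ] E}
    (hS : ∀ v w, g (S v) w = -g v (S w)) (hT : ∀ v w, g (T v) w = -g v (T w))
    (u v : E × (E →L[ℝ] ℝ)) :
    pairL v (biHermitian g S T u) = -pairL (biHermitian g S T v) u := by
  obtain ⟨a, b, rfl⟩ := exists_split he u
  obtain ⟨c, d, rfl⟩ := exists_split he v
  rw [biHermitian_split he hS hT, biHermitian_split he hS hT, pairL_split hsymm, pairL_split hsymm]
  simp [hS, hT]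
  ring

/-- On each graph the product of `-S` and `-S₁` is `S S₁ = -S₂`, and likewise for `T`. It transfers
the holomorphy relation from `I_α`, `I_β` to `𝒥_{α,β}`. -/
lemma biHermitian_comp {g : E →L[ℝ] E →L[ℝ] ℝ} {e : E ≃L[ℝ] (E →L[ℝ] ℝ)}
    (he : (e : E →L[ℝ] E →L[ℝ] ℝ) = g) {S T S₁ T₁ S₂ T₂ : E →L[ℝ] E}
    (hS : ∀ v w, g (S v) w = -g v (S w)) (hT : ∀ v w, g (T v) w = -g v (T w))
    (hS₁ : ∀ v w, g (S₁ v) w = -g v (S₁ w)) (hT₁ : ∀ v w, g (T₁ v) w = -g v (T₁ w))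
    (hS₂ : ∀ v w, g (S₂ v) w = -g v (S₂ w)) (hT₂ : ∀ v w, g (T₂ v) w = -g v (T₂ w))
    (hSS : ∀ v, S₂ v = -S (S₁ v)) (hTT : ∀ v, T₂ v = -T (T₁ v)) (u : E × (E →L[ℝ] ℝ)) :
    biHermitian g S₂ T₂ u = biHermitian g S T (biHermitian g S₁ T₁ u) := by
  obtain ⟨a, b, rfl⟩ := exists_split he u
  rw [biHermitian_split he hS₂ hT₂, biHermitian_split he hS₁ hT₁, biHermitian_split he hS hT]
  simp [hSS, hTT]

variable {W : Type*} [NormedAddCommGroup W] [NormedSpace ℝ W]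

lemma contDiffAt_biHermitian [CompleteSpace E] {n : WithTop ℕ∞} {g : W → E →L[ℝ] E →L[ℝ] ℝ}
    {S T : W → E →L[ℝ] E} {y : W} {e : E ≃L[ℝ] (E →L[ℝ] ℝ)}
    (he : (e : E →L[ℝ] E →L[ℝ] ℝ) = g y) (hg : ContDiffAt ℝ n g y)
    (hS : ContDiffAt ℝ n S y) (hT : ContDiffAt ℝ n T y) :
    ContDiffAt ℝ n (fun y => biHermitian (g y) (S y) (T y)) y := by
  have hinv : ContDiffAt ℝ n (fun y => (g y).inverse) y := by
    have := contDiffAt_map_inverse (𝕜 := ℝ) (n := n) e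
    rw [he] at this
    exact this.comp y hg
  let L : (E →L[ℝ] E) →L[ℝ] (E →L[ℝ] ℝ) →L[ℝ] E →L[ℝ] ℝ :=
    (ContinuousLinearMap.compL ℝ E E ℝ).flip
  have h1 : ContDiffAt ℝ n (fun z => (-(S z + T z)).comp
      (ContinuousLinearMap.fst ℝ E (E →L[ℝ] ℝ))) y :=
    (hS.add hT).neg.clm_comp contDiffAt_const
  have h2 : ContDiffAt ℝ n (fun z => ((S z - T z).comp (g z).inverse).comp
      (ContinuousLinearMap.snd ℝ E (E →L[ℝ] ℝ))) y :=
    ((hS.sub hT).clm_comp hinv).clm_comp contDiffAt_const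
  have h3 : ContDiffAt ℝ n (fun z => ((g z).comp (S z - T z)).comp
      (ContinuousLinearMap.fst ℝ E (E →L[ℝ] ℝ))) y :=
    (hg.clm_comp (hS.sub hT)).clm_comp contDiffAt_const
  have h4 : ContDiffAt ℝ n (fun z => (L (S z + T z)).comp
      (ContinuousLinearMap.snd ℝ E (E →L[ℝ] ℝ))) y :=
    (L.contDiff.contDiffAt.comp y (hS.add hT)).clm_comp contDiffAt_const
  have h5 : ContDiffAt ℝ n (fun z => (ContinuousLinearMap.inl ℝ E (E →L[ℝ] ℝ)).comp _) y :=
    contDiffAt_const.clm_comp (h1.add h2)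
  have h6 : ContDiffAt ℝ n (fun z => (ContinuousLinearMap.inr ℝ E (E →L[ℝ] ℝ)).comp _) y :=
    contDiffAt_const.clm_comp (h3.add h4)
  exact (h5.add h6).const_smul (1 / 2 : ℝ)

/-- The covariant derivative of the structure attached to `(g, S, T)` when `g` is parallel. -/
theorem fderiv_biHermitian [FiniteDimensional ℝ E] {g : W → E →L[ℝ] E →L[ℝ] ℝ}
    {S T : W → E →L[ℝ] E} {y : W} (hpos : ∀ᶠ z in 𝓝 y, ∀ v, v ≠ 0 → 0 < g z v v)
    {g' : W →L[ℝ] E →L[ℝ] E →L[ℝ] ℝ} {S' T' : W →L[ℝ] E →L[ℝ] E}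
    (hg : HasFDerivAt g g' y) (hS : HasFDerivAt S S' y) (hT : HasFDerivAt T T' y)
    (hd : DifferentiableAt ℝ (fun z => (g z).inverse) y)
    {Ψ' : W →L[ℝ] E × (E →L[ℝ] ℝ) →L[ℝ] E × (E →L[ℝ] ℝ)}
    (hΨ : HasFDerivAt (fun z => biHermitian (g z) (S z) (T z)) Ψ' y)
    {Γ : E →L[ℝ] E} {w : W} {σ τ : E →L[ℝ] E}
    (hΓ : ∀ u v, g' w u v = g y (Γ u) v + g y u (Γ v))
    (hσ : ∀ v, S' w v + Γ (S y v) - S y (Γ v) = σ v)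
    (hτ : ∀ v, T' w v + Γ (T y v) - T y (Γ v) = τ v) (u : E × (E →L[ℝ] ℝ)) :
    Ψ' w u + (Γ (biHermitian (g y) (S y) (T y) u).1,
        -((biHermitian (g y) (S y) (T y) u).2.comp Γ)) -
      biHermitian (g y) (S y) (T y) (Γ u.1, -(u.2.comp Γ)) = biHermitian (g y) σ τ u := by
  obtain ⟨e, he⟩ := exists_metricEquiv hpos.self_of_nhds
  obtain ⟨X, ξ⟩ := u
  -- Writing the covector as `g Y` lets every occurrence of `g⁻¹` be evaluated explicitly.
  obtain ⟨Y, rfl⟩ : ∃ Y, ξ = g y Y := ⟨(g y).inverse ξ, (metric_inverse_apply he ξ).symm⟩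
  set G' := fderiv ℝ (fun z => (g z).inverse) y with hG'
  have hG : HasFDerivAt (fun z => (g z).inverse) G' y := hd.hasFDerivAt
  -- `Z` is the `g`-adjoint of `Γ` applied to `Y`.
  set Z := (g y).inverse ((g y Y).comp Γ) with hZ
  have hgZ : g y Z = (g y Y).comp Γ := metric_inverse_apply he _
  have hGY : G' w (g y Y) = -(Γ Y + Z) := by
    -- Differentiating `g⁻¹ (g Y) = Y` gives the derivative of `g⁻¹` without a formula for the
    -- derivative of inversion.
    have h1 : (fun z => (g z).inverse (g z Y)) =ᶠ[𝓝 y] fun _ => Y := by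
      filter_upwards [hpos] with z hz
      obtain ⟨e', he'⟩ := exists_metricEquiv hz
      exact inverse_metric_apply he' Y
    have h2 := (hG.clm_apply (hg.clm_apply (hasFDerivAt_const Y y)))
    have h3 := (h2.congr_of_eventuallyEq h1.symm).unique (hasFDerivAt_const Y y)
    have h4 := congrArg (fun L : W →L[ℝ] E => L w) h3
    simp at h4
    have h5 : (g y).inverse (g' w Y) = Γ Y + Z := by
      have : g' w Y = g y (Γ Y + Z) := by
        rw [map_add, hgZ]
        ext v
        simp [hΓ]
      rw [this, inverse_metric_apply he]
    rw [h5] at h4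
    exact eq_neg_of_add_eq_zero_right h4
  have hΨ1 : Ψ' w (X, g y Y) =
      ((1 / 2 : ℝ) • (-(S' w X + T' w X) + (S' w Y - T' w Y) -
          (S y (Γ Y + Z) - T y (Γ Y + Z))),
        (1 / 2 : ℝ) • (g' w (S y X - T y X) + g y (S' w X - T' w X) +
          (g y Y).comp (S' w + T' w))) := by
    have h1 := hΨ.clm_apply (hasFDerivAt_const (X, g y Y) y)
    simp only [biHermitian_apply] at h1
    have hX := hasFDerivAt_const (𝕜 := ℝ) X y
    have hξ := hasFDerivAt_const (𝕜 := ℝ) (g y Y) y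
    have hGξ := hG.clm_apply hξ
    have h2 := (((((hS.clm_apply hX).add (hT.clm_apply hX)).neg.add
      ((hS.clm_apply hGξ).sub (hT.clm_apply hGξ))).const_smul (1 / 2 : ℝ)).prodMk
      ((((hg.clm_apply ((hS.clm_apply hX).sub (hT.clm_apply hX)))).add
        (hξ.clm_comp (hS.add hT))).const_smul (1 / 2 : ℝ)))
    have h3 := congrArg (fun L : W →L[ℝ] E × (E →L[ℝ] ℝ) => L w) (h1.unique h2)
    simp at h3
    rw [h3, hGY, inverse_metric_apply he]
    refine Prod.ext ?_ ?_
    · simp only [map_neg]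
      module
    · ext v
      simp
      ring
  rw [hΨ1]
  simp only [biHermitian_apply, inverse_metric_apply he, map_neg, ← hZ]
  refine Prod.ext ?_ ?_
  · simp only [← hσ, ← hτ, map_add, map_sub, map_smul, map_neg, Prod.fst_add, Prod.fst_sub]
    module
  · ext v
    simp [← hσ, ← hτ, hΓ]
    ring

end BiHermitian

/-! ### Products of generalized structures -/

section ProductAlgebra

set_option maxSynthPendingDepth 3

variable (E N : Type*) [NormedAddCommGroup E] [NormedSpace ℝ E]
  [NormedAddCommGroup N] [NormedSpace ℝ N]

/-- The projection of `(E ⊕ N) ⊕ (E ⊕ N)^*` to `E ⊕ E^*`. -/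
def genFst : (E × N) × (E × N →L[ℝ] ℝ) →L[ℝ] E × (E →L[ℝ] ℝ) :=
  ((ContinuousLinearMap.fst ℝ E N).comp (ContinuousLinearMap.fst ℝ _ _)).prod
    (((ContinuousLinearMap.compL ℝ E (E × N) ℝ).flip (ContinuousLinearMap.inl ℝ E N)).comp
      (ContinuousLinearMap.snd ℝ _ _))

/-- The projection of `(E ⊕ N) ⊕ (E ⊕ N)^*` to `N ⊕ N^*`. -/
def genSnd : (E × N) × (E × N →L[ℝ] ℝ) →L[ℝ] N × (N →L[ℝ] ℝ) :=
  ((ContinuousLinearMap.snd ℝ E N).comp (ContinuousLinearMap.fst ℝ _ _)).prod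
    (((ContinuousLinearMap.compL ℝ N (E × N) ℝ).flip (ContinuousLinearMap.inr ℝ E N)).comp
      (ContinuousLinearMap.snd ℝ _ _))

/-- The inclusion of `E ⊕ E^*` in `(E ⊕ N) ⊕ (E ⊕ N)^*`. -/
def genInl : E × (E →L[ℝ] ℝ) →L[ℝ] (E × N) × (E × N →L[ℝ] ℝ) :=
  ((ContinuousLinearMap.inl ℝ E N).comp (ContinuousLinearMap.fst ℝ _ _)).prod
    (((ContinuousLinearMap.compL ℝ (E × N) E ℝ).flip (ContinuousLinearMap.fst ℝ E N)).comp
      (ContinuousLinearMap.snd ℝ _ _))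

/-- The inclusion of `N ⊕ N^*` in `(E ⊕ N) ⊕ (E ⊕ N)^*`. -/
def genInr : N × (N →L[ℝ] ℝ) →L[ℝ] (E × N) × (E × N →L[ℝ] ℝ) :=
  ((ContinuousLinearMap.inr ℝ E N).comp (ContinuousLinearMap.fst ℝ _ _)).prod
    (((ContinuousLinearMap.compL ℝ (E × N) N ℝ).flip (ContinuousLinearMap.snd ℝ E N)).comp
      (ContinuousLinearMap.snd ℝ _ _))

variable {E N}

lemma genFst_apply (u : (E × N) × (E × N →L[ℝ] ℝ)) :
    genFst E N u = (u.1.1, u.2.comp (ContinuousLinearMap.inl ℝ E N)) := rfl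

lemma genSnd_apply (u : (E × N) × (E × N →L[ℝ] ℝ)) :
    genSnd E N u = (u.1.2, u.2.comp (ContinuousLinearMap.inr ℝ E N)) := rfl

lemma genInl_apply (u : E × (E →L[ℝ] ℝ)) :
    genInl E N u = ((u.1, 0), u.2.comp (ContinuousLinearMap.fst ℝ E N)) := rfl

lemma genInr_apply (u : N × (N →L[ℝ] ℝ)) :
    genInr E N u = ((0, u.1), u.2.comp (ContinuousLinearMap.snd ℝ E N)) := rfl

lemma genFst_genInl (u : E × (E →L[ℝ] ℝ)) : genFst E N (genInl E N u) = u := by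
  refine Prod.ext rfl ?_
  ext v
  simp [genFst_apply, genInl_apply]

lemma genSnd_genInl (u : E × (E →L[ℝ] ℝ)) : genSnd E N (genInl E N u) = 0 := by
  refine Prod.ext rfl ?_
  ext v
  simp [genSnd_apply, genInl_apply]

lemma genFst_genInr (u : N × (N →L[ℝ] ℝ)) : genFst E N (genInr E N u) = 0 := by
  refine Prod.ext rfl ?_
  ext v
  simp [genFst_apply, genInr_apply]

lemma genSnd_genInr (u : N × (N →L[ℝ] ℝ)) : genSnd E N (genInr E N u) = u := by
  refine Prod.ext rfl ?_
  ext v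
  simp [genSnd_apply, genInr_apply]

lemma genInl_add_genInr (u : (E × N) × (E × N →L[ℝ] ℝ)) :
    genInl E N (genFst E N u) + genInr E N (genSnd E N u) = u := by
  refine Prod.ext ?_ ?_
  · simp [genFst_apply, genInl_apply, genSnd_apply, genInr_apply]
  · have h0 : u.2 (0, 0) = 0 := map_zero u.2
    ext v <;> simp [genFst_apply, genInl_apply, genSnd_apply, genInr_apply, h0]

lemma pairL_eq_add (u v : (E × N) × (E × N →L[ℝ] ℝ)) :
    pairL u v = pairL (genFst E N u) (genFst E N v) + pairL (genSnd E N u) (genSnd E N v) := by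
  have h : ∀ (ξ : E × N →L[ℝ] ℝ) (w : E × N), ξ w = ξ (w.1, 0) + ξ (0, w.2) := fun ξ w => by
    rw [← map_add]; simp
  simp only [pairL_apply, genFst_apply, genSnd_apply, ContinuousLinearMap.comp_apply,
    ContinuousLinearMap.inl_apply, ContinuousLinearMap.inr_apply]
  rw [h u.2 v.1, h v.2 u.1]
  ring

/-- The product of endomorphisms of `E ⊕ E^*` and `N ⊕ N^*`. -/
def prodEnd (B : E × (E →L[ℝ] ℝ) →L[ℝ] E × (E →L[ℝ] ℝ))
    (C : N × (N →L[ℝ] ℝ) →L[ℝ] N × (N →L[ℝ] ℝ)) :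
    (E × N) × (E × N →L[ℝ] ℝ) →L[ℝ] (E × N) × (E × N →L[ℝ] ℝ) :=
  (genInl E N).comp (B.comp (genFst E N)) + (genInr E N).comp (C.comp (genSnd E N))

lemma prodEnd_apply (B : E × (E →L[ℝ] ℝ) →L[ℝ] E × (E →L[ℝ] ℝ))
    (C : N × (N →L[ℝ] ℝ) →L[ℝ] N × (N →L[ℝ] ℝ)) (u : (E × N) × (E × N →L[ℝ] ℝ)) :
    prodEnd B C u = genInl E N (B (genFst E N u)) + genInr E N (C (genSnd E N u)) := rfl

lemma genFst_prodEnd (B : E × (E →L[ℝ] ℝ) →L[ℝ] E × (E →L[ℝ] ℝ))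
    (C : N × (N →L[ℝ] ℝ) →L[ℝ] N × (N →L[ℝ] ℝ)) (u : (E × N) × (E × N →L[ℝ] ℝ)) :
    genFst E N (prodEnd B C u) = B (genFst E N u) := by
  rw [prodEnd_apply, map_add, genFst_genInl, genFst_genInr, add_zero]

lemma genSnd_prodEnd (B : E × (E →L[ℝ] ℝ) →L[ℝ] E × (E →L[ℝ] ℝ))
    (C : N × (N →L[ℝ] ℝ) →L[ℝ] N × (N →L[ℝ] ℝ)) (u : (E × N) × (E × N →L[ℝ] ℝ)) :
    genSnd E N (prodEnd B C u) = C (genSnd E N u) := by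
  rw [prodEnd_apply, map_add, genSnd_genInl, genSnd_genInr, zero_add]

/-- `B ↦ B × 0` as a continuous linear map. -/
def prodEndL : (E × (E →L[ℝ] ℝ) →L[ℝ] E × (E →L[ℝ] ℝ)) →L[ℝ]
    (E × N) × (E × N →L[ℝ] ℝ) →L[ℝ] (E × N) × (E × N →L[ℝ] ℝ) :=
  (ContinuousLinearMap.compL ℝ _ _ _ (genInl E N)).comp
    ((ContinuousLinearMap.compL ℝ _ _ _).flip (genFst E N))

/-- The generalized complex structure of a complex structure `i`. -/
def complexEnd (i : N →L[ℝ] N) : N × (N →L[ℝ] ℝ) →L[ℝ] N × (N →L[ℝ] ℝ) :=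
  ((-i).comp (ContinuousLinearMap.fst ℝ _ _)).prod
    (((ContinuousLinearMap.compL ℝ N N ℝ).flip i).comp (ContinuousLinearMap.snd ℝ _ _))

lemma complexEnd_apply (i : N →L[ℝ] N) (u : N × (N →L[ℝ] ℝ)) :
    complexEnd i u = (-i u.1, u.2.comp i) := rfl

lemma complexEnd_sq {i : N →L[ℝ] N} (hi : ∀ v, i (i v) = -v) (u : N × (N →L[ℝ] ℝ)) :
    complexEnd i (complexEnd i u) = -u := by
  refine Prod.ext ?_ ?_
  · simp [complexEnd_apply, hi]
  · ext v
    simp [complexEnd_apply, hi]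

lemma complexEnd_skew (i : N →L[ℝ] N) (u v : N × (N →L[ℝ] ℝ)) :
    pairL v (complexEnd i u) = -pairL (complexEnd i v) u := by
  simp [complexEnd_apply, pairL_apply]
  ring

/-- A connection form on `E`, extended by zero to `E × N`. -/
def connProd (Γ : E →L[ℝ] E →L[ℝ] E) : E × N →L[ℝ] E × N →L[ℝ] E × N :=
  ((ContinuousLinearMap.compL ℝ (E × N) E (E × N)) (ContinuousLinearMap.inl ℝ E N)).comp
    (((ContinuousLinearMap.compL ℝ (E × N) E E).flip (ContinuousLinearMap.fst ℝ E N)).comp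
      (Γ.comp (ContinuousLinearMap.fst ℝ E N)))

lemma connProd_apply (Γ : E →L[ℝ] E →L[ℝ] E) (v w : E × N) :
    connProd Γ v w = (Γ v.1 w.1, 0) := rfl

lemma connAct_connProd (Γ : E →L[ℝ] E →L[ℝ] E) (u : (E × N) × (E × N →L[ℝ] ℝ)) (w : E × N) :
    connAct (connProd Γ) u w = genInl E N (connAct Γ (genFst E N u) w.1) := by
  refine Prod.ext rfl ?_
  ext v <;> simp [connAct_apply, connProd_apply, genInl_apply, genFst_apply]

/-- The Nijenhuis tensor of a bi-Hermitian structure that is parallel along `E` and varies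
holomorphically with a parameter in `N` vanishes. -/
theorem jetIntegrable_prodEnd {g : E →L[ℝ] E →L[ℝ] ℝ} {e : E ≃L[ℝ] (E →L[ℝ] ℝ)}
    (he : (e : E →L[ℝ] E →L[ℝ] ℝ) = g) (hsymm : ∀ v w, g v w = g w v) {S T : E →L[ℝ] E}
    (hS : ∀ v w, g (S v) w = -g v (S w)) (hT : ∀ v w, g (T v) w = -g v (T w))
    (hS2 : ∀ v, S (S v) = -v) (hT2 : ∀ v, T (T v) = -v)
    {i : N →L[ℝ] N} (hi : ∀ v, i (i v) = -v)
    {Γ : E →L[ℝ] E →L[ℝ] E} (hΓ : ∀ v w, Γ v w = Γ w v) {σ τ : N →L[ℝ] E →L[ℝ] E}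
    (hσ : ∀ ν v w, g (σ ν v) w = -g v (σ ν w)) (hτ : ∀ ν v w, g (τ ν v) w = -g v (τ ν w))
    (hSσ : ∀ ν v, σ ν v = -S (σ (i ν) v)) (hTτ : ∀ ν v, τ ν v = -T (τ (i ν) v))
    {Ψ' : E × N →L[ℝ] E × (E →L[ℝ] ℝ) →L[ℝ] E × (E →L[ℝ] ℝ)}
    (hΨ : ∀ w u, Ψ' w u + connAct Γ (biHermitian g S T u) w.1 -
      biHermitian g S T (connAct Γ u w.1) = biHermitian g (σ w.2) (τ w.2) u) :
    JetIntegrable (prodEnd (biHermitian g S T) (complexEnd i)) (prodEndL.comp Ψ') := by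
  -- The derivative in the `N` directions. There the connection term vanishes, since `connProd` sees
  -- only the `E` component, so `hΨ` identifies `R ν` with the structure of `(σ ν, τ ν)`.
  let R : N →L[ℝ] (E × N) × (E × N →L[ℝ] ℝ) →L[ℝ] (E × N) × (E × N →L[ℝ] ℝ) :=
    prodEndL.comp (Ψ'.comp (ContinuousLinearMap.inr ℝ E N))
  have hR : ∀ ν u, R ν u = genInl E N (biHermitian g (σ ν) (τ ν) (genFst E N u)) := by
    intro ν u
    rw [← hΨ (0, ν) (genFst E N u)]
    have h0 : ∀ z, connAct Γ z (0 : E) = 0 := fun z => map_zero _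
    simp only [h0, map_zero, add_zero, sub_zero]
    rfl
  refine jetIntegrable_of_connection (Γ := connProd Γ) ?_ ?_ ?_ (ContinuousLinearMap.snd ℝ E N) i R
    ?_ ?_ ?_ ?_
  · intro u
    conv_rhs => rw [← genInl_add_genInr u]
    rw [prodEnd_apply _ _ (prodEnd _ _ u), genFst_prodEnd, genSnd_prodEnd,
      biHermitian_sq he hS hT hS2 hT2, complexEnd_sq hi, map_neg, map_neg, neg_add]
  · intro u v
    rw [pairL_eq_add, pairL_eq_add (prodEnd _ _ v), genFst_prodEnd, genSnd_prodEnd, genFst_prodEnd,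
      genSnd_prodEnd, biHermitian_skew he hsymm hS hT, complexEnd_skew]
    ring
  · intro v w
    rw [connProd_apply, connProd_apply, hΓ]
  · intro w u
    rw [hR, ContinuousLinearMap.coe_snd', ← hΨ w, connAct_connProd, connAct_connProd,
      genFst_prodEnd, prodEnd_apply, genFst_genInl, genSnd_genInl, map_zero, map_zero, add_zero, map_sub, map_add]
    rfl
  · intro ν u
    rw [hR, hR, prodEnd_apply, genFst_genInl, genSnd_genInl, map_zero, map_zero, add_zero,
      ← biHermitian_comp he hS hT (hσ (i ν)) (hτ (i ν)) (hσ ν) (hτ ν) (hSσ ν) (hTτ ν)]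
  · intro u
    exact congrArg Prod.fst (genSnd_prodEnd (biHermitian g S T) (complexEnd i) u)
  · intro s
    have h1 : genFst E N (0, s.comp (ContinuousLinearMap.snd ℝ E N)) = 0 := by
      refine Prod.ext rfl ?_
      ext v
      simp [genFst_apply]
    have h2 : genSnd E N (0, s.comp (ContinuousLinearMap.snd ℝ E N)) = (0, s) := by
      refine Prod.ext rfl ?_
      ext v
      simp [genSnd_apply]
    rw [prodEnd_apply, h1, h2, map_zero, map_zero, zero_add, complexEnd_apply, genInr_apply]
    simp

end ProductAlgebra

/-! ### Holomorphic parametrization of the sphere by `ℂℙ¹` -/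

section ProjectiveLine

set_option maxSynthPendingDepth 3

/-- The affine coordinate expression of `spherePoint`. -/
def sphereCoord (z : ℂ) : ℝ × ℝ × ℝ :=
  ((1 - (z.re ^ 2 + z.im ^ 2)) * (1 + (z.re ^ 2 + z.im ^ 2))⁻¹,
    2 * z.re * (1 + (z.re ^ 2 + z.im ^ 2))⁻¹, 2 * z.im * (1 + (z.re ^ 2 + z.im ^ 2))⁻¹)

/-- The rotation of the sphere induced by the inversion of `ℂℙ¹`. -/
def sphereRot : ℝ × ℝ × ℝ →L[ℝ] ℝ × ℝ × ℝ :=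
  (-ContinuousLinearMap.id ℝ ℝ).prodMap
    ((ContinuousLinearMap.id ℝ ℝ).prodMap (-ContinuousLinearMap.id ℝ ℝ))

lemma sphereRot_apply (s : ℝ × ℝ × ℝ) : sphereRot s = (-s.1, s.2.1, -s.2.2) := rfl

lemma spherePoint_coe (z : ℂ) : spherePoint (z : OnePoint ℂ) = sphereCoord z := by
  change ((1 - ‖z‖ ^ 2) / (1 + ‖z‖ ^ 2), 2 * z.re / (1 + ‖z‖ ^ 2), 2 * z.im / (1 + ‖z‖ ^ 2)) = _
  have : ‖z‖ ^ 2 = z.re ^ 2 + z.im ^ 2 := by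
    rw [← Complex.normSq_eq_norm_sq, Complex.normSq_apply]; ring
  rw [this]
  simp only [sphereCoord, div_eq_mul_inv]

/-- Under stereographic projection `z ↦ z⁻¹` is the half-turn about the second axis. It reduces the
chart at `∞` to the affine one. -/
lemma spherePoint_inv (z : ℂ) :
    spherePoint (CP1.inv (z : OnePoint ℂ)) = sphereRot (sphereCoord z) := by
  by_cases hz : z = 0
  · subst hz
    rw [CP1.inv_coe_zero]
    simp [sphereCoord, sphereRot_apply, spherePoint]
  · rw [CP1.inv_coe hz, spherePoint_coe]
    have h1 : z.re ^ 2 + z.im ^ 2 ≠ 0 := by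
      have := Complex.normSq_pos.2 hz
      rw [Complex.normSq_apply] at this
      nlinarith
    have h2 : 1 + (z.re ^ 2 + z.im ^ 2) ≠ 0 := by positivity
    simp only [sphereCoord, sphereRot_apply, Complex.inv_re, Complex.inv_im, Complex.normSq_apply]
    have h3 : z.re * z.re + z.im * z.im = z.re ^ 2 + z.im ^ 2 := by ring
    rw [h3]
    have h4 : 1 + ((z.re / (z.re ^ 2 + z.im ^ 2)) ^ 2 + (-z.im / (z.re ^ 2 + z.im ^ 2)) ^ 2) =
        (1 + (z.re ^ 2 + z.im ^ 2)) / (z.re ^ 2 + z.im ^ 2) := by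
      field_simp
      ring
    rw [h4]
    refine Prod.ext ?_ (Prod.ext ?_ ?_)
    · simp only; field_simp; ring
    · simp only; field_simp
    · simp only; field_simp

lemma contDiff_sphereCoord {n : WithTop ℕ∞} : ContDiff ℝ n sphereCoord := by
  have hre : ContDiff ℝ n Complex.re := Complex.reCLM.contDiff
  have him : ContDiff ℝ n Complex.im := Complex.imCLM.contDiff
  have h : ContDiff ℝ n fun z : ℂ => (1 + (z.re ^ 2 + z.im ^ 2))⁻¹ :=
    (contDiff_const.add ((hre.pow 2).add (him.pow 2))).inv fun z => by positivity
  exact ((contDiff_const.sub ((hre.pow 2).add (him.pow 2))).mul h).prodMk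
    (((contDiff_const.mul hre).mul h).prodMk ((contDiff_const.mul him).mul h))

/-- The points and derivatives of a holomorphic parametrization of the unit sphere of `ℝ³`:
`s` is a unit vector, and `ds(i v) = s × ds(v)` is orthogonal to `s`. -/
structure IsHolomorphicJet (s : ℝ × ℝ × ℝ) (s' : ℂ →L[ℝ] ℝ × ℝ × ℝ) : Prop where
  unit : s.1 ^ 2 + s.2.1 ^ 2 + s.2.2 ^ 2 = 1
  cross₁ : ∀ v, (s' (Complex.I * v)).1 = s.2.1 * (s' v).2.2 - s.2.2 * (s' v).2.1
  cross₂ : ∀ v, (s' (Complex.I * v)).2.1 = s.2.2 * (s' v).1 - s.1 * (s' v).2.2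
  cross₃ : ∀ v, (s' (Complex.I * v)).2.2 = s.1 * (s' v).2.1 - s.2.1 * (s' v).1

/-- Stereographic projection is conformal, and with this orientation multiplication by `i` becomes
the quarter turn `s × ·` of the tangent plane at `s`. The proof differentiates the explicit formula.
-/
lemma sphereCoord_isHolomorphicJet (z : ℂ) :
    IsHolomorphicJet (sphereCoord z) (fderiv ℝ sphereCoord z) := by
  have hre : HasFDerivAt Complex.re Complex.reCLM z := Complex.reCLM.hasFDerivAt
  have him : HasFDerivAt Complex.im Complex.imCLM z := Complex.imCLM.hasFDerivAt
  have hD : 1 + (z.re ^ 2 + z.im ^ 2) ≠ 0 := by positivity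
  have hN := (hre.pow 2).add (him.pow 2)
  have hd := (hN.const_add 1)
  have hi := (hasDerivAt_inv hD).comp_hasFDerivAt z hd
  have h := ((hN.const_sub 1).mul hi).prodMk
    (((hre.const_mul 2).mul hi).prodMk ((him.const_mul 2).mul hi))
  have hf : ∀ v : ℂ, fderiv ℝ sphereCoord z v = _ := fun v =>
    congrArg (fun L : ℂ →L[ℝ] ℝ × ℝ × ℝ => L v) (HasFDerivAt.fderiv (f := sphereCoord) h)
  simp at hf
  refine ⟨?_, fun v => ?_, fun v => ?_, fun v => ?_⟩
  · simp only [sphereCoord]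
    field_simp
    ring
  all_goals
    simp only [hf, sphereCoord, Complex.mul_re, Complex.mul_im, Complex.I_re, Complex.I_im]
    field_simp
    ring

/-- `sphereRot` is a rotation, so it preserves lengths and cross products. -/
lemma IsHolomorphicJet.rot {s : ℝ × ℝ × ℝ} {s' : ℂ →L[ℝ] ℝ × ℝ × ℝ} (h : IsHolomorphicJet s s') :
    IsHolomorphicJet (sphereRot s) (sphereRot.comp s') where
  unit := by simpa [sphereRot_apply] using h.unit
  cross₁ v := by simp [sphereRot_apply, h.cross₁]; ring
  cross₂ v := by simp [sphereRot_apply, h.cross₂]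
  cross₃ v := by simp [sphereRot_apply, h.cross₃]; ring

/-- `spherePoint` is smooth and holomorphic in the preferred chart at a point of `ℂℙ¹`. -/
theorem spherePoint_chart (p : CP1) :
    ContDiff ℝ ∞ (fun z => spherePoint ((extChartAt 𝓘(ℝ, ℂ) p).symm z)) ∧
    ∀ z, IsHolomorphicJet (spherePoint ((extChartAt 𝓘(ℝ, ℂ) p).symm z))
      (fderiv ℝ (fun z => spherePoint ((extChartAt 𝓘(ℝ, ℂ) p).symm z)) z) := by
  induction p using OnePoint.rec with
  | infty =>
    have h : (fun z => spherePoint ((extChartAt 𝓘(ℝ, ℂ) (OnePoint.infty : CP1)).symm z)) =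
        fun z => sphereRot (sphereCoord z) := funext spherePoint_inv
    have h' : ∀ z, spherePoint ((extChartAt 𝓘(ℝ, ℂ) (OnePoint.infty : CP1)).symm z) =
        sphereRot (sphereCoord z) := spherePoint_inv
    rw [h]
    refine ⟨sphereRot.contDiff.comp contDiff_sphereCoord, fun z => ?_⟩
    have hd : DifferentiableAt ℝ sphereCoord z :=
      (contDiff_sphereCoord (n := 1)).differentiable one_ne_zero z
    have h2 : fderiv ℝ (fun z => sphereRot (sphereCoord z)) z =
        sphereRot.comp (fderiv ℝ sphereCoord z) :=
      (sphereRot.hasFDerivAt.comp z hd.hasFDerivAt).fderiv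
    rw [h', h2]
    exact (sphereCoord_isHolomorphicJet z).rot
  | coe q =>
    have h : (fun z => spherePoint ((extChartAt 𝓘(ℝ, ℂ) (q : CP1)).symm z)) = sphereCoord :=
      funext spherePoint_coe
    have h' : ∀ z, spherePoint ((extChartAt 𝓘(ℝ, ℂ) (q : CP1)).symm z) = sphereCoord z :=
      spherePoint_coe
    rw [h]
    refine ⟨contDiff_sphereCoord, fun z => ?_⟩
    rw [h']
    exact sphereCoord_isHolomorphicJet z

/-- The coordinate changes of `ℂℙ¹` are holomorphic. -/
theorem tangentCoordChange_cp1_comm {p q r : CP1} (hp : r ∈ (extChartAt 𝓘(ℝ, ℂ) p).source)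
    (hq : r ∈ (extChartAt 𝓘(ℝ, ℂ) q).source) (v : ℂ) :
    tangentCoordChange 𝓘(ℝ, ℂ) p q r (Complex.I * v) =
      Complex.I * tangentCoordChange 𝓘(ℝ, ℂ) p q r v := by
  have hp' : r ∈ (extChartAt 𝓘(ℂ, ℂ) p).source := by
    rw [extChartAt_source] at hp ⊢; exact hp
  have hq' : r ∈ (extChartAt 𝓘(ℂ, ℂ) q).source := by
    rw [extChartAt_source] at hq ⊢; exact hq
  -- The complex and real models share the same charts, so by uniqueness the real derivative of a
  -- transition map is the complex one with scalars restricted, and it commutes with `i`.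
  have h1 := hasFDerivWithinAt_tangentCoordChange (I := 𝓘(ℂ, ℂ)) ⟨hp', hq'⟩
  have h2 := hasFDerivWithinAt_tangentCoordChange (I := 𝓘(ℝ, ℂ)) ⟨hp, hq⟩
  have h3 := h1.restrictScalars ℝ
  rw [modelWithCornersSelf_coe, Set.range_id, hasFDerivWithinAt_univ] at h2 h3
  have h4 := h2.unique h3
  rw [h4]
  simp only [ContinuousLinearMap.coe_restrictScalars', ← smul_eq_mul, map_smul]

end ProjectiveLine

/-! ### Imaginary quaternions acting on a vector space -/

section Quaternions

variable {E : Type*} [NormedAddCommGroup E] [NormedSpace ℝ E]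

/-- The combination `a I + b J + c K` as a linear map of `(a, b, c)`. -/
def quatL (I J K : E →L[ℝ] E) : ℝ × ℝ × ℝ →L[ℝ] E →L[ℝ] E :=
  (ContinuousLinearMap.fst ℝ ℝ (ℝ × ℝ)).smulRight I +
    (((ContinuousLinearMap.fst ℝ ℝ ℝ).comp (ContinuousLinearMap.snd ℝ ℝ (ℝ × ℝ))).smulRight J +
    ((ContinuousLinearMap.snd ℝ ℝ ℝ).comp (ContinuousLinearMap.snd ℝ ℝ (ℝ × ℝ))).smulRight K)

lemma quatL_apply (I J K : E →L[ℝ] E) (s : ℝ × ℝ × ℝ) (v : E) :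
    quatL I J K s v = s.1 • I v + s.2.1 • J v + s.2.2 • K v := by
  simp [quatL, add_assoc]

/-- The quaternion relations. -/
structure QuatRel (I J K : E → E) : Prop where
  II : ∀ v, I (I v) = -v
  JJ : ∀ v, J (J v) = -v
  KK : ∀ v, K (K v) = -v
  IJ : ∀ v, I (J v) = K v
  JI : ∀ v, J (I v) = -K v
  JK : ∀ v, J (K v) = I v
  KJ : ∀ v, K (J v) = -I v
  KI : ∀ v, K (I v) = J v
  IK : ∀ v, I (K v) = -J v

/-- The product of imaginary quaternions: minus the dot product plus the cross product. -/
lemma quatL_mul {I J K : E →L[ℝ] E} (h : QuatRel I J K) (s t : ℝ × ℝ × ℝ) (v : E) :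
    quatL I J K s (quatL I J K t v) =
      -(s.1 * t.1 + s.2.1 * t.2.1 + s.2.2 * t.2.2) • v +
      quatL I J K (s.2.1 * t.2.2 - s.2.2 * t.2.1, s.2.2 * t.1 - s.1 * t.2.2,
        s.1 * t.2.1 - s.2.1 * t.1) v := by
  simp only [quatL_apply, map_add, map_smul, h.II, h.JJ, h.KK, h.IJ, h.JI, h.JK, h.KJ, h.KI, h.IK]
  module

lemma quatL_sq {I J K : E →L[ℝ] E} (h : QuatRel I J K) {s : ℝ × ℝ × ℝ}
    (hs : s.1 ^ 2 + s.2.1 ^ 2 + s.2.2 ^ 2 = 1) (v : E) :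
    quatL I J K s (quatL I J K s v) = -v := by
  rw [quatL_mul h, show s.1 * s.1 + s.2.1 * s.2.1 + s.2.2 * s.2.2 = 1 by rw [← hs]; ring]
  simp only [quatL_apply]
  module

/-- Holomorphy of the twistor family. As `ds(iν) = s × ds(ν)` is orthogonal to `s`, the quaternion
product of `s` and `ds(iν)` is just `s × ds(iν) = ds(i·iν) = -ds(ν)`. -/
lemma IsHolomorphicJet.quatL_eq {I J K : E →L[ℝ] E} (h : QuatRel I J K) {s : ℝ × ℝ × ℝ}
    {s' : ℂ →L[ℝ] ℝ × ℝ × ℝ} (hs : IsHolomorphicJet s s') (ν : ℂ) (v : E) :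
    quatL I J K (s' ν) v = -quatL I J K s (quatL I J K (s' (Complex.I * ν)) v) := by
  have h1 := hs.unit
  have hI : Complex.I * (Complex.I * ν) = -ν := by
    rw [← mul_assoc, Complex.I_mul_I, neg_one_mul]
  have e1 := hs.cross₁ (Complex.I * ν)
  have e2 := hs.cross₂ (Complex.I * ν)
  have e3 := hs.cross₃ (Complex.I * ν)
  rw [hI, map_neg] at e1 e2 e3
  have f1 := hs.cross₁ ν
  have f2 := hs.cross₂ ν
  have f3 := hs.cross₃ ν
  rw [quatL_mul h]
  rw [show s.1 * (s' (Complex.I * ν)).1 + s.2.1 * (s' (Complex.I * ν)).2.1 +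
    s.2.2 * (s' (Complex.I * ν)).2.2 = 0 by rw [f1, f2, f3]; ring]
  rw [← e1, ← e2, ← e3]
  simp only [quatL_apply, Prod.fst_neg, Prod.snd_neg]
  module

lemma quatL_skew {g : E →L[ℝ] E →L[ℝ] ℝ} {I J K : E →L[ℝ] E}
    (hI : ∀ v w, g (I v) w = -g v (I w)) (hJ : ∀ v w, g (J v) w = -g v (J w))
    (hK : ∀ v w, g (K v) w = -g v (K w)) (s : ℝ × ℝ × ℝ) (v w : E) :
    g (quatL I J K s v) w = -g v (quatL I J K s w) := by
  simp [quatL_apply, hI, hJ, hK]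
  ring

end Quaternions

/-! ### Kähler structures read in a chart -/

section KahlerChart

set_option maxSynthPendingDepth 3

variable {E : Type*} [NormedAddCommGroup E] [NormedSpace ℝ E]
  {M : Type*} [TopologicalSpace M] [ChartedSpace E M] [IsManifold 𝓘(ℝ, E) ∞ M]

/-- The metric read in the preferred chart at `x₀`. -/
def metricInChart (g : RiemannianMetric E M) (x₀ : M) (y : E) : E →L[ℝ] E →L[ℝ] ℝ :=
  let p := (extChartAt 𝓘(ℝ, E) x₀).symm y
  ((ContinuousLinearMap.compL ℝ E E ℝ).flip (tangentCoordChange 𝓘(ℝ, E) x₀ p p)).comp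
    (ContinuousLinearMap.comp (g.inner p : E →L[ℝ] E →L[ℝ] ℝ)
      (tangentCoordChange 𝓘(ℝ, E) x₀ p p))

/-- A field of endomorphisms read in the preferred chart at `x₀`. -/
def endInChart (A : Π x : M, TangentSpace 𝓘(ℝ, E) x →L[ℝ] TangentSpace 𝓘(ℝ, E) x) (x₀ : M)
    (y : E) : E →L[ℝ] E :=
  let p := (extChartAt 𝓘(ℝ, E) x₀).symm y
  (tangentCoordChange 𝓘(ℝ, E) p x₀ p).comp
    (ContinuousLinearMap.comp (A p : E →L[ℝ] E) (tangentCoordChange 𝓘(ℝ, E) x₀ p p))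

lemma metricInChart_apply (g : RiemannianMetric E M) (x₀ : M) (y v w : E) :
    metricInChart g x₀ y v w = g.inner ((extChartAt 𝓘(ℝ, E) x₀).symm y)
      (tangentCoordChange 𝓘(ℝ, E) x₀ ((extChartAt 𝓘(ℝ, E) x₀).symm y)
        ((extChartAt 𝓘(ℝ, E) x₀).symm y) v)
      (tangentCoordChange 𝓘(ℝ, E) x₀ ((extChartAt 𝓘(ℝ, E) x₀).symm y)
        ((extChartAt 𝓘(ℝ, E) x₀).symm y) w) := rfl

lemma tangentCoordChange_left_inv_apply {x₀ p : M} (hp : p ∈ (extChartAt 𝓘(ℝ, E) x₀).source)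
    (v : E) : tangentCoordChange 𝓘(ℝ, E) p x₀ p (tangentCoordChange 𝓘(ℝ, E) x₀ p p v) = v :=
  congrArg (fun L : E →L[ℝ] E => L v) (tangentCoordChange_left_inv hp)

lemma tangentCoordChange_right_inv_apply {x₀ p : M} (hp : p ∈ (extChartAt 𝓘(ℝ, E) x₀).source)
    (v : E) : tangentCoordChange 𝓘(ℝ, E) x₀ p p (tangentCoordChange 𝓘(ℝ, E) p x₀ p v) = v :=
  congrArg (fun L : E →L[ℝ] E => L v) (tangentCoordChange_right_inv hp)

lemma tangentCoordChange_endInChart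
    (A : Π x : M, TangentSpace 𝓘(ℝ, E) x →L[ℝ] TangentSpace 𝓘(ℝ, E) x) {x₀ : M} {y : E}
    (hy : y ∈ (extChartAt 𝓘(ℝ, E) x₀).target) (v : E) :
    tangentCoordChange 𝓘(ℝ, E) x₀ ((extChartAt 𝓘(ℝ, E) x₀).symm y)
        ((extChartAt 𝓘(ℝ, E) x₀).symm y) (endInChart A x₀ y v) =
      (A ((extChartAt 𝓘(ℝ, E) x₀).symm y) : E →L[ℝ] E)
        (tangentCoordChange 𝓘(ℝ, E) x₀ ((extChartAt 𝓘(ℝ, E) x₀).symm y)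
        ((extChartAt 𝓘(ℝ, E) x₀).symm y) v) :=
  tangentCoordChange_right_inv_apply ((extChartAt 𝓘(ℝ, E) x₀).map_target hy) _

lemma metricInChart_symm (g : RiemannianMetric E M) (x₀ : M) (y v w : E) :
    metricInChart g x₀ y v w = metricInChart g x₀ y w v :=
  g.symm _ _ _

lemma metricInChart_pos (g : RiemannianMetric E M) {x₀ : M} {y : E}
    (hy : y ∈ (extChartAt 𝓘(ℝ, E) x₀).target) (v : E) (hv : v ≠ 0) :
    0 < metricInChart g x₀ y v v := by
  refine g.pos _ _ fun h => hv ?_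
  rw [← tangentCoordChange_left_inv_apply ((extChartAt 𝓘(ℝ, E) x₀).map_target hy) v]
  exact (congrArg (tangentCoordChange 𝓘(ℝ, E) ((extChartAt 𝓘(ℝ, E) x₀).symm y) x₀
    ((extChartAt 𝓘(ℝ, E) x₀).symm y)) h).trans (map_zero _)

lemma contDiffAt_metricInChart (g : RiemannianMetric E M) (x : M) :
    ContDiffAt ℝ ∞ (metricInChart g x) (extChartAt 𝓘(ℝ, E) x x) := by
  have h := (contMDiffAt_hom_bundle _).1 (g.contMDiff x)
  have h2 := contMDiffAt_iff_contDiffAt_chart.1 h.2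
  refine h2.congr_of_eventuallyEq ?_
  filter_upwards [extChartAt_target_mem_nhds (I := 𝓘(ℝ, E)) x] with y hy
  have hp : (extChartAt 𝓘(ℝ, E) x).symm y ∈ (chartAt E x).source := by
    rw [← extChartAt_source 𝓘(ℝ, E)]
    exact (extChartAt 𝓘(ℝ, E) x).map_target hy
  ext v w
  simp only [Function.comp_apply, ContinuousLinearMap.inCoordinates,
    TangentBundle.symmL_trivializationAt_eq_core hp]
  have hb : (extChartAt 𝓘(ℝ, E) x).symm y ∈ (trivializationAt (E →L[ℝ] ℝ)
      (fun b : M => TangentSpace 𝓘(ℝ, E) b →L[ℝ] ℝ) x).baseSet := ⟨hp, Set.mem_univ _⟩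
  -- The metric is a section of the maps from `T` to `T^*`; the trivialization of `T^*` is
  -- precomposition with the coordinate change.
  have key : ∀ η : TangentSpace 𝓘(ℝ, E) ((extChartAt 𝓘(ℝ, E) x).symm y) →L[ℝ] ℝ,
      (trivializationAt (E →L[ℝ] ℝ)
        (fun b : M => TangentSpace 𝓘(ℝ, E) b →L[ℝ] ℝ) x).continuousLinearMapAt
        ℝ ((extChartAt 𝓘(ℝ, E) x).symm y) η =
      (η : E →L[ℝ] ℝ).comp (tangentCoordChange 𝓘(ℝ, E) x
        ((extChartAt 𝓘(ℝ, E) x).symm y) ((extChartAt 𝓘(ℝ, E) x).symm y) : E →L[ℝ] E) := by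
    intro η
    rw [Bundle.Trivialization.continuousLinearMapAt_apply,
      Bundle.Trivialization.coe_linearMapAt_of_mem _ hb]
    simp only [hom_trivializationAt_apply, ContinuousLinearMap.inCoordinates,
      TangentBundle.symmL_trivializationAt_eq_core hp]
    ext v
    simp
  exact congrArg (fun L : E →L[ℝ] ℝ => L w) (key _).symm

lemma contDiffAt_endInChart
    {A : Π x : M, TangentSpace 𝓘(ℝ, E) x →L[ℝ] TangentSpace 𝓘(ℝ, E) x}
    (hA : ContMDiff 𝓘(ℝ, E) (𝓘(ℝ, E).prod 𝓘(ℝ, E →L[ℝ] E)) ∞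
      (fun x => Bundle.TotalSpace.mk' (E →L[ℝ] E)
        (E := fun x : M => TangentSpace 𝓘(ℝ, E) x →L[ℝ] TangentSpace 𝓘(ℝ, E) x) x (A x))) (x : M) :
    ContDiffAt ℝ ∞ (endInChart A x) (extChartAt 𝓘(ℝ, E) x x) := by
  have h := (contMDiffAt_hom_bundle _).1 (hA x)
  have h2 := contMDiffAt_iff_contDiffAt_chart.1 h.2
  refine h2.congr_of_eventuallyEq ?_
  filter_upwards [extChartAt_target_mem_nhds (I := 𝓘(ℝ, E)) x] with y hy
  have hp : (extChartAt 𝓘(ℝ, E) x).symm y ∈ (chartAt E x).source := by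
    rw [← extChartAt_source 𝓘(ℝ, E)]
    exact (extChartAt 𝓘(ℝ, E) x).map_target hy
  simp only [Function.comp_apply, ContinuousLinearMap.inCoordinates,
    TangentBundle.symmL_trivializationAt_eq_core hp,
    TangentBundle.continuousLinearMapAt_trivializationAt_eq_core hp]
  rfl

/-- The vector field with constant coefficients in the preferred chart at `x₀`. -/
def constField (x₀ : M) (v : E) (p : M) : TangentSpace 𝓘(ℝ, E) p :=
  tangentCoordChange 𝓘(ℝ, E) x₀ p p v

lemma smoothOn_constField (x₀ : M) (v : E) :
    SmoothVectorFieldOn 𝓘(ℝ, E) (constField x₀ v) (chartAt E x₀).source := by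
  have h1 := (trivializationAt E (TangentSpace 𝓘(ℝ, E)) x₀).contMDiffOn_symm
    (IB := 𝓘(ℝ, E)) (n := ∞)
  have h2 : ContMDiffOn 𝓘(ℝ, E) (𝓘(ℝ, E).prod 𝓘(ℝ, E)) ∞ (fun p : M => (p, v))
    (chartAt E x₀).source := (contMDiff_id.prodMk contMDiff_const).contMDiffOn
  have h3 := h1.comp h2 (fun p hp => by
    rw [Set.mem_preimage, Bundle.Trivialization.mem_target]
    exact hp)
  refine h3.congr fun p hp => ?_
  have hb : p ∈ (trivializationAt E (TangentSpace 𝓘(ℝ, E)) x₀).baseSet := hp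
  have h4 := (trivializationAt E (TangentSpace 𝓘(ℝ, E)) x₀).mk_symm hb v
  refine Eq.trans ?_ h4
  have h5 := congrArg (fun L : E →L[ℝ] E => L v)
    (TangentBundle.symmL_trivializationAt_eq_core (I := 𝓘(ℝ, E)) hp)
  exact congrArg (fun w : TangentSpace 𝓘(ℝ, E) p => (⟨p, w⟩ : TangentBundle 𝓘(ℝ, E) M))
    (h5.symm.trans (Bundle.Trivialization.symmL_apply (R := ℝ) _ hb v))

lemma vecInChart_constField {x₀ : M} {y : E} (hy : y ∈ (extChartAt 𝓘(ℝ, E) x₀).target) (v : E) :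
    vecInChart 𝓘(ℝ, E) (constField x₀ v) x₀ y = v :=
  tangentCoordChange_left_inv_apply ((extChartAt 𝓘(ℝ, E) x₀).map_target hy) v

lemma endInChart_self (A : Π x : M, TangentSpace 𝓘(ℝ, E) x →L[ℝ] TangentSpace 𝓘(ℝ, E) x) (x : M) :
    endInChart A x (extChartAt 𝓘(ℝ, E) x x) = A x := by
  unfold endInChart
  simp only
  rw [extChartAt_to_inv, tangentCoordChange_same]
  rfl

lemma IsKahler.endInChart_sq {g : RiemannianMetric E M}
    {A : Π x : M, TangentSpace 𝓘(ℝ, E) x →L[ℝ] TangentSpace 𝓘(ℝ, E) x} (h : IsKahler g A) {x₀ : M}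
    {y : E} (hy : y ∈ (extChartAt 𝓘(ℝ, E) x₀).target) (v : E) :
    endInChart A x₀ y (endInChart A x₀ y v) = -v := by
  have hp := (extChartAt 𝓘(ℝ, E) x₀).map_target hy
  set p := (extChartAt 𝓘(ℝ, E) x₀).symm y with hp'
  have h1 : (A p : E →L[ℝ] E) (tangentCoordChange 𝓘(ℝ, E) x₀ p p (endInChart A x₀ y v)) =
      -tangentCoordChange 𝓘(ℝ, E) x₀ p p v := by
    rw [tangentCoordChange_endInChart A hy]
    exact h.sq p (tangentCoordChange 𝓘(ℝ, E) x₀ p p v)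
  change tangentCoordChange 𝓘(ℝ, E) p x₀ p ((A p : E →L[ℝ] E)
    (tangentCoordChange 𝓘(ℝ, E) x₀ p p (endInChart A x₀ y v))) = -v
  rw [h1, map_neg, tangentCoordChange_left_inv_apply hp]

lemma IsKahler.metricInChart_orthogonal {g : RiemannianMetric E M}
    {A : Π x : M, TangentSpace 𝓘(ℝ, E) x →L[ℝ] TangentSpace 𝓘(ℝ, E) x} (h : IsKahler g A) {x₀ : M}
    {y : E} (hy : y ∈ (extChartAt 𝓘(ℝ, E) x₀).target) (v w : E) :
    metricInChart g x₀ y (endInChart A x₀ y v) (endInChart A x₀ y w) =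
      metricInChart g x₀ y v w := by
  rw [metricInChart_apply, tangentCoordChange_endInChart A hy, tangentCoordChange_endInChart A hy]
  exact h.orthogonal _ _ _

/-- The Nijenhuis tensor tested on fields with constant coefficients in the chart, whose mutual
bracket vanishes, so that only derivatives of `A` remain. -/
lemma IsKahler.nijenhuis {g : RiemannianMetric E M}
    {A : Π x : M, TangentSpace 𝓘(ℝ, E) x →L[ℝ] TangentSpace 𝓘(ℝ, E) x} (h : IsKahler g A) {x : M}
    {A' : E →L[ℝ] E →L[ℝ] E} (hA' : HasFDerivAt (endInChart A x) A' (extChartAt 𝓘(ℝ, E) x x))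
    (v w : E) :
    A' (endInChart A x (extChartAt 𝓘(ℝ, E) x x) v) w -
      A' (endInChart A x (extChartAt 𝓘(ℝ, E) x x) w) v +
      endInChart A x (extChartAt 𝓘(ℝ, E) x x) (A' w v) -
      endInChart A x (extChartAt 𝓘(ℝ, E) x x) (A' v w) = 0 := by
  have hx : x ∈ (chartAt E x).source := mem_chart_source E x
  have h1 := h.integrable _ (chartAt E x).open_source _ _ (smoothOn_constField x v)
    (smoothOn_constField x w) x hx
  simp only [mlieBracket_eq_lieBracket] at h1
  have hc : ∀ z : E, vecInChart 𝓘(ℝ, E) (constField x z) x =ᶠ[𝓝 (extChartAt 𝓘(ℝ, E) x x)]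
      fun _ => z := fun z => by
    filter_upwards [extChartAt_target_mem_nhds (I := 𝓘(ℝ, E)) x] with y hy
    exact vecInChart_constField hy z
  have hAc : ∀ z : E, vecInChart 𝓘(ℝ, E) (fun p => A p (constField x z p)) x
      =ᶠ[𝓝 (extChartAt 𝓘(ℝ, E) x x)] fun y => endInChart A x y z := fun z => Filter.EventuallyEq.rfl
  have hd : ∀ z u : E, fderiv ℝ (fun y => endInChart A x y z) (extChartAt 𝓘(ℝ, E) x x) u = A' u z :=
    fun z u => by
      rw [(hA'.clm_apply (hasFDerivAt_const z _)).fderiv]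
      simp
  have e1 : VectorField.lieBracket ℝ (vecInChart 𝓘(ℝ, E) (fun p => A p (constField x v p)) x)
      (vecInChart 𝓘(ℝ, E) (fun p => A p (constField x w p)) x) (extChartAt 𝓘(ℝ, E) x x) =
      A' (endInChart A x (extChartAt 𝓘(ℝ, E) x x) v) w -
      A' (endInChart A x (extChartAt 𝓘(ℝ, E) x x) w) v := by
    rw [(hAc v).lieBracket_vectorField_eq (hAc w), VectorField.lieBracket, hd, hd]
  have e2 : VectorField.lieBracket ℝ (vecInChart 𝓘(ℝ, E) (fun p => A p (constField x v p)) x)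
      (vecInChart 𝓘(ℝ, E) (constField x w) x) (extChartAt 𝓘(ℝ, E) x x) = -A' w v := by
    rw [(hAc v).lieBracket_vectorField_eq (hc w), VectorField.lieBracket, hd]
    simp
  have e3 : VectorField.lieBracket ℝ (vecInChart 𝓘(ℝ, E) (constField x v) x)
      (vecInChart 𝓘(ℝ, E) (fun p => A p (constField x w p)) x) (extChartAt 𝓘(ℝ, E) x x) =
      A' v w := by
    rw [(hc v).lieBracket_vectorField_eq (hAc w), VectorField.lieBracket, hd]
    simp
  have e4 : VectorField.lieBracket ℝ (vecInChart 𝓘(ℝ, E) (constField x v) x)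
      (vecInChart 𝓘(ℝ, E) (constField x w) x) (extChartAt 𝓘(ℝ, E) x x) = 0 := by
    rw [(hc v).lieBracket_vectorField_eq (hc w), VectorField.lieBracket]
    simp
  rw [e1, e2, e3, e4] at h1
  have key : ∀ (L : E →L[ℝ] E) (a b c : E), a - L (-b) - L c - 0 = 0 → a + L b - L c = 0 := by
    intro L a b c hL
    simpa using hL
  refine key _ _ _ _ ?_
  refine Eq.trans ?_ h1
  exact congrArg (fun L : E →L[ℝ] E => A' (endInChart A x (extChartAt 𝓘(ℝ, E) x x) v) w -
    A' (endInChart A x (extChartAt 𝓘(ℝ, E) x x) w) v - L (-A' w v) - L (A' v w) - 0)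
    (endInChart_self A x)

/-- Closedness of `ω_A` expanded by the product rule, since in the chart `ω_A(b, c) = g(A b, c)`. -/
lemma IsKahler.closed_chart {g : RiemannianMetric E M}
    {A : Π x : M, TangentSpace 𝓘(ℝ, E) x →L[ℝ] TangentSpace 𝓘(ℝ, E) x} (h : IsKahler g A) {x : M}
    {A' : E →L[ℝ] E →L[ℝ] E} (hA' : HasFDerivAt (endInChart A x) A' (extChartAt 𝓘(ℝ, E) x x))
    {g' : E →L[ℝ] E →L[ℝ] E →L[ℝ] ℝ}
    (hg' : HasFDerivAt (metricInChart g x) g' (extChartAt 𝓘(ℝ, E) x x)) (u v w : E) :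
    (g' u (endInChart A x (extChartAt 𝓘(ℝ, E) x x) v) w +
        metricInChart g x (extChartAt 𝓘(ℝ, E) x x) (A' u v) w) -
      (g' v (endInChart A x (extChartAt 𝓘(ℝ, E) x x) u) w +
        metricInChart g x (extChartAt 𝓘(ℝ, E) x x) (A' v u) w) +
      (g' w (endInChart A x (extChartAt 𝓘(ℝ, E) x x) u) v +
        metricInChart g x (extChartAt 𝓘(ℝ, E) x x) (A' w u) v) = 0 := by
  have hω : ∀ b c : E, (fun y => twoFormInChart 𝓘(ℝ, E) (kahlerForm g A) x y b c)
      =ᶠ[𝓝 (extChartAt 𝓘(ℝ, E) x x)]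
      fun y => metricInChart g x y (endInChart A x y b) c := fun b c => by
    filter_upwards [extChartAt_target_mem_nhds (I := 𝓘(ℝ, E)) x] with y hy
    rw [metricInChart_apply, tangentCoordChange_endInChart A hy]
    exact congrArg (fun D : E →L[ℝ] E => (g.inner ((extChartAt 𝓘(ℝ, E) x).symm y) :
      E →L[ℝ] E →L[ℝ] ℝ) ((A ((extChartAt 𝓘(ℝ, E) x).symm y) : E →L[ℝ] E) (D b)) (D c))
      (mfderivWithin_extChartAt_symm_eq hy)
  have hd : ∀ a b c : E, fderivWithin ℝ (fun y => twoFormInChart 𝓘(ℝ, E) (kahlerForm g A) x y b c)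
      (Set.range 𝓘(ℝ, E)) (extChartAt 𝓘(ℝ, E) x x) a =
      g' a (endInChart A x (extChartAt 𝓘(ℝ, E) x x) b) c +
        metricInChart g x (extChartAt 𝓘(ℝ, E) x x) (A' a b) c := fun a b c => by
    rw [(𝓘(ℝ, E)).range_eq_univ, fderivWithin_univ, (hω b c).fderiv_eq]
    have h2 := (hg'.clm_apply (hA'.clm_apply (hasFDerivAt_const b _))).clm_apply
      (hasFDerivAt_const c _)
    rw [h2.fderiv]
    generalize extChartAt 𝓘(ℝ, E) x x = y₀
    simp
    ring
  rw [← hd, ← hd, ← hd]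
  refine Eq.trans ?_ (h.closed x u v w)
  have key : ∀ (F : E → E → E → ℝ) (D : E →L[ℝ] E), D = ContinuousLinearMap.id ℝ E →
      F u v w - F v u w + F w u v = F (D u) (D v) (D w) - F (D v) (D u) (D w) +
        F (D w) (D u) (D v) := by
    rintro F D rfl
    rfl
  exact key (fun a b c => fderivWithin ℝ (fun y => twoFormInChart 𝓘(ℝ, E) (kahlerForm g A) x y b c)
    (Set.range 𝓘(ℝ, E)) (extChartAt 𝓘(ℝ, E) x x) a) (chartDeriv 𝓘(ℝ, E) x) (chartDeriv_eq x)

/-- The complex structure of a Kähler manifold is parallel for the Levi-Civita connection. -/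
theorem IsKahler.parallel {g : RiemannianMetric E M}
    {A : Π x : M, TangentSpace 𝓘(ℝ, E) x →L[ℝ] TangentSpace 𝓘(ℝ, E) x} (h : IsKahler g A) {x : M}
    {A' : E →L[ℝ] E →L[ℝ] E} (hA' : HasFDerivAt (endInChart A x) A' (extChartAt 𝓘(ℝ, E) x x))
    {g' : E →L[ℝ] E →L[ℝ] E →L[ℝ] ℝ}
    (hg' : HasFDerivAt (metricInChart g x) g' (extChartAt 𝓘(ℝ, E) x x))
    {Γ : E →L[ℝ] E →L[ℝ] E} (hΓ : ∀ v w, Γ v w = Γ w v)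
    (hΓ' : ∀ u v w, g' u v w = metricInChart g x (extChartAt 𝓘(ℝ, E) x x) (Γ u v) w +
      metricInChart g x (extChartAt 𝓘(ℝ, E) x x) v (Γ u w)) (u v : E) :
    A' u v + Γ u (endInChart A x (extChartAt 𝓘(ℝ, E) x x) v) -
      endInChart A x (extChartAt 𝓘(ℝ, E) x x) (Γ u v) = 0 := by
  have ht := mem_extChartAt_target (I := 𝓘(ℝ, E)) x
  have hev := extChartAt_target_mem_nhds (I := 𝓘(ℝ, E)) x
  have hc := h.closed_chart hA' hg'
  have hn := h.nijenhuis hA'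
  have hpos := metricInChart_pos g ht
  have hsq := h.endInChart_sq ht
  have horth := h.metricInChart_orthogonal ht
  generalize extChartAt 𝓘(ℝ, E) x x = y₀ at *
  refine kahler_parallel (metricInChart_symm g x _) hpos hΓ hΓ' hsq ?_ horth ?_ hc hn u v
  -- The two infinitesimal hypotheses are the derivatives of `A² = -1` and of orthogonality, both
  -- valid throughout the chart.
  · intro u v
    have h1 : (fun y => endInChart A x y (endInChart A x y v)) =ᶠ[𝓝 y₀] fun _ => -v := by
      filter_upwards [hev] with y hy
      exact h.endInChart_sq hy v
    have h2 := hA'.clm_apply (hA'.clm_apply (hasFDerivAt_const v _))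
    have h3 := congrArg (fun L : E →L[ℝ] E => L u)
      ((h2.congr_of_eventuallyEq h1.symm).unique (hasFDerivAt_const (-v) _))
    simp at h3
    rw [add_comm]
    exact h3
  · intro u v w
    have h1 : (fun y => metricInChart g x y (endInChart A x y v) (endInChart A x y w))
        =ᶠ[𝓝 y₀] fun y => metricInChart g x y v w := by
      filter_upwards [hev] with y hy
      exact h.metricInChart_orthogonal hy v w
    have h2 := (hg'.clm_apply (hA'.clm_apply (hasFDerivAt_const v _))).clm_apply
      (hA'.clm_apply (hasFDerivAt_const w _))
    have h4 := (hg'.clm_apply (hasFDerivAt_const v _)).clm_apply (hasFDerivAt_const w _)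
    have h3 := congrArg (fun L : E →L[ℝ] ℝ => L u)
      ((h2.congr_of_eventuallyEq h1.symm).unique h4)
    simp at h3
    linarith

end KahlerChart

/-! ### Naturality under change of frame -/

section ChangeOfFrame

set_option maxSynthPendingDepth 3

variable {E N : Type*} [NormedAddCommGroup E] [NormedSpace ℝ E]
  [NormedAddCommGroup N] [NormedSpace ℝ N]

/-- The action on `E ⊕ E^*` of a change of frame with matrix `Q` and inverse `D`. -/
def frameChange (Q D : E →L[ℝ] E) (u : E × (E →L[ℝ] ℝ)) : E × (E →L[ℝ] ℝ) :=
  (Q u.1, u.2.comp D)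

lemma genFst_frameChange (Q D : E →L[ℝ] E) (Q' D' : N →L[ℝ] N)
    (u : (E × N) × (E × N →L[ℝ] ℝ)) :
    genFst E N (frameChange (Q.prodMap Q') (D.prodMap D') u) = frameChange Q D (genFst E N u) := by
  refine Prod.ext rfl ?_
  ext v
  simp [frameChange, genFst_apply]

lemma genSnd_frameChange (Q D : E →L[ℝ] E) (Q' D' : N →L[ℝ] N)
    (u : (E × N) × (E × N →L[ℝ] ℝ)) :
    genSnd E N (frameChange (Q.prodMap Q') (D.prodMap D') u) =
      frameChange Q' D' (genSnd E N u) := by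
  refine Prod.ext rfl ?_
  ext v
  simp [frameChange, genSnd_apply]

lemma gen_ext {u v : (E × N) × (E × N →L[ℝ] ℝ)} (h₁ : genFst E N u = genFst E N v)
    (h₂ : genSnd E N u = genSnd E N v) : u = v := by
  rw [← genInl_add_genInr u, h₁, h₂, genInl_add_genInr]

lemma frameChange_prodEnd {Q D : E →L[ℝ] E} {Q' D' : N →L[ℝ] N}
    {B B' : E × (E →L[ℝ] ℝ) →L[ℝ] E × (E →L[ℝ] ℝ)}
    {C C' : N × (N →L[ℝ] ℝ) →L[ℝ] N × (N →L[ℝ] ℝ)}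
    (hB : ∀ u, frameChange Q D (B u) = B' (frameChange Q D u))
    (hC : ∀ u, frameChange Q' D' (C u) = C' (frameChange Q' D' u))
    (u : (E × N) × (E × N →L[ℝ] ℝ)) :
    frameChange (Q.prodMap Q') (D.prodMap D') (prodEnd B C u) =
      prodEnd B' C' (frameChange (Q.prodMap Q') (D.prodMap D') u) := by
  refine gen_ext ?_ ?_
  · rw [genFst_frameChange, genFst_prodEnd, genFst_prodEnd, genFst_frameChange, hB]
  · rw [genSnd_frameChange, genSnd_prodEnd, genSnd_prodEnd, genSnd_frameChange, hC]

lemma frameChange_complexEnd {Q D i : N →L[ℝ] N} (hQ : ∀ v, Q (i v) = i (Q v))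
    (hD : ∀ v, D (i v) = i (D v)) (u : N × (N →L[ℝ] ℝ)) :
    frameChange Q D (complexEnd i u) = complexEnd i (frameChange Q D u) := by
  refine Prod.ext ?_ ?_
  · simp [frameChange, complexEnd_apply, hQ]
  · ext v
    simp [frameChange, complexEnd_apply, hD]

/-- The construction is natural: transporting `g`, `S`, `T` by a linear isomorphism transports the
block matrix. Only the block with `g⁻¹` needs an argument, supplied by `hinv`. -/
lemma frameChange_biHermitian [FiniteDimensional ℝ E] {Q D : E →L[ℝ] E} (hQD : ∀ v, Q (D v) = v)
    (hDQ : ∀ v, D (Q v) = v) {g g' : E →L[ℝ] E →L[ℝ] ℝ} {S T S' T' : E →L[ℝ] E}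
    (hg : ∀ v, v ≠ 0 → 0 < g v v) (hg' : ∀ v w, g' v w = g (D v) (D w))
    (hS : ∀ v, D (S' v) = S (D v)) (hT : ∀ v, D (T' v) = T (D v)) (u : E × (E →L[ℝ] ℝ)) :
    frameChange Q D (biHermitian g S T u) = biHermitian g' S' T' (frameChange Q D u) := by
  have hpos' : ∀ v, v ≠ 0 → 0 < g' v v := fun v hv => by
    rw [hg']
    refine hg _ fun h => hv ?_
    rw [← hQD v, h, map_zero]
  obtain ⟨e, he⟩ := exists_metricEquiv hg
  obtain ⟨e', he'⟩ := exists_metricEquiv hpos'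
  have hS' : ∀ v, S' v = Q (S (D v)) := fun v => by rw [← hS, hQD]
  have hT' : ∀ v, T' v = Q (T (D v)) := fun v => by rw [← hT, hQD]
  have hinv : g'.inverse (u.2.comp D) = Q (g.inverse u.2) := by
    rw [← inverse_metric_apply he' (Q (g.inverse u.2))]
    congr 1
    ext w
    rw [hg', hDQ, metric_inverse_apply he]
    rfl
  simp only [biHermitian_apply, frameChange, hinv]
  refine Prod.ext ?_ ?_
  · simp only [hS', hT', hDQ, map_smul, map_add, map_sub, map_neg]
  · ext w
    simp [hg', hDQ, hS', hT']

/-- If `A² = -1`, then `ω_A = g ∘ A` has inverse `-A ∘ g⁻¹`, so the inverses of the two-forms can be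
traded for that of the metric, which does not involve the parameters. -/
lemma genOfBiHermitian_eq [FiniteDimensional ℝ E] {g : E →L[ℝ] E →L[ℝ] ℝ} {S T : E →L[ℝ] E}
    (hg : ∀ v, v ≠ 0 → 0 < g v v) (hS : ∀ v, S (S v) = -v) (hT : ∀ v, T (T v) = -v)
    (u : E × (E →L[ℝ] ℝ)) :
    genOfBiHermitian S T (g.comp S) (g.comp T) u = biHermitian g S T u := by
  obtain ⟨e, he⟩ := exists_metricEquiv hg
  have hinv : ∀ {A : E →L[ℝ] E}, (∀ v, A (A v) = -v) →
      (g.comp A).inverse = -(A.comp g.inverse) := by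
    intro A hA
    refine ContinuousLinearMap.inverse_eq ?_ ?_
    · ext ξ v
      simp [hA, metric_inverse_apply he]
    · ext v
      simp [hA, inverse_metric_apply he]
  rw [biHermitian_apply]
  change ((1 / 2 : ℝ) • (-(S u.1 + T u.1) - ((g.comp S).inverse u.2 - (g.comp T).inverse u.2)),
      (1 / 2 : ℝ) • ((g.comp S u.1 - g.comp T u.1) + (u.2.comp S + u.2.comp T))) = _
  rw [hinv hS, hinv hT]
  refine Prod.ext ?_ ?_
  · simp only [neg_apply, ContinuousLinearMap.comp_apply]
    module
  · ext v
    simp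

lemma genProd_eq {V W : Type*} [NormedAddCommGroup V] [NormedSpace ℝ V]
    [NormedAddCommGroup W] [NormedSpace ℝ W]
    {J₁ : (V × (V →L[ℝ] ℝ)) →ₗ[ℝ] (V × (V →L[ℝ] ℝ))}
    {J₂ : (W × (W →L[ℝ] ℝ)) →ₗ[ℝ] (W × (W →L[ℝ] ℝ))}
    {B : V × (V →L[ℝ] ℝ) →L[ℝ] V × (V →L[ℝ] ℝ)} {C : W × (W →L[ℝ] ℝ) →L[ℝ] W × (W →L[ℝ] ℝ)}
    (hB : ∀ u, J₁ u = B u) (hC : ∀ u, J₂ u = C u) (u : (V × W) × (V × W →L[ℝ] ℝ)) :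
    genProd J₁ J₂ u = prodEnd B C u := by
  change (((J₁ (genFst V W u)).1, (J₂ (genSnd V W u)).1),
    (J₁ (genFst V W u)).2.coprod (J₂ (genSnd V W u)).2) = _
  rw [hB, hC, prodEnd_apply]
  refine Prod.ext ?_ ?_
  · simp [genInl_apply, genInr_apply]
  · ext v <;> simp [genInl_apply, genInr_apply]

end ChangeOfFrame

/-! ### Coordinate changes of a product manifold -/

section ProductChart

variable {E E' : Type*} [NormedAddCommGroup E] [NormedSpace ℝ E]
  [NormedAddCommGroup E'] [NormedSpace ℝ E']
  {H H' : Type*} [TopologicalSpace H] [TopologicalSpace H']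
  {I : ModelWithCorners ℝ E H} {I' : ModelWithCorners ℝ E' H'} [I.Boundaryless] [I'.Boundaryless]
  {M M' : Type*} [TopologicalSpace M] [ChartedSpace H M] [TopologicalSpace M'] [ChartedSpace H' M']
  [IsManifold I ∞ M] [IsManifold I' ∞ M']

theorem tangentCoordChange_prod {x y z : M × M'}
    (h₁ : z.1 ∈ (extChartAt I x.1).source ∩ (extChartAt I y.1).source)
    (h₂ : z.2 ∈ (extChartAt I' x.2).source ∩ (extChartAt I' y.2).source) :
    tangentCoordChange (I.prod I') x y z =
      (tangentCoordChange I x.1 y.1 z.1).prodMap (tangentCoordChange I' x.2 y.2 z.2) := by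
  have hz : z ∈ (extChartAt (I.prod I') x).source ∩ (extChartAt (I.prod I') y).source := by
    rw [extChartAt_prod, extChartAt_prod]
    exact ⟨⟨h₁.1, h₂.1⟩, ⟨h₁.2, h₂.2⟩⟩
  have d := hasFDerivWithinAt_tangentCoordChange hz
  have d₁ := hasFDerivWithinAt_tangentCoordChange h₁
  have d₂ := hasFDerivWithinAt_tangentCoordChange h₂
  rw [ModelWithCorners.range_eq_univ, hasFDerivWithinAt_univ] at d d₁ d₂
  refine d.unique ?_
  have d₃ := HasFDerivAt.prodMap (p := (extChartAt I x.1 z.1, extChartAt I' x.2 z.2)) d₁ d₂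
  rw [extChartAt_prod, extChartAt_prod]
  exact d₃

end ProductChart

/-! ### The complex structure of the parameter space -/

section TwistorAlgebra

set_option maxSynthPendingDepth 3

/-- Multiplication by `i` on `ℂ × ℂ`. -/
def mulI : ℂ × ℂ →L[ℝ] ℂ × ℂ :=
  (Complex.I • ContinuousLinearMap.id ℝ ℂ : ℂ →L[ℝ] ℂ).prodMap
    (Complex.I • ContinuousLinearMap.id ℝ ℂ : ℂ →L[ℝ] ℂ)

lemma mulI_apply (v : ℂ × ℂ) : mulI v = (Complex.I * v.1, Complex.I * v.2) := rfl

lemma mulI_sq (v : ℂ × ℂ) : mulI (mulI v) = -v := by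
  simp only [mulI_apply, ← mul_assoc, Complex.I_mul_I, neg_one_mul]
  rfl

lemma genProd_genOfComplex (u : (ℂ × ℂ) × (ℂ × ℂ →L[ℝ] ℝ)) :
    genProd (genOfComplex (Complex.I • ContinuousLinearMap.id ℝ ℂ : ℂ →L[ℝ] ℂ))
      (genOfComplex (Complex.I • ContinuousLinearMap.id ℝ ℂ : ℂ →L[ℝ] ℂ)) u =
      complexEnd mulI u := by
  refine Prod.ext ?_ ?_
  · simp [genProd, genOfComplex, complexEnd_apply, mulI_apply]
  · ext v <;> simp [genProd, genOfComplex, complexEnd_apply, mulI]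

end TwistorAlgebra

/-! ### The twistor structure at a point -/

section Pointwise

set_option maxSynthPendingDepth 3

variable {E : Type*} [NormedAddCommGroup E] [NormedSpace ℝ E]
  {M : Type*} [TopologicalSpace M] [ChartedSpace E M] [IsManifold 𝓘(ℝ, E) ∞ M]
  {g : RiemannianMetric E M}
  {I J K : Π x : M, TangentSpace 𝓘(ℝ, E) x →L[ℝ] TangentSpace 𝓘(ℝ, E) x}

lemma IsHyperkahler.quatRel (h : IsHyperkahler g I J K) (x : M) :
    QuatRel (E := E) (I x) (J x) (K x) where
  II v := h.kahler_I.sq x v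
  JJ v := h.kahler_J.sq x v
  KK v := h.kahler_K.sq x v
  IJ v := DFunLike.congr_fun (h.IJ x) v
  JI v := DFunLike.congr_fun (h.JI x) v
  JK v := DFunLike.congr_fun (h.JK x) v
  KJ v := DFunLike.congr_fun (h.KJ x) v
  KI v := DFunLike.congr_fun (h.KI x) v
  IK v := DFunLike.congr_fun (h.IK x) v

lemma IsHyperkahler.quatRel_chart (h : IsHyperkahler g I J K) {x₀ : M} {y : E}
    (hy : y ∈ (extChartAt 𝓘(ℝ, E) x₀).target) :
    QuatRel (endInChart I x₀ y) (endInChart J x₀ y) (endInChart K x₀ y) := by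
  have hq := h.quatRel ((extChartAt 𝓘(ℝ, E) x₀).symm y)
  have hp := (extChartAt 𝓘(ℝ, E) x₀).map_target hy
  have key : ∀ {A B : Π x : M, TangentSpace 𝓘(ℝ, E) x →L[ℝ] TangentSpace 𝓘(ℝ, E) x} {z v : E},
      (A ((extChartAt 𝓘(ℝ, E) x₀).symm y) : E →L[ℝ] E)
        ((B ((extChartAt 𝓘(ℝ, E) x₀).symm y) : E →L[ℝ] E)
          (tangentCoordChange 𝓘(ℝ, E) x₀ ((extChartAt 𝓘(ℝ, E) x₀).symm y)
            ((extChartAt 𝓘(ℝ, E) x₀).symm y) v)) =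
        tangentCoordChange 𝓘(ℝ, E) x₀ ((extChartAt 𝓘(ℝ, E) x₀).symm y)
            ((extChartAt 𝓘(ℝ, E) x₀).symm y) z →
      endInChart A x₀ y (endInChart B x₀ y v) = z := by
    intro A B z v hz
    rw [← tangentCoordChange_left_inv_apply hp z, ← hz, ← tangentCoordChange_endInChart B hy,
      ← tangentCoordChange_endInChart A hy, tangentCoordChange_left_inv_apply hp]
  exact
  { II := fun v => key (by rw [hq.II, map_neg])
    JJ := fun v => key (by rw [hq.JJ, map_neg])
    KK := fun v => key (by rw [hq.KK, map_neg])
    IJ := fun v => key (by rw [hq.IJ, tangentCoordChange_endInChart K hy])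
    JI := fun v => key (by rw [hq.JI, map_neg, tangentCoordChange_endInChart K hy])
    JK := fun v => key (by rw [hq.JK, tangentCoordChange_endInChart I hy])
    KJ := fun v => key (by rw [hq.KJ, map_neg, tangentCoordChange_endInChart I hy])
    KI := fun v => key (by rw [hq.KI, tangentCoordChange_endInChart J hy])
    IK := fun v => key (by rw [hq.IK, map_neg, tangentCoordChange_endInChart J hy]) }

lemma skew_of_orthogonal {g : E →L[ℝ] E →L[ℝ] ℝ} {A : E →L[ℝ] E} (hA : ∀ v, A (A v) = -v)
    (ho : ∀ v w, g (A v) (A w) = g v w) (v w : E) : g (A v) w = -g v (A w) := by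
  rw [← ho v (A w), hA, map_neg, neg_neg]

lemma IsKahler.skew {A : Π x : M, TangentSpace 𝓘(ℝ, E) x →L[ℝ] TangentSpace 𝓘(ℝ, E) x}
    (h : IsKahler g A) (x : M) (v w : E) :
    (g.inner x : E →L[ℝ] E →L[ℝ] ℝ) ((A x : E →L[ℝ] E) v) w =
      -(g.inner x : E →L[ℝ] E →L[ℝ] ℝ) v ((A x : E →L[ℝ] E) w) :=
  skew_of_orthogonal (E := E) (h.sq x) (h.orthogonal x) v w

lemma IsKahler.skew_chart {A : Π x : M, TangentSpace 𝓘(ℝ, E) x →L[ℝ] TangentSpace 𝓘(ℝ, E) x}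
    (h : IsKahler g A) {x₀ : M} {y : E} (hy : y ∈ (extChartAt 𝓘(ℝ, E) x₀).target) (v w : E) :
    metricInChart g x₀ y (endInChart A x₀ y v) w = -metricInChart g x₀ y v (endInChart A x₀ y w) :=
  skew_of_orthogonal (h.endInChart_sq hy) (h.metricInChart_orthogonal hy) v w

lemma spherePoint_unit (η : CP1) :
    (spherePoint η).1 ^ 2 + (spherePoint η).2.1 ^ 2 + (spherePoint η).2.2 ^ 2 = 1 := by
  have h := ((spherePoint_chart η).2 (extChartAt 𝓘(ℝ, ℂ) η η)).unit
  rwa [extChartAt_to_inv] at h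

/-- The value at a point of the structure on the twistor space attached to the complex structures
`s` and `t`. -/
def twistorEnd (g : E →L[ℝ] E →L[ℝ] ℝ) (I J K : E →L[ℝ] E) (s t : ℝ × ℝ × ℝ) :
    (E × ℂ × ℂ) × (E × ℂ × ℂ →L[ℝ] ℝ) →L[ℝ] (E × ℂ × ℂ) × (E × ℂ × ℂ →L[ℝ] ℝ) :=
  prodEnd (biHermitian g (quatL I J K s) (quatL I J K t)) (complexEnd mulI)

lemma twistorEnd_sq [FiniteDimensional ℝ E] {g : E →L[ℝ] E →L[ℝ] ℝ} {I J K : E →L[ℝ] E}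
    (hpos : ∀ v, v ≠ 0 → 0 < g v v) (hI : ∀ v w, g (I v) w = -g v (I w))
    (hJ : ∀ v w, g (J v) w = -g v (J w)) (hK : ∀ v w, g (K v) w = -g v (K w))
    (hq : QuatRel I J K) {s t : ℝ × ℝ × ℝ} (hs : s.1 ^ 2 + s.2.1 ^ 2 + s.2.2 ^ 2 = 1)
    (ht : t.1 ^ 2 + t.2.1 ^ 2 + t.2.2 ^ 2 = 1) (u : (E × ℂ × ℂ) × (E × ℂ × ℂ →L[ℝ] ℝ)) :
    twistorEnd g I J K s t (twistorEnd g I J K s t u) = -u := by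
  obtain ⟨e, he⟩ := exists_metricEquiv hpos
  refine gen_ext ?_ ?_
  · rw [twistorEnd, genFst_prodEnd, genFst_prodEnd, biHermitian_sq he (quatL_skew hI hJ hK s)
      (quatL_skew hI hJ hK t) (quatL_sq hq hs) (quatL_sq hq ht), map_neg]
  · rw [twistorEnd, genSnd_prodEnd, genSnd_prodEnd, complexEnd_sq mulI_sq, map_neg]

lemma twistorEnd_skew [FiniteDimensional ℝ E] {g : E →L[ℝ] E →L[ℝ] ℝ} {I J K : E →L[ℝ] E}
    (hpos : ∀ v, v ≠ 0 → 0 < g v v) (hsymm : ∀ v w, g v w = g w v)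
    (hI : ∀ v w, g (I v) w = -g v (I w))
    (hJ : ∀ v w, g (J v) w = -g v (J w)) (hK : ∀ v w, g (K v) w = -g v (K w))
    (s t : ℝ × ℝ × ℝ) (u v : (E × ℂ × ℂ) × (E × ℂ × ℂ →L[ℝ] ℝ)) :
    pairL v (twistorEnd g I J K s t u) = -pairL (twistorEnd g I J K s t v) u := by
  obtain ⟨e, he⟩ := exists_metricEquiv hpos
  rw [twistorEnd, pairL_eq_add, pairL_eq_add (prodEnd _ _ v), genFst_prodEnd, genSnd_prodEnd,
    genFst_prodEnd, genSnd_prodEnd, biHermitian_skew he hsymm (quatL_skew hI hJ hK s)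
      (quatL_skew hI hJ hK t), complexEnd_skew]
  ring

/-- A skew endomorphism with square `-1` is orthogonal. -/
lemma twistorEnd_orthogonal [FiniteDimensional ℝ E] {g : E →L[ℝ] E →L[ℝ] ℝ} {I J K : E →L[ℝ] E}
    (hpos : ∀ v, v ≠ 0 → 0 < g v v) (hsymm : ∀ v w, g v w = g w v)
    (hI : ∀ v w, g (I v) w = -g v (I w))
    (hJ : ∀ v w, g (J v) w = -g v (J w)) (hK : ∀ v w, g (K v) w = -g v (K w))
    (hq : QuatRel I J K) {s t : ℝ × ℝ × ℝ} (hs : s.1 ^ 2 + s.2.1 ^ 2 + s.2.2 ^ 2 = 1)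
    (ht : t.1 ^ 2 + t.2.1 ^ 2 + t.2.2 ^ 2 = 1) (u v : (E × ℂ × ℂ) × (E × ℂ × ℂ →L[ℝ] ℝ)) :
    pairL (twistorEnd g I J K s t v) (twistorEnd g I J K s t u) = pairL v u := by
  rw [twistorEnd_skew hpos hsymm hI hJ hK, twistorEnd_sq hpos hI hJ hK hq hs ht]
  simp only [pairL_apply, Prod.fst_neg, Prod.snd_neg, map_neg, neg_apply]
  ring

omit [IsManifold 𝓘(ℝ, E) ∞ M] in
lemma twistorFamily_eq (η : CP1) (x : M) :
    twistorFamily I J K η x = quatL (E := E) (I x) (J x) (K x) (spherePoint η) := by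
  refine ContinuousLinearMap.ext fun v => ?_
  exact (quatL_apply (E := E) (I x) (J x) (K x) (spherePoint η) v).symm

/-- The maps `a`, `b` will be the two projections in either order, so one argument covers both
`𝒥_{α,β}` and `𝒥_{β,α}`. -/
lemma twistorStructure_eq [FiniteDimensional ℝ E] (h : IsHyperkahler g I J K)
    {a b : CP1 × CP1 → CP1} (p : M × CP1 × CP1)
    (u : (E × ℂ × ℂ) × (E × ℂ × ℂ →L[ℝ] ℝ)) :
    twistorStructure (fun α β => genFamily g I J K (a (α, β)) (b (α, β))) p u =
      twistorEnd (E := E) (g.inner p.1) (I p.1) (J p.1) (K p.1) (spherePoint (a p.2))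
        (spherePoint (b p.2)) u := by
  refine genProd_eq (V := E) (W := ℂ × ℂ) (fun u => ?_) genProd_genOfComplex u
  have hq := h.quatRel p.1
  have := genOfBiHermitian_eq (E := E) (g := g.inner p.1)
    (S := quatL (E := E) (I p.1) (J p.1) (K p.1) (spherePoint (a p.2)))
    (T := quatL (E := E) (I p.1) (J p.1) (K p.1) (spherePoint (b p.2))) (g.pos p.1)
    (quatL_sq hq (spherePoint_unit _)) (quatL_sq hq (spherePoint_unit _)) u
  rw [← this]
  exact congrArg₂ (fun S T : E →L[ℝ] E => genOfBiHermitian (V := E) S T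
    (ContinuousLinearMap.comp (g.inner p.1 : E →L[ℝ] E →L[ℝ] ℝ) S)
    (ContinuousLinearMap.comp (g.inner p.1 : E →L[ℝ] E →L[ℝ] ℝ) T) u)
    (twistorFamily_eq (a p.2) p.1) (twistorFamily_eq (b p.2) p.1)

end Pointwise

/-! ### The twistor structure in a chart -/

section TwistorChart

set_option maxSynthPendingDepth 3

variable {E : Type*} [NormedAddCommGroup E] [NormedSpace ℝ E]
  {M : Type*} [TopologicalSpace M] [ChartedSpace E M] [IsManifold 𝓘(ℝ, E) ∞ M]
  {g : RiemannianMetric E M}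
  {I J K : Π x : M, TangentSpace 𝓘(ℝ, E) x →L[ℝ] TangentSpace 𝓘(ℝ, E) x}

/-- A projection of `ℂℙ¹ × ℂℙ¹` to `ℂℙ¹` together with its expression in the charts. -/
structure IsChartProj (a : CP1 × CP1 → CP1) (pa : ℂ × ℂ →L[ℝ] ℂ) : Prop where
  symm_apply : ∀ (p : CP1 × CP1) (z : ℂ × ℂ),
    a ((extChartAt (𝓘(ℝ, ℂ).prod 𝓘(ℝ, ℂ)) p).symm z) = (extChartAt 𝓘(ℝ, ℂ) (a p)).symm (pa z)
  mulI : ∀ z, pa (mulI z) = Complex.I * pa z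

lemma isChartProj_fst : IsChartProj Prod.fst (ContinuousLinearMap.fst ℝ ℂ ℂ) where
  symm_apply p z := by rw [extChartAt_prod]; rfl
  mulI _ := rfl

lemma isChartProj_snd : IsChartProj Prod.snd (ContinuousLinearMap.snd ℝ ℂ ℂ) where
  symm_apply p z := by rw [extChartAt_prod]; rfl
  mulI _ := rfl

/-- The map `spherePoint` read in the preferred chart at `q`. -/
def sphereInChart (q : CP1) (z : ℂ) : ℝ × ℝ × ℝ := spherePoint ((extChartAt 𝓘(ℝ, ℂ) q).symm z)

variable (g I J K) in
/-- The structure on the twistor space read in the preferred chart. -/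
def twistorInChart (m : M) (α β : CP1) (pa pb : ℂ × ℂ →L[ℝ] ℂ) (y : E × ℂ × ℂ) :
    (E × ℂ × ℂ) × (E × ℂ × ℂ →L[ℝ] ℝ) →L[ℝ] (E × ℂ × ℂ) × (E × ℂ × ℂ →L[ℝ] ℝ) :=
  twistorEnd (metricInChart g m y.1) (endInChart I m y.1) (endInChart J m y.1)
    (endInChart K m y.1) (sphereInChart α (pa y.2)) (sphereInChart β (pb y.2))

lemma tangentCoordChange_quatL {x₀ : M} {y : E} (hy : y ∈ (extChartAt 𝓘(ℝ, E) x₀).target)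
    (s : ℝ × ℝ × ℝ) (v : E) :
    tangentCoordChange 𝓘(ℝ, E) x₀ ((extChartAt 𝓘(ℝ, E) x₀).symm y)
        ((extChartAt 𝓘(ℝ, E) x₀).symm y)
        (quatL (endInChart I x₀ y) (endInChart J x₀ y) (endInChart K x₀ y) s v) =
      quatL (E := E) (I ((extChartAt 𝓘(ℝ, E) x₀).symm y)) (J ((extChartAt 𝓘(ℝ, E) x₀).symm y))
        (K ((extChartAt 𝓘(ℝ, E) x₀).symm y)) s
        (tangentCoordChange 𝓘(ℝ, E) x₀ ((extChartAt 𝓘(ℝ, E) x₀).symm y)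
        ((extChartAt 𝓘(ℝ, E) x₀).symm y) v) := by
  refine Eq.trans ?_ (quatL_apply (E := E) _ _ _ s _).symm
  rw [quatL_apply, map_add, map_add, map_smul, map_smul, map_smul,
    tangentCoordChange_endInChart I hy, tangentCoordChange_endInChart J hy,
    tangentCoordChange_endInChart K hy]
  rfl

lemma tangentCoordChange_cp1_prod_comm {p q r : CP1 × CP1}
    (hp : r ∈ (extChartAt (𝓘(ℝ, ℂ).prod 𝓘(ℝ, ℂ)) p).source)
    (hq : r ∈ (extChartAt (𝓘(ℝ, ℂ).prod 𝓘(ℝ, ℂ)) q).source) (v : ℂ × ℂ) :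
    tangentCoordChange (𝓘(ℝ, ℂ).prod 𝓘(ℝ, ℂ)) p q r (mulI v) =
      mulI (tangentCoordChange (𝓘(ℝ, ℂ).prod 𝓘(ℝ, ℂ)) p q r v) := by
  rw [extChartAt_prod] at hp hq
  rw [tangentCoordChange_prod ⟨hp.1, hq.1⟩ ⟨hp.2, hq.2⟩]
  exact Prod.ext (tangentCoordChange_cp1_comm hp.1 hq.1 _)
    (tangentCoordChange_cp1_comm hp.2 hq.2 _)

/-- Passing to the chart is a block-diagonal change of frame. On `M` it carries `g`, `I`, `J`, `K`
to their chart expressions; on `ℂℙ¹ × ℂℙ¹` it commutes with `i`, because transition maps are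
holomorphic, so that factor stays constant. -/
theorem representedBy_twistorInChart [FiniteDimensional ℝ E] (h : IsHyperkahler g I J K)
    {a b : CP1 × CP1 → CP1} {pa pb : ℂ × ℂ →L[ℝ] ℂ} (ha : IsChartProj a pa) (hb : IsChartProj b pb)
    (x : M × CP1 × CP1) :
    RepresentedBy (twistorModel E)
      (twistorStructure (fun α β => genFamily g I J K (a (α, β)) (b (α, β)))) x
      (twistorInChart g I J K x.1 (a x.2) (b x.2) pa pb) := by
  filter_upwards [extChartAt_target_mem_nhds (I := twistorModel E) x] with y hy
  rw [extChartAt_prod] at hy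
  have hs : (extChartAt (twistorModel E) x).symm y = ((extChartAt 𝓘(ℝ, E) x.1).symm y.1,
      (extChartAt (𝓘(ℝ, ℂ).prod 𝓘(ℝ, ℂ)) x.2).symm y.2) := by
    rw [extChartAt_prod]; rfl
  have hy₁ : y.1 ∈ (extChartAt 𝓘(ℝ, E) x.1).target := hy.1
  have hy₂ : y.2 ∈ (extChartAt (𝓘(ℝ, ℂ).prod 𝓘(ℝ, ℂ)) x.2).target := hy.2
  rw [hs]
  have hm := (extChartAt 𝓘(ℝ, E) x.1).map_target hy₁
  have hr := (extChartAt (𝓘(ℝ, ℂ).prod 𝓘(ℝ, ℂ)) x.2).map_target hy₂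
  set m := (extChartAt 𝓘(ℝ, E) x.1).symm y.1 with hm'
  set r := (extChartAt (𝓘(ℝ, ℂ).prod 𝓘(ℝ, ℂ)) x.2).symm y.2 with hr'
  intro u
  have hmm := mem_extChartAt_source (I := 𝓘(ℝ, E)) m
  have hrr := mem_extChartAt_source (I := 𝓘(ℝ, ℂ).prod 𝓘(ℝ, ℂ)) r
  have hc : ∀ w : (E × ℂ × ℂ) × (E × ℂ × ℂ →L[ℝ] ℝ), genToChart (twistorModel E) x (m, r) w =
      frameChange ((tangentCoordChange 𝓘(ℝ, E) m x.1 m).prodMap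
        (tangentCoordChange (𝓘(ℝ, ℂ).prod 𝓘(ℝ, ℂ)) r x.2 r))
        ((tangentCoordChange 𝓘(ℝ, E) x.1 m m).prodMap
        (tangentCoordChange (𝓘(ℝ, ℂ).prod 𝓘(ℝ, ℂ)) x.2 r r)) w := fun w => by
    rw [← tangentCoordChange_prod (x := (m, r)) (y := x) (z := (m, r)) ⟨hmm, hm⟩ ⟨hrr, hr⟩,
      ← tangentCoordChange_prod (x := x) (y := (m, r)) (z := (m, r)) ⟨hm, hmm⟩ ⟨hr, hrr⟩]
    rfl
  refine (congrArg (genToChart (twistorModel E) x (m, r))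
    (twistorStructure_eq (a := a) (b := b) h (m, r) u)).trans ?_
  refine (hc _).trans (Eq.trans ?_ (congrArg _ (hc u).symm))
  have hα : sphereInChart (a x.2) (pa y.2) = spherePoint (a r) := by
    rw [sphereInChart, ← ha.symm_apply]
  have hβ : sphereInChart (b x.2) (pb y.2) = spherePoint (b r) := by
    rw [sphereInChart, ← hb.symm_apply]
  rw [twistorInChart, hα, hβ]
  exact frameChange_prodEnd
    (frameChange_biHermitian (tangentCoordChange_left_inv_apply hm)
      (tangentCoordChange_right_inv_apply hm) (g.pos m) (metricInChart_apply g x.1 y.1)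
      (tangentCoordChange_quatL hy₁ _) (tangentCoordChange_quatL hy₁ _))
    (frameChange_complexEnd (tangentCoordChange_cp1_prod_comm hrr hr)
      (tangentCoordChange_cp1_prod_comm hr hrr)) u

lemma contDiff_sphereInChart (q : CP1) : ContDiff ℝ ∞ (sphereInChart q) := (spherePoint_chart q).1

lemma contDiffAt_quatL {W : Type*} [NormedAddCommGroup W] [NormedSpace ℝ W] {n : WithTop ℕ∞}
    {I J K : W → E →L[ℝ] E} {s : W → ℝ × ℝ × ℝ} {y : W} (hI : ContDiffAt ℝ n I y)
    (hJ : ContDiffAt ℝ n J y) (hK : ContDiffAt ℝ n K y) (hs : ContDiffAt ℝ n s y) :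
    ContDiffAt ℝ n (fun y => quatL (I y) (J y) (K y) (s y)) y := by
  have h := ((hs.fst.smul hI).add (hs.snd.fst.smul hJ)).add (hs.snd.snd.smul hK)
  refine h.congr_of_eventuallyEq (Filter.Eventually.of_forall fun z => ?_)
  ext v
  simp [quatL_apply]

lemma hasFDerivAt_quatL {W : Type*} [NormedAddCommGroup W] [NormedSpace ℝ W]
    {I J K : W → E →L[ℝ] E} {s : W → ℝ × ℝ × ℝ} {y : W} {I' J' K' : W →L[ℝ] E →L[ℝ] E}
    {s' : W →L[ℝ] ℝ × ℝ × ℝ} (hI : HasFDerivAt I I' y) (hJ : HasFDerivAt J J' y)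
    (hK : HasFDerivAt K K' y) (hs : HasFDerivAt s s' y) :
    ∃ Q' : W →L[ℝ] E →L[ℝ] E, HasFDerivAt (fun y => quatL (I y) (J y) (K y) (s y)) Q' y ∧
      ∀ w, Q' w = quatL (I' w) (J' w) (K' w) (s y) + quatL (I y) (J y) (K y) (s' w) := by
  have h := ((hs.fst.smul hI).add (hs.snd.fst.smul hJ)).add (hs.snd.snd.smul hK)
  refine ⟨_, h.congr_of_eventuallyEq (Filter.Eventually.of_forall fun z => ?_), fun w => ?_⟩
  · ext v
    simp [quatL_apply]
  · ext v
    simp [quatL_apply]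
    abel

end TwistorChart

/-! ### Integrability of the 1-jet of the twistor structure -/

section TwistorJet

set_option maxSynthPendingDepth 3

variable {E : Type*} [NormedAddCommGroup E] [NormedSpace ℝ E] [FiniteDimensional ℝ E]

section
variable {G : E → E →L[ℝ] E →L[ℝ] ℝ} {I J K : E → E →L[ℝ] E} {r s : ℂ → ℝ × ℝ × ℝ}
  {pa pb : ℂ × ℂ →L[ℝ] ℂ} {y : E × ℂ × ℂ}

lemma contDiffAt_biHermitian_quatL {n : WithTop ℕ∞} (hpos : ∀ v, v ≠ 0 → 0 < G y.1 v v)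
    (hG : ContDiffAt ℝ n G y.1) (hI : ContDiffAt ℝ n I y.1) (hJ : ContDiffAt ℝ n J y.1)
    (hK : ContDiffAt ℝ n K y.1) (hr : ContDiff ℝ n r) (hs : ContDiff ℝ n s) :
    ContDiffAt ℝ n (fun y : E × ℂ × ℂ => biHermitian (G y.1)
      (quatL (I y.1) (J y.1) (K y.1) (r (pa y.2)))
      (quatL (I y.1) (J y.1) (K y.1) (s (pb y.2)))) y := by
  obtain ⟨e, he⟩ := exists_metricEquiv hpos
  have hr' : ContDiffAt ℝ n (fun y : E × ℂ × ℂ => r (pa y.2)) y :=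
    (hr.comp (pa.contDiff.comp contDiff_snd)).contDiffAt
  have hs' : ContDiffAt ℝ n (fun y : E × ℂ × ℂ => s (pb y.2)) y :=
    (hs.comp (pb.contDiff.comp contDiff_snd)).contDiffAt
  have hI' := hI.comp y contDiffAt_fst
  have hJ' := hJ.comp y contDiffAt_fst
  have hK' := hK.comp y contDiffAt_fst
  exact contDiffAt_biHermitian he (hG.comp y contDiffAt_fst)
    (contDiffAt_quatL hI' hJ' hK' hr') (contDiffAt_quatL hI' hJ' hK' hs')

lemma contDiffAt_twistorEnd {n : WithTop ℕ∞} (hpos : ∀ v, v ≠ 0 → 0 < G y.1 v v)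
    (hG : ContDiffAt ℝ n G y.1) (hI : ContDiffAt ℝ n I y.1) (hJ : ContDiffAt ℝ n J y.1)
    (hK : ContDiffAt ℝ n K y.1) (hr : ContDiff ℝ n r) (hs : ContDiff ℝ n s) :
    ContDiffAt ℝ n (fun y : E × ℂ × ℂ =>
      twistorEnd (G y.1) (I y.1) (J y.1) (K y.1) (r (pa y.2)) (s (pb y.2))) y := by
  have h := contDiffAt_biHermitian_quatL (pa := pa) (pb := pb) hpos hG hI hJ hK hr hs
  have h2 := (prodEndL (E := E) (N := ℂ × ℂ)).contDiff.contDiffAt.comp y h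
  exact h2.add contDiffAt_const

-- With `I`, `J`, `K` parallel, the covariant derivative of `a I + b J + c K` differentiates only
-- the coefficients; `t` stands for the derivative of the coefficient vector `s`.
omit [FiniteDimensional ℝ E] in
lemma quatL_covariant {I' J' K' : E →L[ℝ] E →L[ℝ] E} {I J K : E →L[ℝ] E} {Γ : E →L[ℝ] E →L[ℝ] E}
    (hI : ∀ u v, I' u v + Γ u (I v) - I (Γ u v) = 0)
    (hJ : ∀ u v, J' u v + Γ u (J v) - J (Γ u v) = 0)
    (hK : ∀ u v, K' u v + Γ u (K v) - K (Γ u v) = 0) (s t : ℝ × ℝ × ℝ) (u v : E) :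
    (quatL (I' u) (J' u) (K' u) s + quatL I J K t) v + Γ u (quatL I J K s v) -
      quatL I J K s (Γ u v) = quatL I J K t v := by
  have h : ∀ {a b c : E}, a + b - c = 0 → a = c - b := fun h => by
    rw [← sub_eq_zero, ← h]; abel
  simp only [add_apply, quatL_apply, map_add, map_smul, h (hI u v), h (hJ u v), h (hK u v)]
  module

/-- The Nijenhuis tensor vanishes when the metric and the complex structures are parallel and the
sphere is parametrized holomorphically. -/
theorem exists_jetIntegrable_twistorEnd (hpos : ∀ᶠ z in 𝓝 y.1, ∀ v, v ≠ 0 → 0 < G z v v)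
    (hsymm : ∀ v w, G y.1 v w = G y.1 w v)
    {G' : E →L[ℝ] E →L[ℝ] E →L[ℝ] ℝ} {I' J' K' : E →L[ℝ] E →L[ℝ] E}
    (hG : HasFDerivAt G G' y.1) (hI : HasFDerivAt I I' y.1) (hJ : HasFDerivAt J J' y.1)
    (hK : HasFDerivAt K K' y.1)
    (hd : DifferentiableAt ℝ (fun y : E × ℂ × ℂ => biHermitian (G y.1)
      (quatL (I y.1) (J y.1) (K y.1) (r (pa y.2)))
      (quatL (I y.1) (J y.1) (K y.1) (s (pb y.2)))) y)
    (hIs : ∀ v w, G y.1 (I y.1 v) w = -G y.1 v (I y.1 w))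
    (hJs : ∀ v w, G y.1 (J y.1 v) w = -G y.1 v (J y.1 w))
    (hKs : ∀ v w, G y.1 (K y.1 v) w = -G y.1 v (K y.1 w))
    (hq : QuatRel (I y.1) (J y.1) (K y.1)) {Γ : E →L[ℝ] E →L[ℝ] E}
    (hΓ : ∀ v w, Γ v w = Γ w v) (hΓG : ∀ u v w, G' u v w = G y.1 (Γ u v) w + G y.1 v (Γ u w))
    (hΓI : ∀ u v, I' u v + Γ u (I y.1 v) - I y.1 (Γ u v) = 0)
    (hΓJ : ∀ u v, J' u v + Γ u (J y.1 v) - J y.1 (Γ u v) = 0)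
    (hΓK : ∀ u v, K' u v + Γ u (K y.1 v) - K y.1 (Γ u v) = 0)
    (hpa : ∀ z, pa (mulI z) = Complex.I * pa z) (hpb : ∀ z, pb (mulI z) = Complex.I * pb z)
    {r' s' : ℂ →L[ℝ] ℝ × ℝ × ℝ} (hr : HasFDerivAt r r' (pa y.2)) (hs : HasFDerivAt s s' (pb y.2))
    (hrj : IsHolomorphicJet (r (pa y.2)) r') (hsj : IsHolomorphicJet (s (pb y.2)) s') :
    ∃ Φ', HasFDerivAt (fun y : E × ℂ × ℂ =>
      twistorEnd (G y.1) (I y.1) (J y.1) (K y.1) (r (pa y.2)) (s (pb y.2))) Φ' y ∧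
      JetIntegrable (twistorEnd (G y.1) (I y.1) (J y.1) (K y.1) (r (pa y.2)) (s (pb y.2))) Φ' := by
  obtain ⟨e, he⟩ := exists_metricEquiv hpos.self_of_nhds
  have hfst : HasFDerivAt (fun y : E × ℂ × ℂ => y.1) (ContinuousLinearMap.fst ℝ E (ℂ × ℂ)) y :=
    hasFDerivAt_fst
  have hsnd : HasFDerivAt (fun y : E × ℂ × ℂ => y.2) (ContinuousLinearMap.snd ℝ E (ℂ × ℂ)) y :=
    hasFDerivAt_snd
  have hr₁ := hr.comp y (pa.hasFDerivAt.comp y hsnd)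
  have hs₁ := hs.comp y (pb.hasFDerivAt.comp y hsnd)
  obtain ⟨S', hS, hS'⟩ := hasFDerivAt_quatL (hI.comp y hfst) (hJ.comp y hfst) (hK.comp y hfst) hr₁
  obtain ⟨T', hT, hT'⟩ := hasFDerivAt_quatL (hI.comp y hfst) (hJ.comp y hfst) (hK.comp y hfst) hs₁
  have hinv : DifferentiableAt ℝ (fun y : E × ℂ × ℂ => (G y.1).inverse) y := by
    have h := contDiffAt_map_inverse (𝕜 := ℝ) (n := 1) e
    rw [he] at h
    exact (h.differentiableAt one_ne_zero).comp y (hG.comp y hfst).differentiableAt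
  -- The `ℂℙ¹ × ℂℙ¹` factor is constant in the chart and does not contribute to the derivative.
  refine ⟨prodEndL.comp (fderiv ℝ _ y),
    ((prodEndL (E := E) (N := ℂ × ℂ)).hasFDerivAt.comp y hd.hasFDerivAt).add_const _, ?_⟩
  refine jetIntegrable_prodEnd he hsymm (quatL_skew hIs hJs hKs _) (quatL_skew hIs hJs hKs _)
    (quatL_sq hq hrj.unit) (quatL_sq hq hsj.unit) mulI_sq hΓ
    -- `σ` and `τ` are the derivatives of the two complex structures along the parameters.
    (σ := (quatL (I y.1) (J y.1) (K y.1)).comp (r'.comp pa))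
    (τ := (quatL (I y.1) (J y.1) (K y.1)).comp (s'.comp pb))
    (fun ν => quatL_skew hIs hJs hKs _) (fun ν => quatL_skew hIs hJs hKs _) ?_ ?_ ?_
  · intro ν v
    simp only [ContinuousLinearMap.comp_apply, hpa]
    exact hrj.quatL_eq hq (pa ν) v
  · intro ν v
    simp only [ContinuousLinearMap.comp_apply, hpb]
    exact hsj.quatL_eq hq (pb ν) v
  · intro w u
    refine fderiv_biHermitian (hfst.continuousAt.eventually hpos) (hG.comp y hfst) hS hT hinv
      hd.hasFDerivAt (Γ := Γ w.1) (hΓG w.1) (fun v => ?_) (fun v => ?_) u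
    · rw [hS']
      exact quatL_covariant hΓI hΓJ hΓK (r (pa y.2)) (r' (pa w.2)) w.1 v
    · rw [hT']
      exact quatL_covariant hΓI hΓJ hΓK (s (pb y.2)) (s' (pb w.2)) w.1 v

end

end TwistorJet

/-! ### Assembly of the theorem -/

section Twistor

set_option maxSynthPendingDepth 3

variable {E : Type*} [NormedAddCommGroup E] [NormedSpace ℝ E] [FiniteDimensional ℝ E]
  {M : Type*} [TopologicalSpace M] [ChartedSpace E M] [IsManifold 𝓘(ℝ, E) ∞ M]
  {g : RiemannianMetric E M}
  {I J K : Π x : M, TangentSpace 𝓘(ℝ, E) x →L[ℝ] TangentSpace 𝓘(ℝ, E) x}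

lemma contDiffAt_twistorInChart (h : IsHyperkahler g I J K) (α β : CP1) (pa pb : ℂ × ℂ →L[ℝ] ℂ)
    (m : M) (z : ℂ × ℂ) :
    ContDiffAt ℝ ∞ (twistorInChart g I J K m α β pa pb) (extChartAt 𝓘(ℝ, E) m m, z) :=
  contDiffAt_twistorEnd (y := (extChartAt 𝓘(ℝ, E) m m, z))
    (metricInChart_pos g (mem_extChartAt_target m)) (contDiffAt_metricInChart g m)
    (contDiffAt_endInChart h.kahler_I.smooth m) (contDiffAt_endInChart h.kahler_J.smooth m)
    (contDiffAt_endInChart h.kahler_K.smooth m) (contDiff_sphereInChart α)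
    (contDiff_sphereInChart β)

theorem exists_jetIntegrable_twistorInChart (h : IsHyperkahler g I J K) (α β : CP1)
    {pa pb : ℂ × ℂ →L[ℝ] ℂ} (hpa : ∀ z, pa (mulI z) = Complex.I * pa z)
    (hpb : ∀ z, pb (mulI z) = Complex.I * pb z) (m : M) (z : ℂ × ℂ) :
    ∃ Φ', HasFDerivAt (twistorInChart g I J K m α β pa pb) Φ' (extChartAt 𝓘(ℝ, E) m m, z) ∧
      JetIntegrable (twistorInChart g I J K m α β pa pb (extChartAt 𝓘(ℝ, E) m m, z)) Φ' := by
  have ht := mem_extChartAt_target (I := 𝓘(ℝ, E)) m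
  have hG := contDiffAt_metricInChart g m
  have hI := contDiffAt_endInChart h.kahler_I.smooth m
  have hJ := contDiffAt_endInChart h.kahler_J.smooth m
  have hK := contDiffAt_endInChart h.kahler_K.smooth m
  have hd : ∀ {F : Type _} [NormedAddCommGroup F] [NormedSpace ℝ F] {f : E → F} {y : E},
      ContDiffAt ℝ ∞ f y → HasFDerivAt f (fderiv ℝ f y) y := fun hf =>
    (hf.differentiableAt (by simp)).hasFDerivAt
  -- The derivative of a symmetric form is symmetric, as the Koszul construction of `Γ` requires.
  -- The same `Γ` then serves `I`, `J` and `K`.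
  have hsymm' : ∀ u v w, fderiv ℝ (metricInChart g m) (extChartAt 𝓘(ℝ, E) m m) u v w =
      fderiv ℝ (metricInChart g m) (extChartAt 𝓘(ℝ, E) m m) u w v := by
    intro u v w
    have h₁ : ∀ v w : E, HasFDerivAt (fun y => metricInChart g m y v w) _ _ := fun v w =>
      ((hd hG).clm_apply (hasFDerivAt_const v _)).clm_apply (hasFDerivAt_const w _)
    have h₂ := h₁ w v
    simp only [metricInChart_symm g m _ w v] at h₂
    have h₃ := congrArg (fun L : E →L[ℝ] ℝ => L u) ((h₁ v w).unique h₂)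
    generalize extChartAt 𝓘(ℝ, E) m m = y₀ at *
    simpa using h₃
  obtain ⟨Γ, hΓ, hΓG⟩ := exists_leviCivita (metricInChart_symm g m _) (metricInChart_pos g ht)
    hsymm'
  have hds : ∀ (q : CP1) (t : ℂ),
      HasFDerivAt (sphereInChart q) (fderiv ℝ (sphereInChart q) t) t := fun q t =>
    ((contDiff_sphereInChart q).differentiable (by simp) t).hasFDerivAt
  refine exists_jetIntegrable_twistorEnd (y := (extChartAt 𝓘(ℝ, E) m m, z)) ?_
    (metricInChart_symm g m _) (hd hG) (hd hI) (hd hJ) (hd hK) ?_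
    (h.kahler_I.skew_chart ht) (h.kahler_J.skew_chart ht) (h.kahler_K.skew_chart ht)
    (h.quatRel_chart ht) hΓ hΓG (h.kahler_I.parallel (hd hI) (hd hG) hΓ hΓG)
    (h.kahler_J.parallel (hd hJ) (hd hG) hΓ hΓG) (h.kahler_K.parallel (hd hK) (hd hG) hΓ hΓG)
    hpa hpb (hds α _) (hds β _) ((spherePoint_chart α).2 _) ((spherePoint_chart β).2 _)
  · filter_upwards [extChartAt_target_mem_nhds (I := 𝓘(ℝ, E)) m] with y hy
    exact metricInChart_pos g hy
  · exact (contDiffAt_biHermitian_quatL (y := (extChartAt 𝓘(ℝ, E) m m, z))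
      (metricInChart_pos g ht) hG hI hJ hK (contDiff_sphereInChart α)
      (contDiff_sphereInChart β)).differentiableAt (by simp)

theorem isGenComplex_twistorStructure (h : IsHyperkahler g I J K)
    {a b : CP1 × CP1 → CP1} {pa pb : ℂ × ℂ →L[ℝ] ℂ} (ha : IsChartProj a pa)
    (hb : IsChartProj b pb) :
    IsGenComplex (twistorModel E)
      (twistorStructure (fun α β => genFamily g I J K (a (α, β)) (b (α, β)))) := by
  have hx : ∀ x : M × CP1 × CP1, extChartAt (twistorModel E) x x = (extChartAt 𝓘(ℝ, E) x.1 x.1,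
      extChartAt (𝓘(ℝ, ℂ).prod 𝓘(ℝ, ℂ)) x.2 x.2) := fun x => by
    rw [extChartAt_prod]; rfl
  have hrep := representedBy_twistorInChart h ha hb
  have hsq : ∀ (x : M × CP1 × CP1) (u : GenTangentSpace (twistorModel E) x),
      twistorStructure (fun α β => genFamily g I J K (a (α, β)) (b (α, β))) x
        (twistorStructure (fun α β => genFamily g I J K (a (α, β)) (b (α, β))) x u) = -u := by
    intro x u
    refine (twistorStructure_eq (a := a) (b := b) h x _).trans ?_
    refine (congrArg (twistorEnd (E := E) (g.inner x.1) (I x.1) (J x.1) (K x.1)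
      (spherePoint (a x.2)) (spherePoint (b x.2)))
      (twistorStructure_eq (a := a) (b := b) h x u)).trans ?_
    exact twistorEnd_sq (E := E) (g.pos x.1) (h.kahler_I.skew x.1) (h.kahler_J.skew x.1)
      (h.kahler_K.skew x.1) (h.quatRel x.1) (spherePoint_unit _) (spherePoint_unit _) u
  refine ⟨⟨smooth_of_representedBy fun x => ⟨_, hrep x, ?_⟩, ?_, hsq⟩,
    isInvolutive_of_jetIntegrable hsq fun x => ?_⟩
  · rw [hx]
    exact contDiffAt_twistorInChart h _ _ _ _ _ _
  · intro x u v
    have hpair : ∀ u v : (E × ℂ × ℂ) × (E × ℂ × ℂ →L[ℝ] ℝ),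
        pairing (twistorModel E) (x := x) u v = (1 / 2) * pairL v u := fun _ _ => rfl
    refine (congrArg₂ (pairing (twistorModel E) (x := x))
      (twistorStructure_eq (a := a) (b := b) h x u)
      (twistorStructure_eq (a := a) (b := b) h x v)).trans ?_
    refine (hpair _ _).trans (Eq.trans ?_ (hpair _ _).symm)
    exact congrArg ((1 / 2 : ℝ) * ·) (twistorEnd_orthogonal (E := E) (g.pos x.1) (g.symm x.1)
      (h.kahler_I.skew x.1) (h.kahler_J.skew x.1) (h.kahler_K.skew x.1) (h.quatRel x.1)
      (spherePoint_unit _) (spherePoint_unit _) u v)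
  · obtain ⟨Φ', h₁, h₂⟩ := exists_jetIntegrable_twistorInChart h (a x.2) (b x.2) ha.mulI hb.mulI x.1
      (extChartAt (𝓘(ℝ, ℂ).prod 𝓘(ℝ, ℂ)) x.2 x.2)
    rw [← hx] at h₁ h₂
    exact ⟨_, Φ', hrep x, h₁, h₂⟩

end Twistor

end GenTwistor

end

theorem mainTheorem1
    {E : Type*} [NormedAddCommGroup E] [NormedSpace ℝ E] [FiniteDimensional ℝ E]
    {M : Type*} [TopologicalSpace M] [T2Space M] [SecondCountableTopology M]
    [ChartedSpace E M] [IsManifold 𝓘(ℝ, E) ∞ M]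
    (g : GenTwistor.RiemannianMetric E M)
    (I J K : Π x : M, TangentSpace 𝓘(ℝ, E) x →L[ℝ] TangentSpace 𝓘(ℝ, E) x)
    (h : GenTwistor.IsHyperkahler g I J K) :
    GenTwistor.IsGenComplex (GenTwistor.twistorModel E)
        (GenTwistor.twistorStructure (fun α β => GenTwistor.genFamily g I J K α β)) ∧
      GenTwistor.IsGenComplex (GenTwistor.twistorModel E)
        (GenTwistor.twistorStructure (fun α β => GenTwistor.genFamily g I J K β α)) := by
  have h₁ := GenTwistor.isGenComplex_twistorStructure h GenTwistor.isChartProj_fst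
    GenTwistor.isChartProj_snd
  have h₂ := GenTwistor.isGenComplex_twistorStructure h GenTwistor.isChartProj_snd
    GenTwistor.isChartProj_fst
  exact ⟨h₁, h₂⟩
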